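/- **Setting.** A CSS code $Q$ is given by full-rank matrices $H^X\in\mathbb F_2^{m_x\times n}$, $H^Z\in\mathbb F_2^{m_z\times n}$ with $H^X(H^Z)^T=0$; its stabilizers are generated by $X^a$, $a$ a row of $H^X$, and $Z^b$, $b$ a row of $H^Z$. It is an $[[n,k,d]]$ code if $k=n-m_x-m_z$ and $d$ is the least weight of a vector in $(\ker H^Z\setminus\operatorname{row}H^X)\cup(\ker H^X\setminus\operatorname{row}H^Z)$ (which is assumed nonempty). It is $\ell$-LDPC if its stabilizer group is generated by Pauli checks of weight $\le\ell$ with at most $\ell$ of them acting nontrivially on any qubit. Call the matrices $H^X,H^Z$ sparse if all their rows and columns have weight $\le\ell$. *ATG state.* For $T\ge1$ the alternating Tanner graph has layers $1,\dots,2T+1$. Each layer carries $n$ code qubits, the copies of a code qubit on consecutive layers being joined. Odd layers also carry $m_z$ check qubits joined to the code qubits of that layer by the Tanner graph of $H^Z$; even layers carry $m_x$ check qubits joined by the Tanner graph of $H^X$. With $V$ its vertex set and $E$ its edge set, $|\mathrm{ATG}\rangle=\prod_{uv\in E}\mathsf{CZ}_{uv}|+\rangle^{\otimes V}$. *Unmeasured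 layers.* Let $1\le m\le T+1$. Odd layers $i_1<\dots<i_m$ are well separated if $i_1=1$, $i_m=2T+1$ (when $m\ge2$), and $i_{j+1}-i_j\ge T/m$. Let $\partial$ be the $mn$ code qubits on these layers and $\mathcal B=V\setminus\partial$ the bulk. *Target.* $|\overline{\mathrm{GHZ}_m^{\otimes k}}\rangle$ is the encoding of $k$ copies of $\mathrm{GHZ}_m=\frac1{\sqrt2}(|0\rangle^{\otimes m}+|1\rangle^{\otimes m})$ in $m$ blocks of $Q$, where the $a$-th copy uses the $a$-th logical qubit of every block, and $|\bar u\rangle=2^{-m_x/2}\sum_{h\in\operatorname{row}H^X}|\sum_a u_aL_a+h\rangle$ for a basis $L_1,\dots,L_k$ of $\ker H^Z$ modulo $\operatorname{row}H^X$. *Noise.* A random Pauli error $E$ is local stochastic of rate $p$ if $\Pr[S\subseteq\operatorname{supp}E]\le p^{|S|}$ for every set $S$ of qubits. **Theorem.** There are absolute constants $c,K>0$, and for every $\ell\ge1$ constants $p^*=p^*(\ell)\in(0,1)$ and $C=C(\ell)>0$ with $C\sqrt{p^*}\le1$, such that the following holds for all integers $T\ge1$, $1\le m\le T+1$ and every $\ell$-LDPC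 $[[n,k,d]]$ CSS code $Q$. Sparse full-rank parity check matrices for $Q$ exist, and so do well-separated layers. For every choice of such matrices, the ATG state has at most $K\ell nT$ qubits, and a circuit $W$ of Hadamard and $\mathsf{CZ}$ gates of depth at most $K\ell^2$ prepares it from $|0\rangle^{\otimes V}$. Moreover, for every choice of well-separated layers (and of $L$) there are functions $\mathsf{Rec}:\{0,1\}^{\mathcal B}\to\mathsf{Pauli}(\partial)$ and $\mathsf{Rep}:\mathsf{Pauli}(\mathcal B)\to\mathsf{Pauli}(\partial)$ such that for every bulk error $P$ and every measurement outcome $s$ there is $\gamma\in\mathbb C$ with $$\big(|\pm_s\rangle\langle\pm_s|_{\mathcal B}\otimes\mathsf{Rec}(s)\big)\,P\,W|0\rangle^{\otimes V}=\gamma\,|\pm_s\rangle\otimes\mathsf{Rep}(P)\,|\overline{\mathrm{GHZ}_m^{\otimes k}}\rangle ,$$ and there is a set $\mathrm{Success}\subseteq\mathsf{Pauli}(\mathcal B)$ of errors on which the residual error is free of logical errors (for $P\in\mathrm{Success}$, $\mathsf{Rep}(P)$ is the error that one fixed minimum-weight decoder of the $m$ blocks returns on the syndrome of $\mathsf{Rep}(P)$),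 such that whenever $0\le p<p^*$ and $P$ is a local stochastic error of rate $p$ on $\mathcal B$: 1. $\Pr[P\in\mathrm{Success}]\ \ge\ 1-nT\,(p/p^*)^{\,c\min(T/m,\,d)}$. 2. $\Pr[S\subseteq\operatorname{supp}\mathsf{Rep}(P)\text{ and }P\in\mathrm{Success}]\le(C\sqrt p)^{|S|}$ for every $S\subseteq\partial$; and if $\Pr[P\in\mathrm{Success}]\ge\frac12$, then, conditioned on $P\in\mathrm{Success}$, $\mathsf{Rep}(P)$ is local stochastic of rate $C\sqrt p$. -/

import Mathlib

open scoped Matrix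

namespace SingleShot

noncomputable section

/-! ### Qubit registers, Pauli operators, local stochastic noise -/

/-- (Unnormalized) pure states of a register of qubits labelled by `V`, as amplitude functions
on computational basis strings. -/
abbrev QState (V : Type) : Type := (V → ZMod 2) → ℂ

/-- Pauli operators modulo phase: the pair `(a, b)` is the operator `X^a Z^b`. -/
abbrev PauliOp (V : Type) : Type := (V → ZMod 2) × (V → ZMod 2)

/-- The sign `(-1)^b`. -/
def bsign (b : ZMod 2) : ℂ := if b = 0 then 1 else -1

/-- The qubits on which a Pauli operator acts nontrivially. -/
def supp {V : Type} (E : PauliOp V) : Set V := {v | E.1 v ≠ 0 ∨ E.2 v ≠ 0}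

/-- The action of `X^a Z^b` on states. -/
def applyPauli {V : Type} [Fintype V] (E : PauliOp V) (ψ : QState V) : QState V :=
  fun x => bsign (∑ v, E.2 v * (x v + E.1 v)) * ψ (x + E.1)

/-- The probability of the event `A` under the distribution `D`. -/
def prob {α : Type} (D : PMF α) (A : Set α) : ℝ := (D.toOuterMeasure A).toReal

/-- The conditional probability of `A` given `G` (only used when `G` has positive probability). -/
def condProb {α : Type} (D : PMF α) (A G : Set α) : ℝ := prob D (A ∩ G) / prob D G

/-- A random Pauli error is local stochastic of rate `p`: every set `S` of qubits is contained
in the support of the error with probability at most `p ^ |S|`. -/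
def IsLocalStochastic {V : Type} (D : PMF (PauliOp V)) (p : ℝ) : Prop :=
  ∀ S : Finset V, prob D {E | (S : Set V) ⊆ supp E} ≤ p ^ S.card

/-! ### Circuits -/

/-- Hadamard gates, and controlled-`Z` gates on two distinct qubits. -/
inductive Gate (V : Type) : Type
  | had (v : V) : Gate V
  | cz (u v : V) (h : u ≠ v) : Gate V

/-- The qubits a gate acts on. -/
def Gate.qubits {V : Type} : Gate V → Set V
  | .had v => {v}
  | .cz u v _ => {u, v}

/-- The unitary action of a gate. -/
def Gate.apply {V : Type} [DecidableEq V] : Gate V → QState V → QState V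
  | .had v, ψ => fun x => (1 / (Real.sqrt 2 : ℂ)) *
      ∑ b : ZMod 2, bsign (b * x v) * ψ (Function.update x v b)
  | .cz u v _, ψ => fun x => bsign (x u * x v) * ψ x

/-- A circuit is a list of layers; the gates inside one layer act on disjoint sets of qubits. -/
structure Circuit (V : Type) : Type where
  layers : List (List (Gate V))
  disjoint : ∀ L ∈ layers, L.Pairwise (fun g h => Disjoint g.qubits h.qubits)

/-- The depth of a circuit is its number of layers. -/
def Circuit.depth {V : Type} (W : Circuit V) : ℕ := W.layers.length

/-- The action of a circuit: its layers are applied from first to last. -/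
def Circuit.run {V : Type} [DecidableEq V] (W : Circuit V) (ψ : QState V) : QState V :=
  W.layers.foldl (fun φ L => L.foldl (fun χ g => g.apply χ) φ) ψ

/-- The state `|0…0⟩`. -/
def zeroState (V : Type) [Fintype V] : QState V := fun x => if x = 0 then 1 else 0

/-- The graph state `(∏_{uv ∈ E} CZ_{uv}) |+⟩^V`: the amplitude of the string `x` is
`2^(-|V|/2)` times `-1` for every edge with both endpoints in `{v | x v = 1}`. -/
def graphState {V : Type} [Fintype V] (G : SimpleGraph V) : QState V :=
  fun x => (1 / (Real.sqrt 2 : ℂ)) ^ Fintype.card V *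
    (-1 : ℂ) ^ Set.ncard {e : Sym2 V | e ∈ G.edgeSet ∧ ∀ v ∈ e, x v = 1}

/-! ### Measuring all qubits but a given set -/

/-- The qubits outside the range of `ι : D → V`; these are measured, while `D` labels the
unmeasured qubits. -/
abbrev Bulk {D V : Type} (ι : D → V) : Type := {v : V // v ∉ Set.range ι}

instance bulkFintype {D V : Type} [Fintype V] (ι : D → V) : Fintype (Bulk ι) :=
  Fintype.ofFinite _

open Classical in
/-- A Pauli operator on the bulk as a Pauli operator on all qubits. -/
def extendBulk {D V : Type} (ι : D → V) (E : PauliOp (Bulk ι)) : PauliOp V :=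
  (fun v => if h : v ∈ Set.range ι then 0 else E.1 ⟨v, h⟩,
   fun v => if h : v ∈ Set.range ι then 0 else E.2 ⟨v, h⟩)

open Classical in
/-- `(⟨±_s|_Bulk ⊗ 𝟙) ψ`: the unnormalized state of the unmeasured qubits after the bulk has been
measured in the basis `|±⟩` with outcome `s`. Thus
`(|±_s⟩⟨±_s| ⊗ 𝟙) ψ = |±_s⟩ ⊗ postMeasure ι s ψ`. -/
def postMeasure {D V : Type} [Fintype D] [Fintype V] (ι : D → V) (s : Bulk ι → ZMod 2)
    (ψ : QState V) : QState D :=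
  fun y => (1 / (Real.sqrt 2 : ℂ)) ^ Fintype.card (Bulk ι) *
    ∑ x : V → ZMod 2, if x ∘ ι = y then bsign (∑ v : Bulk ι, s v * x v) * ψ x else 0

/-- For every bulk error `P` and every outcome `s`, applying the error `P` to `ψ`, measuring the
bulk with outcome `s` and applying the correction `Rec s` leaves the unmeasured qubits in the state
`Rep P |target⟩`, up to a scalar:
`(|±_s⟩⟨±_s| ⊗ Rec s) P ψ = γ |±_s⟩ ⊗ Rep P |target⟩`. -/
def Prepares {D V : Type} [Fintype D] [Fintype V] (ι : D → V) (ψ : QState V)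
    (target : QState D) (Rec : (Bulk ι → ZMod 2) → PauliOp D)
    (Rep : PauliOp (Bulk ι) → PauliOp D) : Prop :=
  ∀ (P : PauliOp (Bulk ι)) (s : Bulk ι → ZMod 2), ∃ γ : ℂ,
    applyPauli (Rec s) (postMeasure ι s (applyPauli (extendBulk ι P) ψ)) =
      γ • applyPauli (Rep P) target

/-! ### CSS codes -/

/-- Two full-rank parity check matrices `H^X`, `H^Z` with `H^X (H^Z)ᵀ = 0`. -/
structure CSSCode (n mx mz : ℕ) : Type where
  HX : Matrix (Fin mx) (Fin n) (ZMod 2)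
  HZ : Matrix (Fin mz) (Fin n) (ZMod 2)
  fullRankX : LinearIndependent (ZMod 2) HX.row
  fullRankZ : LinearIndependent (ZMod 2) HZ.row
  orthogonal : HX * HZᵀ = 0

namespace CSSCode

variable {n mx mz : ℕ}

/-- The row space of `H^X`: the supports of the `X`-type stabilizers. -/
def rowX (Q : CSSCode n mx mz) : Submodule (ZMod 2) (Fin n → ZMod 2) :=
  Submodule.span (ZMod 2) (Set.range Q.HX.row)

/-- The row space of `H^Z`: the supports of the `Z`-type stabilizers. -/
def rowZ (Q : CSSCode n mx mz) : Submodule (ZMod 2) (Fin n → ZMod 2) :=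
  Submodule.span (ZMod 2) (Set.range Q.HZ.row)

/-- Two pairs of parity check matrices define the same code. -/
def SameCode (Q Q' : CSSCode n mx mz) : Prop := Q.rowX = Q'.rowX ∧ Q.rowZ = Q'.rowZ

/-- The code has `k` logical qubits and distance `d`, the least weight of a nontrivial logical
operator of type `X` or `Z`. -/
def HasParams (Q : CSSCode n mx mz) (k d : ℕ) : Prop :=
  k + mx + mz = n ∧
  IsLeast {w | ∃ y : Fin n → ZMod 2,
    ((Q.HZ *ᵥ y = 0 ∧ y ∉ Q.rowX) ∨ (Q.HX *ᵥ y = 0 ∧ y ∉ Q.rowZ)) ∧ hammingNorm y = w} d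

/-- The code is `ℓ`-LDPC: its stabilizer group is generated by some list of Pauli checks, each of
weight at most `ℓ`, with at most `ℓ` of them acting nontrivially on any given qubit. -/
def IsLDPC (Q : CSSCode n mx mz) (ℓ : ℕ) : Prop :=
  ∃ (r : ℕ) (g : Fin r → PauliOp (Fin n)),
    Submodule.span (ZMod 2) (Set.range g) = Q.rowX.prod Q.rowZ ∧
    (∀ c, (supp (g c)).ncard ≤ ℓ) ∧ (∀ i, {c | i ∈ supp (g c)}.ncard ≤ ℓ)

/-- Rows and columns of the parity check matrices themselves have weight at most `ℓ`. -/
def Sparse (Q : CSSCode n mx mz) (ℓ : ℕ) : Prop :=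
  (∀ c, hammingNorm (Q.HX c) ≤ ℓ) ∧ (∀ c, hammingNorm (Q.HZ c) ≤ ℓ) ∧
  (∀ i, hammingNorm (Q.HXᵀ i) ≤ ℓ) ∧ (∀ i, hammingNorm (Q.HZᵀ i) ≤ ℓ)

/-- `L 1, …, L k` are the supports of logical `X` operators of the `k` logical qubits: they form
a basis of `ker H^Z` modulo the row space of `H^X`. -/
def IsLogicalBasis (Q : CSSCode n mx mz) {k : ℕ} (L : Fin k → Fin n → ZMod 2) : Prop :=
  (∀ a, Q.HZ *ᵥ L a = 0) ∧
  LinearIndependent (ZMod 2) (fun a => Q.rowX.mkQ (L a)) ∧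
  ∀ y : Fin n → ZMod 2, Q.HZ *ᵥ y = 0 → ∃ u : Fin k → ZMod 2, y - ∑ a, u a • L a ∈ Q.rowX

open Classical in
/-- The encoded computational basis state
`|ū⟩ = 2^(-m_x/2) ∑_{h ∈ rowspace H^X} |∑ u_a L_a + h⟩`. -/
def encodedBasis (Q : CSSCode n mx mz) {k : ℕ} (L : Fin k → Fin n → ZMod 2)
    (u : Fin k → ZMod 2) : QState (Fin n) :=
  fun x => if x - ∑ a, u a • L a ∈ Q.rowX then (1 / (Real.sqrt 2 : ℂ)) ^ mx else 0

/-- The encoding of a state of `m` blocks of `k` logical qubits into `m` copies of the code. -/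
def encode (Q : CSSCode n mx mz) {k : ℕ} (L : Fin k → Fin n → ZMod 2) {m : ℕ}
    (ψ : QState (Fin m × Fin k)) : QState (Fin m × Fin n) :=
  fun x => ∑ y : Fin m × Fin k → ZMod 2,
    ψ y * ∏ j : Fin m, Q.encodedBasis L (fun a => y (j, a)) (fun i => x (j, i))

/-- The syndromes of an error on `m` copies of the code: the `X` checks see its `Z` part and the
`Z` checks its `X` part. -/
def syndrome (Q : CSSCode n mx mz) {m : ℕ} (E : PauliOp (Fin m × Fin n)) :
    Fin m → (Fin mx → ZMod 2) × (Fin mz → ZMod 2) :=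
  fun j => (Q.HX *ᵥ (fun i => E.2 (j, i)), Q.HZ *ᵥ (fun i => E.1 (j, i)))

/-- A minimum-weight decoder for `m` copies of the code: it sends the syndrome of an error to an
error with that syndrome whose `X` part and whose `Z` part have the least possible weight. -/
def IsMinWeightDecoder (Q : CSSCode n mx mz) {m : ℕ}
    (dec : (Fin m → (Fin mx → ZMod 2) × (Fin mz → ZMod 2)) → PauliOp (Fin m × Fin n)) : Prop :=
  ∀ E, Q.syndrome (dec (Q.syndrome E)) = Q.syndrome E ∧
    hammingNorm (dec (Q.syndrome E)).1 ≤ hammingNorm E.1 ∧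
    hammingNorm (dec (Q.syndrome E)).2 ≤ hammingNorm E.2

end CSSCode

/-- The state `GHZ_m = (|0…0⟩ + |1…1⟩)/√2` of `m` qubits. -/
def ghz (m : ℕ) : QState (Fin m) :=
  fun y => (if y = 0 then 1 / (Real.sqrt 2 : ℂ) else 0) + (if y = 1 then 1 / (Real.sqrt 2 : ℂ) else 0)

/-- `k` copies of `GHZ_m`; the `a`-th copy is formed by the `a`-th qubits of the `m` blocks. -/
def ghzPow (m k : ℕ) : QState (Fin m × Fin k) := fun y => ∏ a : Fin k, ghz m (fun j => y (j, a))

/-! ### The alternating Tanner graph -/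

/-- The layers `1, …, 2T+1` are indexed by `t = 0, …, 2T`. Vertices are
`(t, i)`: code qubit `i` on layer `t + 1`;
`(r, c)` with `r ≤ T`: `Z` check qubit `c` on the odd layer `2r + 1`;
`(r, c)` with `r < T`: `X` check qubit `c` on the even layer `2r + 2`. -/
abbrev ATGVertex (n mx mz T : ℕ) : Type :=
  (Fin (2 * T + 1) × Fin n) ⊕ (Fin (T + 1) × Fin mz) ⊕ (Fin T × Fin mx)

/-- The edges, each listed in one direction: vertical edges between copies of a code qubit on
consecutive layers, the `Z` Tanner graph on odd layers, the `X` Tanner graph on even layers. -/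
def atgRel {n mx mz : ℕ} (Q : CSSCode n mx mz) (T : ℕ) :
    ATGVertex n mx mz T → ATGVertex n mx mz T → Prop
  | .inl (t, i), .inl (t', i') => i = i' ∧ t'.val = t.val + 1
  | .inl (t, i), .inr (.inl (r, c)) => t.val = 2 * r.val ∧ Q.HZ c i = 1
  | .inl (t, i), .inr (.inr (r, c)) => t.val = 2 * r.val + 1 ∧ Q.HX c i = 1
  | _, _ => False

/-- The alternating Tanner graph. -/
def atg {n mx mz : ℕ} (Q : CSSCode n mx mz) (T : ℕ) : SimpleGraph (ATGVertex n mx mz T) :=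
  SimpleGraph.fromRel (atgRel Q T)

/-- The alternating Tanner graph state. -/
def atgState {n mx mz : ℕ} (Q : CSSCode n mx mz) (T : ℕ) : QState (ATGVertex n mx mz T) :=
  graphState (atg Q T)

/-- The `j`-th unmeasured layer is the odd layer `i_j = 2 σ(j) + 1`. These layers increase, start
with layer `1`, end (if there is more than one) with layer `2T + 1`, and consecutive ones satisfy
`i_{j+1} - i_j ≥ T / m`. -/
structure WellSeparated {m T : ℕ} (σ : Fin m → Fin (T + 1)) : Prop where
  mono : StrictMono σ
  first : ∀ j : Fin m, j.val = 0 → (σ j).val = 0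
  last : ∀ j : Fin m, 2 ≤ m → j.val + 1 = m → (σ j).val = T
  gap : ∀ j j' : Fin m, j'.val = j.val + 1 →
    (T : ℝ) / m ≤ ((2 * (σ j').val + 1 : ℕ) : ℝ) - ((2 * (σ j).val + 1 : ℕ) : ℝ)

/-- The code qubits on the unmeasured layers. -/
def surface (n mx mz : ℕ) {m T : ℕ} (σ : Fin m → Fin (T + 1)) :
    Fin m × Fin n → ATGVertex n mx mz T :=
  fun q => .inl (⟨2 * (σ q.1).val, by have := (σ q.1).isLt; omega⟩, q.2)

end

end SingleShot

open SingleShot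

namespace SingleShot
noncomputable section

/-! ### Signs -/

/-! Let `A` be the adjacency matrix of the graph. The operator `X^η Z^(Aη)` fixes the graph state up
to sign. When the bulk is measured in the X basis, an X error there contributes only a sign and a Z
error flips outcomes. Hence the outcome `(Aη)_bulk` leaves the surface in the state of outcome 0, up
to the Pauli error given by `η` and `Aη` on the surface (`postMeasure_adj`). Outcomes not of this
form have amplitude zero (`postMeasure_eq_zero`). The state of outcome 0 is identified by its X and
Z stabilizers as the encoded GHZ state (`postMeasure_zero_eq`).

What remains is a decoding problem over `ZMod 2`. Error positions are all qubits (Z errors) and the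
unmeasured qubits a second time (X errors). Since `H^X (H^Z)ᵀ = 0`, stabilizers satisfy parity
checks, each involving at most `ℓ + 2` positions. Conversely, an error violating no check is a
stabilizer unless its sums over layers represent a logical operator of the code. So an undetected
error of weight below `d` is trivial (`mem_fullSub_of_card_lt`), and an undetected bulk error
smaller than the gaps between unmeasured layers can be completed on these layers while at most
doubling its weight (`exists_push`).

The recovery takes a bulk correction of minimum weight in the coset determined by the outcome. The
actual error plus this correction, completed on the surface by the minimum-weight decoder, is an
undetected error `x`. The support of `x` falls into clusters, connected through common checks. If no
large cluster consists of actual errors to at least one quarter, then two exchange arguments, one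
for the bulk correction and one for the surface decoder, show that every cluster of `x` consists of
actual errors to at least one quarter (`residual_of_small_clusters`). All clusters of `x` are then
small, so `x` is trivial and no logical error occurs. The number of clusters grows exponentially in
their size with a base depending only on `ℓ` (`card_rooted_le`), so a union bound
(`prob_cluster_le`) gives both probability estimates. The rate is `√p` because covering a set `S` of
surface qubits forces only `|S|/2` actual errors. -/

lemma zmod2_eq (a : ZMod 2) : a = 0 ∨ a = 1 := by revert a; decide

@[simp] lemma bsign_zero : bsign 0 = 1 := by simp [bsign]

@[simp] lemma bsign_one : bsign 1 = -1 := by simp [bsign]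

lemma bsign_add (a b : ZMod 2) : bsign (a + b) = bsign a * bsign b := by
  have h : (1 + 1 : ZMod 2) = 0 := by decide
  rcases zmod2_eq a with rfl | rfl <;> rcases zmod2_eq b with rfl | rfl <;> simp [h]

lemma bsign_mul_self (a : ZMod 2) : bsign a * bsign a = 1 := by
  rcases zmod2_eq a with rfl | rfl <;> simp

lemma bsign_natCast (k : ℕ) : bsign (k : ZMod 2) = (-1) ^ k := by
  induction k with
  | zero => simp
  | succ k ih => rw [Nat.cast_succ, bsign_add, ih, bsign_one, pow_succ]

/-! ### Graph states of bipartite relations -/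

open Classical in
/-- The adjacency matrix of a relation, over `ZMod 2`. -/
def relMatrix {V : Type} (R : V → V → Prop) : Matrix V V (ZMod 2) :=
  fun u v => if R u v then 1 else 0

/-- The adjacency matrix of the symmetric closure of an asymmetric relation. -/
def adjMatrix2 {V : Type} (R : V → V → Prop) : Matrix V V (ZMod 2) :=
  relMatrix R + (relMatrix R)ᵀ

lemma dotProduct_relMatrix {V : Type} [Fintype V] (R : V → V → Prop) (x : V → ZMod 2) :
    x ⬝ᵥ relMatrix R *ᵥ x =
      (({p : V × V | R p.1 p.2 ∧ x p.1 = 1 ∧ x p.2 = 1} : Set (V × V)).ncard : ZMod 2) := by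
  classical
  have hset : ({p : V × V | R p.1 p.2 ∧ x p.1 = 1 ∧ x p.2 = 1} : Set (V × V)) =
      ((Finset.univ.filter fun p : V × V => R p.1 p.2 ∧ x p.1 = 1 ∧ x p.2 = 1 :
        Finset (V × V)) : Set (V × V)) := by ext; simp
  rw [hset, Set.ncard_coe_finset, Finset.card_filter, Nat.cast_sum, Fintype.sum_prod_type]
  simp only [dotProduct, Matrix.mulVec, Finset.mul_sum]
  refine Finset.sum_congr rfl fun u _ => Finset.sum_congr rfl fun v _ => ?_
  rcases zmod2_eq (x u) with h | h <;> rcases zmod2_eq (x v) with h' | h' <;>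
    by_cases hR : R u v <;> simp [relMatrix, h, h', hR]

/-- Asymmetry of `R` makes every edge come from exactly one ordered pair, so the number of occupied
edges has the parity of the quadratic form of `relMatrix R`. -/
lemma graphState_fromRel {V : Type} [Fintype V] {R : V → V → Prop}
    (hR : ∀ u v, R u v → ¬ R v u) (x : V → ZMod 2) :
    graphState (SimpleGraph.fromRel R) x =
      (1 / (Real.sqrt 2 : ℂ)) ^ Fintype.card V * bsign (x ⬝ᵥ relMatrix R *ᵥ x) := by
  classical
  rw [graphState, dotProduct_relMatrix, bsign_natCast]
  congr 2
  have himg : {e : Sym2 V | e ∈ (SimpleGraph.fromRel R).edgeSet ∧ ∀ v ∈ e, x v = 1} =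
      (fun p : V × V => s(p.1, p.2)) ''
        {p : V × V | R p.1 p.2 ∧ x p.1 = 1 ∧ x p.2 = 1} := by
    ext e
    induction e using Sym2.ind with
    | _ u v =>
      constructor
      · rintro ⟨h, hx⟩
        rw [SimpleGraph.mem_edgeSet, SimpleGraph.fromRel_adj] at h
        have hu := hx u (by simp)
        have hv := hx v (by simp)
        rcases h.2 with h | h
        · exact ⟨(u, v), ⟨h, hu, hv⟩, rfl⟩
        · exact ⟨(v, u), ⟨h, hv, hu⟩, Sym2.eq_swap⟩
      · rintro ⟨⟨a, b⟩, ⟨h, ha, hb⟩, he⟩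
        simp only at he h ha hb
        rw [← he]
        refine ⟨?_, ?_⟩
        · rw [SimpleGraph.mem_edgeSet, SimpleGraph.fromRel_adj]
          exact ⟨fun hab => hR a b h (by rw [← hab] at h ⊢; exact h), Or.inl h⟩
        · intro w hw
          rcases Sym2.mem_iff.mp hw with rfl | rfl <;> assumption
  rw [himg, Set.InjOn.ncard_image]
  rintro ⟨a, b⟩ ⟨h, -⟩ ⟨a', b'⟩ ⟨h', -⟩ he
  simp only [Sym2.eq_iff] at he h h'
  rcases he with ⟨rfl, rfl⟩ | ⟨rfl, rfl⟩
  · rfl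
  · exact absurd h' (hR _ _ h)

/-! ### Pauli operators and the measurement of the bulk -/

lemma applyPauli_zero {V : Type} [Fintype V] (ψ : QState V) :
    applyPauli ((0, 0) : PauliOp V) ψ = ψ := by
  funext x; simp [applyPauli]

lemma applyPauli_smul {V : Type} [Fintype V] (E : PauliOp V) (γ : ℂ) (ψ : QState V) :
    applyPauli E (γ • ψ) = γ • applyPauli E ψ := by
  funext x; simp [applyPauli]; ring

lemma applyPauli_applyPauli {V : Type} [Fintype V] (E F : PauliOp V) (ψ : QState V) :
    applyPauli E (applyPauli F ψ) =
      bsign (∑ v, E.2 v * F.1 v) • applyPauli (E + F) ψ := by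
  funext x
  simp only [applyPauli, Pi.smul_apply, smul_eq_mul, Prod.fst_add, Prod.snd_add, Pi.add_apply]
  rw [← mul_assoc, ← mul_assoc, ← bsign_add, ← bsign_add, ← Finset.sum_add_distrib,
    ← Finset.sum_add_distrib, add_assoc]
  congr 2
  refine Finset.sum_congr rfl fun v _ => ?_
  have h : E.2 v * F.1 v + E.2 v * F.1 v = 0 := ZModModule.add_self _
  linear_combination -h

/-- The restriction of a vector on all qubits to the bulk. -/
def toBulk {D V : Type} (ι : D → V) (η : V → ZMod 2) : Bulk ι → ZMod 2 := fun v => η v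

lemma sum_eq_sum_bulk_add {D V M : Type} [Fintype D] [Fintype V] [AddCommMonoid M] {ι : D → V}
    (hι : Function.Injective ι) (f : V → M) :
    ∑ v, f v = ∑ v : Bulk ι, f v + ∑ q, f (ι q) := by
  classical
  rw [← Finset.sum_filter_add_sum_filter_not Finset.univ (fun v => v ∉ Set.range ι)]
  congr 1
  · exact Finset.sum_subtype (F := bulkFintype ι) _ (p := fun v => v ∉ Set.range ι)
      (fun v => by simp) f
  · rw [← Finset.sum_image (s := Finset.univ) (g := ι) (f := f) (hι.injOn)]
    exact Finset.sum_congr (by ext; simp) fun _ _ => rfl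

lemma postMeasure_smul {D V : Type} [Fintype D] [Fintype V] (ι : D → V) (s : Bulk ι → ZMod 2)
    (γ : ℂ) (ψ : QState V) : postMeasure ι s (γ • ψ) = γ • postMeasure ι s ψ := by
  funext y
  simp only [postMeasure, Pi.smul_apply, smul_eq_mul, Finset.mul_sum]
  refine Finset.sum_congr rfl fun x _ => ?_
  split_ifs
  · ring
  · simp

/-- A Pauli operator applied before the bulk is measured shifts the outcome by its `Z` part on the
bulk, and acts on the unmeasured qubits by its restriction to them. -/
lemma postMeasure_applyPauli {D V : Type} [Fintype D] [Fintype V] {ι : D → V}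
    (hι : Function.Injective ι) (s : Bulk ι → ZMod 2) (F : PauliOp V) (ψ : QState V) :
    postMeasure ι s (applyPauli F ψ) =
      bsign (∑ v : Bulk ι, s v * F.1 v) •
        applyPauli (F.1 ∘ ι, F.2 ∘ ι) (postMeasure ι (s + toBulk ι F.2) ψ) := by
  classical
  funext y
  simp only [postMeasure, applyPauli, Pi.smul_apply, smul_eq_mul]
  -- Translating the summation variable by the X part undoes the bit flips, at the price of signs
  -- from the measured characters.
  rw [← Equiv.sum_comp (Equiv.addRight F.1) (fun x : V → ZMod 2 => if x ∘ ι = y then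
    bsign (∑ v : Bulk ι, s v * x v) * (bsign (∑ v, F.2 v * (x v + F.1 v)) * ψ (x + F.1)) else 0)]
  rw [mul_left_comm (bsign _) (_ ^ _), mul_left_comm (bsign _) (_ ^ _)]
  refine congrArg _ ?_
  rw [Finset.mul_sum, Finset.mul_sum]
  refine Finset.sum_congr rfl fun x _ => ?_
  have hxx : x + F.1 + F.1 = x := by rw [add_assoc, ZModModule.add_self, add_zero]
  have hcond : ((Equiv.addRight F.1) x ∘ ι = y) ↔ (x ∘ ι = y + F.1 ∘ ι) := by
    constructor
    · intro h
      rw [← h]; funext q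
      simp only [Equiv.coe_addRight, Function.comp, Pi.add_apply, add_assoc,
        ZModModule.add_self, add_zero]
    · intro h
      funext q
      have := congrFun h q
      simp only [Equiv.coe_addRight, Function.comp, Pi.add_apply] at this ⊢
      rw [this, add_assoc, ZModModule.add_self, add_zero]
  by_cases hc : x ∘ ι = y + F.1 ∘ ι
  · rw [if_pos (hcond.mpr hc), if_pos hc]
    simp only [Equiv.coe_addRight, hxx]
    rw [← mul_assoc, ← mul_assoc, ← mul_assoc, ← bsign_add, ← bsign_add, ← bsign_add]
    congr 2
    rw [sum_eq_sum_bulk_add (M := ZMod 2) hι]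
    have h1 : ∀ q, y q + F.1 (ι q) = x (ι q) := fun q => by
      have := congrFun hc q; simpa using this.symm
    simp only [Function.comp, h1, Pi.add_apply, toBulk, add_assoc, ZModModule.add_self, add_zero,
      mul_add, add_mul, Finset.sum_add_distrib]
    ring
  · rw [if_neg (fun h => hc (hcond.mp h)), if_neg hc]; simp

/-- This reduces the analysis of bulk errors to their Z parts. -/
lemma postMeasure_extendBulk {D V : Type} [Fintype D] [Fintype V] {ι : D → V}
    (hι : Function.Injective ι) (s : Bulk ι → ZMod 2) (P : PauliOp (Bulk ι)) (ψ : QState V) :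
    ∃ γ : ℂ, postMeasure ι s (applyPauli (extendBulk ι P) ψ) =
      γ • postMeasure ι (s + P.2) ψ := by
  have h1 : (extendBulk ι P).1 ∘ ι = 0 := by funext q; simp [extendBulk]
  have h2 : (extendBulk ι P).2 ∘ ι = 0 := by funext q; simp [extendBulk]
  have h3 : toBulk ι (extendBulk ι P).2 = P.2 := by
    funext v
    have := v.2
    simp only [toBulk, extendBulk, dif_neg this]
  have h := postMeasure_applyPauli hι s (extendBulk ι P) ψ
  rw [h1, h2, h3, applyPauli_zero] at h
  exact ⟨_, h⟩

/-! ### Stabilizers of graph states -/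

section Stabilizer

variable {V : Type} [Fintype V] {R : V → V → Prop}

lemma dotProduct_relMatrix_add (x δ : V → ZMod 2) :
    (x + δ) ⬝ᵥ relMatrix R *ᵥ (x + δ) =
      x ⬝ᵥ relMatrix R *ᵥ x + δ ⬝ᵥ relMatrix R *ᵥ δ + x ⬝ᵥ adjMatrix2 R *ᵥ δ := by
  have h : δ ⬝ᵥ relMatrix R *ᵥ x = x ⬝ᵥ (relMatrix R)ᵀ *ᵥ δ := by
    rw [Matrix.mulVec_transpose, dotProduct_comm x, ← Matrix.dotProduct_mulVec]
  simp only [adjMatrix2, Matrix.add_mulVec, Matrix.mulVec_add, dotProduct_add, add_dotProduct, h]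
  ring

lemma dotProduct_adjMatrix2_self (δ : V → ZMod 2) : δ ⬝ᵥ adjMatrix2 R *ᵥ δ = 0 := by
  have h : δ ⬝ᵥ (relMatrix R)ᵀ *ᵥ δ = δ ⬝ᵥ relMatrix R *ᵥ δ := by
    rw [Matrix.mulVec_transpose, dotProduct_comm, ← Matrix.dotProduct_mulVec]
  rw [adjMatrix2, Matrix.add_mulVec, dotProduct_add, h, ZModModule.add_self]

/-- An independent set contains no edges, so the stabilizers built on one carry no sign. -/
lemma dotProduct_relMatrix_eq_zero {δ : V → ZMod 2}
    (h : ∀ u v, δ u ≠ 0 → δ v ≠ 0 → ¬ R u v) : δ ⬝ᵥ relMatrix R *ᵥ δ = 0 := by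
  refine Finset.sum_eq_zero fun u _ => ?_
  by_cases hu : δ u = 0
  · simp [hu]
  · rw [Matrix.mulVec, dotProduct, Finset.sum_eq_zero, mul_zero]
    intro v _
    by_cases hv : δ v = 0
    · simp [hv]
    · simp [relMatrix, h u v hu hv]

/-- `adjMatrix2 R` is the polar form of the quadratic form in the amplitudes. Translation by `δ`
therefore changes the amplitude by a character, which the Z part cancels because the polar form is
alternating, and by the constant sign counting edges inside `δ`. -/
lemma applyPauli_graphState (hR : ∀ u v, R u v → ¬ R v u) (δ : V → ZMod 2) :
    applyPauli (δ, adjMatrix2 R *ᵥ δ) (graphState (SimpleGraph.fromRel R)) =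
      bsign (δ ⬝ᵥ relMatrix R *ᵥ δ) • graphState (SimpleGraph.fromRel R) := by
  funext x
  simp only [applyPauli, Pi.smul_apply, smul_eq_mul, graphState_fromRel hR,
    dotProduct_relMatrix_add x δ]
  rw [mul_left_comm, mul_left_comm (bsign _), ← bsign_add, ← bsign_add]
  congr 2
  have h : ∑ v, (adjMatrix2 R *ᵥ δ) v * (x v + δ v) =
      x ⬝ᵥ adjMatrix2 R *ᵥ δ + δ ⬝ᵥ adjMatrix2 R *ᵥ δ := by
    simp only [dotProduct, ← Finset.sum_add_distrib]
    exact Finset.sum_congr rfl fun v _ => by ring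
  rw [h, dotProduct_adjMatrix2_self]
  have h2 := ZModModule.add_self (x ⬝ᵥ adjMatrix2 R *ᵥ δ)
  linear_combination h2

/-- The state of the unmeasured qubits for the outcome `(Adj η)_bulk`. -/
lemma postMeasure_adj {D : Type} [Fintype D] {ι : D → V} (hι : Function.Injective ι)
    (hR : ∀ u v, R u v → ¬ R v u) (η : V → ZMod 2) :
    ∃ γ : ℂ, postMeasure ι (toBulk ι (adjMatrix2 R *ᵥ η)) (graphState (SimpleGraph.fromRel R)) =
      γ • applyPauli (η ∘ ι, (adjMatrix2 R *ᵥ η) ∘ ι)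
        (postMeasure ι 0 (graphState (SimpleGraph.fromRel R))) := by
  have h1 := postMeasure_applyPauli hι (toBulk ι (adjMatrix2 R *ᵥ η)) (η, adjMatrix2 R *ᵥ η)
    (graphState (SimpleGraph.fromRel R))
  rw [applyPauli_graphState hR, postMeasure_smul] at h1
  simp only [ZModModule.add_self] at h1
  set a := bsign (η ⬝ᵥ relMatrix R *ᵥ η) with ha
  refine ⟨a * bsign (∑ v : Bulk ι, toBulk ι (adjMatrix2 R *ᵥ η) v * η v), ?_⟩
  rw [mul_smul, ← h1, smul_smul, ha, bsign_mul_self, one_smul]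

/-- The state of the unmeasured qubits is stabilized by the operators that stabilize the graph
state and commute with the measurement. -/
lemma postMeasure_stabilizer {D : Type} [Fintype D] {ι : D → V} (hι : Function.Injective ι)
    (hR : ∀ u v, R u v → ¬ R v u) {δ : V → ZMod 2} (hδ : δ ⬝ᵥ relMatrix R *ᵥ δ = 0)
    (hb : ∀ v : Bulk ι, (adjMatrix2 R *ᵥ δ) v = 0) (s : Bulk ι → ZMod 2) :
    postMeasure ι s (graphState (SimpleGraph.fromRel R)) =
      bsign (∑ v : Bulk ι, s v * δ v) •
      applyPauli (δ ∘ ι, (adjMatrix2 R *ᵥ δ) ∘ ι)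
        (postMeasure ι s (graphState (SimpleGraph.fromRel R))) := by
  have h1 := postMeasure_applyPauli hι s (δ, adjMatrix2 R *ᵥ δ)
    (graphState (SimpleGraph.fromRel R))
  rw [applyPauli_graphState hR, postMeasure_smul, hδ, bsign_zero, one_smul] at h1
  have h0 : toBulk ι (adjMatrix2 R *ᵥ δ) = 0 := funext hb
  simpa [h0] using h1

end Stabilizer

/-! ### Preparing graph states from edge colourings -/

section Circuit

variable {V : Type} [DecidableEq V]

lemma apply_had (v : V) (ψ : QState V) (x : V → ZMod 2) :
    (Gate.had v).apply ψ x = (1 / (Real.sqrt 2 : ℂ)) *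
      ∑ b : ZMod 2, bsign (b * x v) * ψ (Function.update x v b) := rfl

lemma apply_cz (u v : V) (h : u ≠ v) (ψ : QState V) (x : V → ZMod 2) :
    (Gate.cz u v h).apply ψ x = bsign (x u * x v) * ψ x := rfl

lemma foldl_had [Fintype V] {l : List V} (hl : l.Nodup) (x : V → ZMod 2) :
    (l.map Gate.had).foldl (fun χ g => g.apply χ) (zeroState V) x =
      (1 / (Real.sqrt 2 : ℂ)) ^ l.length * if ∀ v ∉ l, x v = 0 then 1 else 0 := by
  induction l using List.reverseRecOn generalizing x with
  | nil =>
    simp only [List.map_nil, List.foldl_nil, zeroState, List.length_nil, pow_zero, one_mul]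
    congr 1
    simp [funext_iff]
  | append_singleton l v ih =>
    have hl' := List.nodup_append.mp hl
    have hv : v ∉ l := fun h => hl'.2.2 v h v (by simp) rfl
    rw [List.map_append, List.foldl_append]
    simp only [List.map_cons, List.map_nil, List.foldl_cons, List.foldl_nil, apply_had]
    simp only [ih hl'.1, List.length_append, List.length_singleton, pow_succ]
    have h2 : ∀ f : ZMod 2 → ℂ, ∑ b, f b = f 0 + f 1 := fun f => Fin.sum_univ_two f
    rw [h2]
    have h1 : ¬ ∀ w ∉ l, Function.update x v 1 w = 0 := fun h => by simpa using h v hv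
    have h0 : (∀ w ∉ l, Function.update x v 0 w = 0) ↔ ∀ w ∉ l ++ [v], x w = 0 := by
      constructor
      · intro h w hw
        simp only [List.mem_append, List.mem_singleton, not_or] at hw
        simpa [Function.update_of_ne hw.2] using h w hw.1
      · intro h w hw
        by_cases hwv : w = v
        · subst hwv; simp
        · rw [Function.update_of_ne hwv]
          exact h w (by simp [hw, hwv])
    rw [if_neg h1]
    simp only [h0, zero_mul, bsign_zero, mul_zero, add_zero, one_mul]
    ring

lemma foldl_cz {R : V → V → Prop} (hne : ∀ u v, R u v → u ≠ v)
    (l : List {p : V × V // R p.1 p.2}) (φ : QState V) (x : V → ZMod 2) :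
    (l.map fun e => Gate.cz e.1.1 e.1.2 (hne _ _ e.2)).foldl (fun χ g => g.apply χ) φ x =
      bsign (l.map fun e => x e.1.1 * x e.1.2).sum * φ x := by
  induction l generalizing φ with
  | nil => simp
  | cons e l ih =>
    simp only [List.map_cons, List.foldl_cons, List.sum_cons, ih, apply_cz, bsign_add]
    ring

lemma foldl_czLayers {κ : Type} {R : V → V → Prop} (hne : ∀ u v, R u v → u ≠ v)
    (L : κ → List {p : V × V // R p.1 p.2}) (l : List κ) (φ : QState V) (x : V → ZMod 2) :
    (l.map fun c => (L c).map fun e => Gate.cz e.1.1 e.1.2 (hne _ _ e.2)).foldl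
        (fun φ L => L.foldl (fun χ g => g.apply χ) φ) φ x =
      bsign (l.map fun c => ((L c).map fun e => x e.1.1 * x e.1.2).sum).sum * φ x := by
  induction l generalizing φ with
  | nil => simp
  | cons c l ih =>
    simp only [List.map_cons, List.foldl_cons, List.sum_cons, ih, foldl_cz, bsign_add]
    ring

/-- A graph state whose edges are coloured so that edges of one colour are disjoint is prepared
by one layer of Hadamard gates and one layer of `CZ` gates for each colour. -/
theorem exists_circuit_graphState [Fintype V] {κ : Type} [Fintype κ] {R : V → V → Prop}
    (hR : ∀ u v, R u v → ¬ R v u) (col : V → V → κ)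
    (hcol : ∀ u v u' v', R u v → R u' v' → col u v = col u' v' → (u, v) ≠ (u', v') →
      Disjoint ({u, v} : Set V) {u', v'}) :
    ∃ W : Circuit V, W.depth = Fintype.card κ + 1 ∧
      W.run (zeroState V) = graphState (SimpleGraph.fromRel R) := by
  classical
  have hne : ∀ u v, R u v → u ≠ v := fun u v h huv => hR u v h (by rw [huv] at h ⊢; exact h)
  let L : κ → List {p : V × V // R p.1 p.2} := fun c =>
    (Finset.univ.filter fun e : {p : V × V // R p.1 p.2} => col e.1.1 e.1.2 = c).toList
  let Ls : List (List (Gate V)) := (Finset.univ : Finset κ).toList.map fun c =>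
    (L c).map fun e => Gate.cz e.1.1 e.1.2 (hne _ _ e.2)
  refine ⟨⟨((Finset.univ : Finset V).toList.map Gate.had) :: Ls, ?_⟩, ?_, ?_⟩
  · intro l hl
    rcases List.mem_cons.mp hl with rfl | hl
    · rw [List.pairwise_map]
      refine (Finset.nodup_toList _).imp ?_
      intro a b hab
      simpa [Gate.qubits] using hab
    · obtain ⟨c, -, rfl⟩ := List.mem_map.mp hl
      rw [List.pairwise_map]
      refine (Finset.nodup_toList _).imp_of_mem ?_
      intro e e' he he' hee
      have h1 : col e.1.1 e.1.2 = c := by simpa [L] using he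
      have h2 : col e'.1.1 e'.1.2 = c := by simpa [L] using he'
      exact hcol _ _ _ _ e.2 e'.2 (h1.trans h2.symm) fun h => hee (Subtype.ext h)
  · simp [Circuit.depth, Ls]
  · funext x
    simp only [Circuit.run, List.foldl_cons]
    rw [foldl_czLayers, foldl_had (Finset.nodup_toList _), graphState_fromRel hR]
    simp only [Finset.mem_toList, Finset.mem_univ, not_true_eq_false, false_imp_iff,
      implies_true, if_true, mul_one, Finset.length_toList, Finset.card_univ]
    rw [mul_comm]
    congr 2
    simp only [L, Finset.sum_map_toList]
    -- Each edge lies in exactly one colour class, so the layers together produce the whole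
    -- quadratic form.
    have h1 := Finset.sum_fiberwise (Finset.univ : Finset {p : V × V // R p.1 p.2})
      (fun e => col e.1.1 e.1.2) (fun e => x e.1.1 * x e.1.2)
    rw [h1]
    have h2 : x ⬝ᵥ relMatrix R *ᵥ x =
        ∑ p : V × V, if R p.1 p.2 then x p.1 * x p.2 else 0 := by
      rw [Fintype.sum_prod_type]
      simp only [dotProduct, Matrix.mulVec, Finset.mul_sum, relMatrix]
      refine Finset.sum_congr rfl fun u _ => Finset.sum_congr rfl fun v _ => ?_
      split_ifs <;> simp
    rw [h2, ← Finset.sum_filter]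
    exact (Finset.sum_subtype (Finset.univ.filter fun p : V × V => R p.1 p.2)
      (p := fun p : V × V => R p.1 p.2) (fun p => by simp) fun p => x p.1 * x p.2).symm

end Circuit

/-! ### The alternating Tanner graph -/

lemma atgRel_asymm {n mx mz : ℕ} (Q : CSSCode n mx mz) (T : ℕ) (u v : ATGVertex n mx mz T)
    (h : atgRel Q T u v) : ¬ atgRel Q T v u := by
  rcases u with ⟨t, i⟩ | ⟨r, c⟩ | ⟨r, c⟩ <;> rcases v with ⟨t', i'⟩ | ⟨r', c'⟩ | ⟨r', c'⟩ <;>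
    simp only [atgRel] at h ⊢ <;> first | exact not_false | skip
  rintro ⟨-, h'⟩
  omega

lemma exists_injOn_support {ι : Type} [Fintype ι] {ℓ : ℕ} (hℓ : 1 ≤ ℓ) (v : ι → ZMod 2)
    (hv : hammingNorm v ≤ ℓ) :
    ∃ a : ι → Fin ℓ, ∀ i j, v i = 1 → v j = 1 → a i = a j → i = j := by
  classical
  have : Nonempty (Fin ℓ) := ⟨⟨0, hℓ⟩⟩
  have hc : Fintype.card {i // v i ≠ 0} ≤ Fintype.card (Fin ℓ) := by
    rw [Fintype.card_subtype, Fintype.card_fin]; exact hv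
  obtain ⟨f⟩ := Function.Embedding.nonempty_of_card_le hc
  refine ⟨fun i => if h : v i ≠ 0 then f ⟨i, h⟩ else Classical.arbitrary _, ?_⟩
  intro i j hi hj h
  have hi' : v i ≠ 0 := by rw [hi]; decide
  have hj' : v j ≠ 0 := by rw [hj]; decide
  simp only [dif_pos hi', dif_pos hj'] at h
  simpa using f.injective h

/-- The colouring of the edges of a Tanner graph by pairs of ranks. -/
lemma exists_tanner_colouring {ι κ : Type} [Fintype ι] [Fintype κ] {ℓ : ℕ} (hℓ : 1 ≤ ℓ)
    (H : Matrix κ ι (ZMod 2)) (hrow : ∀ c, hammingNorm (H c) ≤ ℓ)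
    (hcol : ∀ i, hammingNorm (Hᵀ i) ≤ ℓ) :
    ∃ a : κ → ι → Fin ℓ × Fin ℓ, ∀ c i c' i', H c i = 1 → H c' i' = 1 → a c i = a c' i' →
      (c = c' ∨ i = i') → c = c' ∧ i = i' := by
  choose a ha using fun c => exists_injOn_support hℓ (H c) (hrow c)
  choose b hb using fun i => exists_injOn_support hℓ (Hᵀ i) (hcol i)
  -- An edge is coloured by its rank in its row and its rank in its column. Distinct edges with a
  -- common endpoint share a row or a column and differ in the corresponding rank.
  refine ⟨fun c i => (a c i, b i c), ?_⟩
  rintro c i c' i' h h' he (rfl | rfl)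
  · exact ⟨rfl, ha _ _ _ h h' (Prod.ext_iff.mp he).1⟩
  · exact ⟨hb _ _ _ h h' (Prod.ext_iff.mp he).2, rfl⟩

/-- Vertical edges need two colours, the parity of the lower layer. Each of the two Tanner graphs
needs `ℓ ^ 2` colours, reused on all its layers because the copies are disjoint. The Hadamard gates
add one more layer. -/
theorem exists_circuit_atgState {n mx mz ℓ : ℕ} (H : CSSCode n mx mz) (T : ℕ) (hℓ : 1 ≤ ℓ)
    (hH : H.Sparse ℓ) :
    ∃ W : Circuit (ATGVertex n mx mz T), W.depth = 3 + 2 * ℓ ^ 2 ∧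
      W.run (zeroState (ATGVertex n mx mz T)) = atgState H T := by
  obtain ⟨hx, hz, hxt, hzt⟩ := hH
  obtain ⟨a, ha⟩ := exists_tanner_colouring hℓ H.HX hx hxt
  obtain ⟨b, hb⟩ := exists_tanner_colouring hℓ H.HZ hz hzt
  let col : ATGVertex n mx mz T → ATGVertex n mx mz T →
      Fin 2 ⊕ (Fin ℓ × Fin ℓ) ⊕ (Fin ℓ × Fin ℓ) := fun u v =>
    match u, v with
    | .inl (_, i), .inr (.inl (_, c)) => .inr (.inl (b c i))
    | .inl (_, i), .inr (.inr (_, c)) => .inr (.inr (a c i))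
    | .inl (t, _), _ => .inl ⟨t.val % 2, Nat.mod_lt _ (by norm_num)⟩
    | _, _ => .inl 0
  obtain ⟨W, hW, hrun⟩ := exists_circuit_graphState (atgRel_asymm H T) col (by
    intro u v u' v' h h' hc hne
    rcases u with ⟨t, i⟩ | ⟨r, c⟩ | ⟨r, c⟩ <;> rcases v with ⟨s, j⟩ | ⟨r₁, c₁⟩ | ⟨r₁, c₁⟩ <;>
      simp only [atgRel] at h <;>
    rcases u' with ⟨t', i'⟩ | ⟨r', c'⟩ | ⟨r', c'⟩ <;>
      rcases v' with ⟨s', j'⟩ | ⟨r₁', c₁'⟩ | ⟨r₁', c₁'⟩ <;>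
      simp only [atgRel] at h' <;> simp only [col, reduceCtorEq, Sum.inr.injEq, Sum.inl.injEq] at hc
    · rw [Fin.mk.injEq] at hc
      simp only [ne_eq, Prod.mk.injEq, Sum.inl.injEq, Fin.ext_iff, not_and] at hne
      simp only [Set.disjoint_insert_left, Set.disjoint_singleton_left, Set.mem_insert_iff,
        Set.mem_singleton_iff, Sum.inl.injEq, Prod.mk.injEq, Fin.ext_iff]
      omega
    · simp only [Set.disjoint_insert_left, Set.disjoint_singleton_left, Set.mem_insert_iff,
        Set.mem_singleton_iff, Sum.inl.injEq, Sum.inr.injEq, Prod.mk.injEq, reduceCtorEq, or_false,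
        false_or]
      have := hb _ _ _ _ h.2 h'.2 hc
      refine ⟨?_, ?_⟩
      · rintro ⟨rfl, rfl⟩
        obtain ⟨rfl, -⟩ := this (Or.inr rfl)
        exact hne (by simp [Fin.ext_iff]; omega)
      · rintro ⟨rfl, rfl⟩
        obtain ⟨-, rfl⟩ := this (Or.inl rfl)
        exact hne (by simp [Fin.ext_iff]; omega)
    · simp only [Set.disjoint_insert_left, Set.disjoint_singleton_left, Set.mem_insert_iff,
        Set.mem_singleton_iff, Sum.inl.injEq, Sum.inr.injEq, Prod.mk.injEq, reduceCtorEq, or_false,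
        false_or]
      have := ha _ _ _ _ h.2 h'.2 hc
      refine ⟨?_, ?_⟩
      · rintro ⟨rfl, rfl⟩
        obtain ⟨rfl, -⟩ := this (Or.inr rfl)
        exact hne (by simp [Fin.ext_iff]; omega)
      · rintro ⟨rfl, rfl⟩
        obtain ⟨-, rfl⟩ := this (Or.inl rfl)
        exact hne (by simp [Fin.ext_iff]; omega))
  refine ⟨W, ?_, hrun⟩
  rw [hW]
  simp only [Fintype.card_sum, Fintype.card_prod, Fintype.card_fin]
  ring

/-! ### Well-separated layers -/

/-- The layers are `⌊jT/(m-1)⌋`. For `m = 1` division by zero yields the required value 0. -/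
theorem exists_wellSeparated {T m : ℕ} (hm : 1 ≤ m) (hmT : m ≤ T + 1) :
    ∃ σ : Fin m → Fin (T + 1), WellSeparated σ := by
  have hle : ∀ j : Fin m, j.val * T / (m - 1) < T + 1 := by
    intro j
    rcases Nat.eq_zero_or_pos (m - 1) with h | h
    · simp [h]
    · refine Nat.lt_succ_of_le ?_
      calc j.val * T / (m - 1) ≤ (m - 1) * T / (m - 1) :=
            Nat.div_le_div_right (Nat.mul_le_mul_right _ (by omega))
        _ = T := Nat.mul_div_cancel_left _ h
  have hgap : ∀ j j' : ℕ, j < j' → j' < m →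
      j * T / (m - 1) + T / (m - 1) ≤ j' * T / (m - 1) := by
    intro j j' h _
    refine (Nat.div_add_div_le_add_div).trans (Nat.div_le_div_right ?_)
    calc j * T + T = (j + 1) * T := by ring
      _ ≤ j' * T := Nat.mul_le_mul_right _ h
  have hpos : 2 ≤ m → 1 ≤ T / (m - 1) := fun h =>
    (Nat.one_le_div_iff (by omega)).mpr (by omega)
  refine ⟨fun j => ⟨j.val * T / (m - 1), hle j⟩, ?_, ?_, ?_, ?_⟩
  · intro j j' h
    have := hgap j j' h j'.2
    have := hpos (by have := j'.2; have : j.val < j'.val := h; omega)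
    simp only [Fin.lt_def]
    omega
  · intro j h; simp [h]
  · intro j h2 h
    have : j.val = m - 1 := by omega
    simp only [this]
    exact Nat.mul_div_cancel_left _ (by omega)
  · intro j j' h
    have h1 := hgap j j' (by omega) j'.2
    have hm2 : 2 ≤ m := by have := j'.2; omega
    have h2 := hpos hm2
    have h3 : T < (T / (m - 1) + 1) * (m - 1) := Nat.lt_mul_of_div_lt (by omega) (by omega)
    -- With `q = ⌊T/(m-1)⌋ ≥ 1` one has `T < (q+1)(m-1) ≤ 2qm`. The factor 2 is available because
    -- `σ` counts only every second layer.
    have h4 : T ≤ m * (2 * (T / (m - 1))) := by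
      have h5 : T / (m - 1) + 1 ≤ 2 * (T / (m - 1)) := by omega
      calc T ≤ (T / (m - 1) + 1) * (m - 1) := h3.le
        _ ≤ (2 * (T / (m - 1))) * m := Nat.mul_le_mul h5 (by omega)
        _ = _ := by ring
    have h6 : 2 * (j.val * T / (m - 1)) + 1 + 2 * (T / (m - 1)) ≤
        2 * (j'.val * T / (m - 1)) + 1 := by omega
    have hm' : (0 : ℝ) < m := by exact_mod_cast hm
    rw [div_le_iff₀ hm']
    have h4' : (T : ℝ) ≤ m * (2 * (T / (m - 1) : ℕ)) := by exact_mod_cast h4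
    have h6' : (((2 * (j.val * T / (m - 1)) + 1 : ℕ) : ℝ)) + 2 * (T / (m - 1) : ℕ) ≤
        ((2 * (j'.val * T / (m - 1)) + 1 : ℕ) : ℝ) := by exact_mod_cast h6
    refine h4'.trans ?_
    rw [mul_comm]
    exact mul_le_mul_of_nonneg_right (by linarith) hm'.le

/-! ### Codes -/

/-- A vector outside a subspace is separated from it by the dot product with some vector. -/
lemma exists_dotProduct_ne_zero {ι : Type} [Fintype ι] {p : Submodule (ZMod 2) (ι → ZMod 2)}
    {y : ι → ZMod 2} (hy : y ∉ p) :
    ∃ a : ι → ZMod 2, a ⬝ᵥ y ≠ 0 ∧ ∀ v ∈ p, a ⬝ᵥ v = 0 := by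
  classical
  obtain ⟨f, hf, hle⟩ := Submodule.exists_le_ker_of_notMem hy
  have hdot : ∀ v, (fun i => f (Pi.single i 1)) ⬝ᵥ v = f v := by
    intro v
    rw [LinearMap.pi_apply_eq_sum_univ f v, dotProduct]
    refine Finset.sum_congr rfl fun i _ => ?_
    rw [smul_eq_mul, mul_comm]
    congr 2
    funext j
    simp [Pi.single_apply, eq_comm]
  refine ⟨fun i => f (Pi.single i 1), ?_, fun v hv => ?_⟩
  · rw [hdot]; exact hf
  · rw [hdot]; exact hle hv

/-- A functional that vanishes on the image is a linear relation among the rows. -/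
lemma mulVec_surjective_of_linearIndependent {ι κ : Type} [Fintype ι] [Fintype κ]
    {A : Matrix κ ι (ZMod 2)} (hA : LinearIndependent (ZMod 2) A.row) (s : κ → ZMod 2) :
    ∃ y, A *ᵥ y = s := by
  by_contra hs
  obtain ⟨a, ha, hp⟩ := exists_dotProduct_ne_zero (p := LinearMap.range A.mulVecLin) (y := s)
    (fun h => hs h)
  have h0 : a ᵥ* A = 0 := by
    refine dotProduct_eq_zero _ fun v => ?_
    rw [← Matrix.dotProduct_mulVec]
    exact hp _ ⟨v, rfl⟩
  rw [Matrix.vecMul_eq_sum] at h0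
  have h1 := Fintype.linearIndependent_iff.mp hA a h0
  exact ha (by rw [funext h1]; simp [dotProduct])

namespace CSSCode

variable {n mx mz : ℕ}

lemma mem_rowX_iff (Q : CSSCode n mx mz) (y : Fin n → ZMod 2) :
    y ∈ Q.rowX ↔ ∃ u : Fin mx → ZMod 2, Q.HXᵀ *ᵥ u = y := by
  rw [rowX, Submodule.mem_span_range_iff_exists_fun]
  refine exists_congr fun u => ?_
  rw [Matrix.mulVec_transpose, Matrix.vecMul_eq_sum]
  rfl

lemma mem_rowZ_iff (Q : CSSCode n mx mz) (y : Fin n → ZMod 2) :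
    y ∈ Q.rowZ ↔ ∃ u : Fin mz → ZMod 2, Q.HZᵀ *ᵥ u = y := by
  rw [rowZ, Submodule.mem_span_range_iff_exists_fun]
  refine exists_congr fun u => ?_
  rw [Matrix.mulVec_transpose, Matrix.vecMul_eq_sum]
  rfl

lemma HX_mulVec_eq_zero_iff (Q : CSSCode n mx mz) (y : Fin n → ZMod 2) :
    Q.HX *ᵥ y = 0 ↔ ∀ v ∈ Q.rowX, v ⬝ᵥ y = 0 := by
  constructor
  · intro h v hv
    obtain ⟨u, rfl⟩ := (Q.mem_rowX_iff v).mp hv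
    rw [Matrix.mulVec_transpose, ← Matrix.dotProduct_mulVec, h, dotProduct_zero]
  · intro h
    funext c
    exact h _ (Submodule.subset_span ⟨c, rfl⟩)

lemma HZ_mulVec_eq_zero_iff (Q : CSSCode n mx mz) (y : Fin n → ZMod 2) :
    Q.HZ *ᵥ y = 0 ↔ ∀ v ∈ Q.rowZ, v ⬝ᵥ y = 0 := by
  constructor
  · intro h v hv
    obtain ⟨u, rfl⟩ := (Q.mem_rowZ_iff v).mp hv
    rw [Matrix.mulVec_transpose, ← Matrix.dotProduct_mulVec, h, dotProduct_zero]
  · intro h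
    funext c
    exact h _ (Submodule.subset_span ⟨c, rfl⟩)

lemma HX_mulVec_HZ_transpose (Q : CSSCode n mx mz) (u : Fin mz → ZMod 2) :
    Q.HX *ᵥ (Q.HZᵀ *ᵥ u) = 0 := by
  rw [Matrix.mulVec_mulVec, Q.orthogonal, Matrix.zero_mulVec]

lemma HZ_mulVec_HX_transpose (Q : CSSCode n mx mz) (u : Fin mx → ZMod 2) :
    Q.HZ *ᵥ (Q.HXᵀ *ᵥ u) = 0 := by
  have h : Q.HZ * Q.HXᵀ = 0 := by
    rw [← Matrix.transpose_transpose (Q.HZ * Q.HXᵀ), Matrix.transpose_mul,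
      Matrix.transpose_transpose, Q.orthogonal, Matrix.transpose_zero]
  rw [Matrix.mulVec_mulVec, h, Matrix.zero_mulVec]

lemma HX_surjective (Q : CSSCode n mx mz) (s : Fin mx → ZMod 2) : ∃ y, Q.HX *ᵥ y = s :=
  mulVec_surjective_of_linearIndependent Q.fullRankX s

lemma HZ_surjective (Q : CSSCode n mx mz) (s : Fin mz → ZMod 2) : ∃ y, Q.HZ *ᵥ y = s :=
  mulVec_surjective_of_linearIndependent Q.fullRankZ s

/-- A vector orthogonal to the kernel of `H^X` lies in the row space of `H^X`. -/
lemma mem_rowX_of_forall (Q : CSSCode n mx mz) {y : Fin n → ZMod 2}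
    (h : ∀ v, Q.HX *ᵥ v = 0 → v ⬝ᵥ y = 0) : y ∈ Q.rowX := by
  by_contra hy
  obtain ⟨a, ha, hp⟩ := exists_dotProduct_ne_zero hy
  exact ha (h a ((Q.HX_mulVec_eq_zero_iff a).mpr fun v hv => by
    rw [dotProduct_comm]; exact hp v hv))

lemma finrank_rowX (Q : CSSCode n mx mz) : Module.finrank (ZMod 2) Q.rowX = mx := by
  rw [rowX, finrank_span_eq_card Q.fullRankX, Fintype.card_fin]

lemma finrank_rowZ (Q : CSSCode n mx mz) : Module.finrank (ZMod 2) Q.rowZ = mz := by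
  rw [rowZ, finrank_span_eq_card Q.fullRankZ, Fintype.card_fin]

/-- A basis is selected among the given generators, so the bounds on rows and columns are inherited
by the subfamily. -/
lemma exists_sparse_basis {r b ℓ : ℕ} (g : Fin r → Fin n → ZMod 2)
    (S : Submodule (ZMod 2) (Fin n → ZMod 2)) (hS : Submodule.span (ZMod 2) (Set.range g) = S)
    (hb : Module.finrank (ZMod 2) S = b)
    (hrow : ∀ c, hammingNorm (g c) ≤ ℓ) (hcol : ∀ i, {c | g c i ≠ 0}.ncard ≤ ℓ) :
    ∃ M : Matrix (Fin b) (Fin n) (ZMod 2), LinearIndependent (ZMod 2) M.row ∧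
      Submodule.span (ZMod 2) (Set.range M.row) = S ∧
      (∀ c, hammingNorm (M c) ≤ ℓ) ∧ ∀ i, hammingNorm (Mᵀ i) ≤ ℓ := by
  obtain ⟨κ, a, ha, hspan, hli⟩ := exists_linearIndependent' (ZMod 2) g
  have : Fintype κ := Fintype.ofInjective a ha
  have hκ : Fintype.card κ = b := by
    rw [← hb, ← hS, ← hspan, finrank_span_eq_card hli]
  let e : Fin b ≃ κ := (Fintype.equivFinOfCardEq hκ).symm
  refine ⟨fun c => g (a (e c)), hli.comp e e.injective, ?_, fun c => hrow _, fun i => ?_⟩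
  · rw [← hS, ← hspan]
    congr 1
    exact e.surjective.range_comp (g ∘ a)
  · refine le_trans ?_ (hcol i)
    rw [hammingNorm, ← Set.ncard_coe_finset]
    refine Set.ncard_le_ncard_of_injOn (fun c => a (e c)) ?_ ?_ (Set.toFinite _)
    · intro c hc
      simp only [Finset.coe_filter, Finset.mem_univ, true_and, Set.mem_ofPred_eq] at hc
      exact hc
    · exact (ha.comp e.injective).injOn

/-- The checks may mix X and Z. As they generate the product of the two row spaces, their X parts
and Z parts generate the factors separately. -/
theorem exists_sparse (Q : CSSCode n mx mz) {ℓ : ℕ} (hQ : Q.IsLDPC ℓ) :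
    ∃ H : CSSCode n mx mz, H.SameCode Q ∧ H.Sparse ℓ := by
  obtain ⟨r, g, hspan, hrow, hcol⟩ := hQ
  have hle : ∀ {s t : Set (Fin n)}, s ⊆ t → t.ncard ≤ ℓ → s.ncard ≤ ℓ := fun hst ht =>
    (Set.ncard_le_ncard hst (Set.toFinite _)).trans ht
  have hnorm : ∀ v : Fin n → ZMod 2, hammingNorm v = {i | v i ≠ 0}.ncard := fun v => by
    rw [hammingNorm, ← Set.ncard_coe_finset]; simp
  have hX : Submodule.span (ZMod 2) (Set.range fun c => (g c).1) = Q.rowX := by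
    have h := congrArg (Submodule.map (LinearMap.fst (ZMod 2) (Fin n → ZMod 2)
      (Fin n → ZMod 2))) hspan
    rw [Submodule.map_span, ← Set.range_comp, Submodule.prod_map_fst] at h
    exact h
  have hZ : Submodule.span (ZMod 2) (Set.range fun c => (g c).2) = Q.rowZ := by
    have h := congrArg (Submodule.map (LinearMap.snd (ZMod 2) (Fin n → ZMod 2)
      (Fin n → ZMod 2))) hspan
    rw [Submodule.map_span, ← Set.range_comp, Submodule.prod_map_snd] at h
    exact h
  obtain ⟨A, hA, hAs, hAr, hAc⟩ := exists_sparse_basis _ _ hX Q.finrank_rowX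
    (fun c => (hnorm _).trans_le (hle (fun i hi => Or.inl hi) (hrow c)))
    (fun i => (Set.ncard_le_ncard (fun c hc => Or.inl hc) (Set.toFinite _)).trans (hcol i))
  obtain ⟨B, hB, hBs, hBr, hBc⟩ := exists_sparse_basis _ _ hZ Q.finrank_rowZ
    (fun c => (hnorm _).trans_le (hle (fun i hi => Or.inr hi) (hrow c)))
    (fun i => (Set.ncard_le_ncard (fun c hc => Or.inr hc) (Set.toFinite _)).trans (hcol i))
  refine ⟨⟨A, B, hA, hB, ?_⟩, ⟨hAs, hBs⟩, hAr, hBr, hAc, hBc⟩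
  ext c c'
  have h1 : A c ∈ Q.rowX := hAs ▸ Submodule.subset_span ⟨c, rfl⟩
  have h2 : B c' ∈ Q.rowZ := hBs ▸ Submodule.subset_span ⟨c', rfl⟩
  obtain ⟨u, hu⟩ := (Q.mem_rowZ_iff _).mp h2
  have h3 : Q.HX *ᵥ B c' = 0 := by rw [← hu, Q.HX_mulVec_HZ_transpose]
  exact (Q.HX_mulVec_eq_zero_iff _).mp h3 _ h1

lemma mx_le (Q : CSSCode n mx mz) : mx ≤ n := by
  have := Q.fullRankX.fintype_card_le_finrank; simpa using this

lemma mz_le (Q : CSSCode n mx mz) : mz ≤ n := by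
  have := Q.fullRankZ.fintype_card_le_finrank; simpa using this

lemma card_atgVertex_le (Q : CSSCode n mx mz) {T : ℕ} (hT : 1 ≤ T) :
    Fintype.card (ATGVertex n mx mz T) ≤ 6 * n * T := by
  simp only [Fintype.card_sum, Fintype.card_prod, Fintype.card_fin]
  have h1 := Nat.mul_le_mul_left (T + 1) Q.mz_le
  have h2 := Nat.mul_le_mul_left T Q.mx_le
  have h3 := Nat.mul_le_mul_right n hT
  nlinarith

/-- The two halves of a syndrome constrain the Z part and the X part separately, so both weights can
be minimized at once. -/
theorem exists_isMinWeightDecoder (H : CSSCode n mx mz) (m : ℕ) :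
    ∃ dec : (Fin m → (Fin mx → ZMod 2) × (Fin mz → ZMod 2)) → PauliOp (Fin m × Fin n),
      H.IsMinWeightDecoder dec := by
  classical
  have key : ∀ (A : Set (Fin m × Fin n → ZMod 2)), ∃ w : Fin m × Fin n → ZMod 2,
      A.Nonempty → w ∈ A ∧ ∀ v ∈ A, hammingNorm w ≤ hammingNorm v := by
    intro A
    by_cases hA : A.Nonempty
    · obtain ⟨w, hw, hmin⟩ := Set.exists_min_image A hammingNorm (Set.toFinite A) hA
      exact ⟨w, fun _ => ⟨hw, hmin⟩⟩
    · exact ⟨0, fun h => absurd h hA⟩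
  choose f hf using key
  refine ⟨fun s => (f {w | ∀ j, H.HZ *ᵥ (fun i => w (j, i)) = (s j).2},
    f {w | ∀ j, H.HX *ᵥ (fun i => w (j, i)) = (s j).1}), fun E => ?_⟩
  have h1 := hf {w | ∀ j, H.HZ *ᵥ (fun i => w (j, i)) = (H.syndrome E j).2} ⟨E.1, fun j => rfl⟩
  have h2 := hf {w | ∀ j, H.HX *ᵥ (fun i => w (j, i)) = (H.syndrome E j).1} ⟨E.2, fun j => rfl⟩
  refine ⟨?_, h1.2 _ fun j => rfl, h2.2 _ fun j => rfl⟩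
  funext j
  exact Prod.ext (h2.1 j) (h1.1 j)

end CSSCode

/-! ### Clusters -/

section Cluster

variable {U : Type}

/-- The support of a vector. -/
def suppF [Fintype U] (x : U → ZMod 2) : Finset U := Finset.univ.filter fun u => x u ≠ 0

@[simp] lemma mem_suppF [Fintype U] {x : U → ZMod 2} {u : U} : u ∈ suppF x ↔ x u ≠ 0 := by simp [suppF]

variable [DecidableEq U]

/-- No vertex of `W` outside `Y` is adjacent to a vertex of `Y`. -/
def ClosedIn (G : SimpleGraph U) (W Y : Finset U) : Prop :=
  ∀ u ∈ Y, ∀ v ∈ W, G.Adj u v → v ∈ Y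

/-- Every connected component of the subgraph induced on `W` meets `S ⊆ W`. -/
def Rooted (G : SimpleGraph U) (S W : Finset U) : Prop :=
  S ⊆ W ∧ ∀ Y ⊆ W, S ⊆ Y → ClosedIn G W Y → Y = W

/-- `W` is the union of the components of `A` that meet `S`, realized as the intersection of all
closed subsets of `A` containing `S`. -/
lemma exists_rooted_closedIn (G : SimpleGraph U) {S A : Finset U} (hS : S ⊆ A) :
    ∃ W ⊆ A, Rooted G S W ∧ ClosedIn G A W := by
  classical
  let W := A.filter fun v => ∀ Y ⊆ A, S ⊆ Y → ClosedIn G A Y → v ∈ Y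
  have hWA : W ⊆ A := Finset.filter_subset _ _
  have hcl : ClosedIn G A W := by
    intro u hu v hv huv
    refine Finset.mem_filter.mpr ⟨hv, fun Y hY hSY hYc => ?_⟩
    exact hYc u ((Finset.mem_filter.mp hu).2 Y hY hSY hYc) v hv huv
  refine ⟨W, hWA, ⟨fun s hs => Finset.mem_filter.mpr ⟨hS hs, fun Y _ hSY _ => hSY hs⟩, ?_⟩, hcl⟩
  intro Y hY hSY hYc
  refine Finset.Subset.antisymm hY fun w hw => ?_
  refine (Finset.mem_filter.mp hw).2 Y (hY.trans hWA) hSY ?_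
  intro u hu v hv huv
  exact hYc u hu v (hcl u (hY hu) v hv huv) huv

open Classical in
/-- The number of rooted clusters of a given size in a graph of bounded degree. -/
lemma card_rooted_le [Fintype U] (G : SimpleGraph U) {Δ : ℕ}
    (hΔ : ∀ u, (Finset.univ.filter fun v => G.Adj u v).card ≤ Δ)
    (S : Finset U) (w : ℕ) :
    (Finset.univ.filter fun W : Finset U => Rooted G S W ∧ W.card = w).card ≤ 2 ^ (Δ * w) := by
  classical
  induction w generalizing S with
  | zero =>
    refine (Finset.card_le_one.mpr fun a ha b hb => ?_).trans Nat.one_le_two_pow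
    simp only [Finset.mem_filter, Finset.card_eq_zero] at ha hb
    rw [ha.2.2, hb.2.2]
  | succ w ih =>
    rcases S.eq_empty_or_nonempty with rfl | ⟨v, hv⟩
    · rw [Finset.card_eq_zero.mpr]
      · exact Nat.zero_le _
      · rw [Finset.filter_eq_empty_iff]
        rintro W - ⟨hW, hc⟩
        have := hW.2 ∅ (Finset.empty_subset _) (Finset.empty_subset _) (by intro u hu; simp at hu)
        rw [← this] at hc
        simp at hc
    -- The cluster is explored from a root `v`: record which neighbours of `v` belong to it, delete
    -- `v`, and turn these neighbours into roots. Each vertex of the cluster costs at most `2 ^ Δ`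
    -- choices.
    · let N := Finset.univ.filter fun u => G.Adj v u
      have hstep : (Finset.univ.filter fun W : Finset U => Rooted G S W ∧ W.card = w + 1).card ≤
          (N.powerset.sigma fun B => Finset.univ.filter fun W : Finset U =>
            Rooted G ((S ∪ B).erase v) W ∧ W.card = w).card := by
        refine Finset.card_le_card_of_injOn (fun W => ⟨N ∩ W, W.erase v⟩) ?_ ?_
        · intro W hW
          simp only [Finset.coe_filter, Finset.mem_univ, true_and, Set.mem_ofPred_eq] at hW
          obtain ⟨⟨hSW, hroot⟩, hc⟩ := hW
          have hvW := hSW hv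
          simp only [Finset.coe_sigma, Set.mem_sigma_iff, Finset.mem_coe, Finset.mem_powerset,
            Finset.mem_filter, Finset.mem_univ, true_and]
          refine ⟨Finset.inter_subset_left, ⟨?_, ?_⟩, ?_⟩
          · refine Finset.erase_subset_erase _ (Finset.union_subset hSW Finset.inter_subset_right)
          · intro Y hY hSY hYc
            have h1 : insert v Y = W := by
              refine hroot _ ?_ ?_ ?_
              · exact Finset.insert_subset hvW (hY.trans (Finset.erase_subset _ _))
              · intro s hs
                by_cases hsv : s = v
                · simp [hsv]
                · exact Finset.mem_insert_of_mem (hSY (by simp [hsv, hs]))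
              · intro u hu x hx hux
                by_cases hxv : x = v
                · simp [hxv]
                · refine Finset.mem_insert_of_mem ?_
                  rcases Finset.mem_insert.mp hu with rfl | hu
                  · exact hSY (by simp [hxv, N, hux, hx])
                  · exact hYc u hu x (by simp [hxv, hx]) hux
            have hvY : v ∉ Y := fun h => by simpa using hY h
            rw [← h1, Finset.erase_insert hvY]
          · rw [Finset.card_erase_of_mem hvW, hc]; rfl
        · intro W hW W' hW' h
          simp only [Finset.coe_filter, Finset.mem_univ, true_and, Set.mem_ofPred_eq] at hW hW'
          simp only [Sigma.mk.injEq, heq_eq_eq] at h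
          rw [← Finset.insert_erase (hW.1.1 hv), ← Finset.insert_erase (hW'.1.1 hv), h.2]
      refine hstep.trans ?_
      rw [Finset.card_sigma]
      refine (Finset.sum_le_sum fun B _ => ih _).trans ?_
      rw [Finset.sum_const, Finset.card_powerset, smul_eq_mul, ← pow_add]
      refine Nat.pow_le_pow_right (by norm_num) ?_
      have : N.card ≤ Δ := hΔ v
      rw [mul_add, mul_one]
      omega

/-- The restriction of a vector to a set of coordinates. -/
def restr (K : Finset U) (x : U → ZMod 2) : U → ZMod 2 := fun u => if u ∈ K then x u else 0

lemma restr_add (K : Finset U) (x y : U → ZMod 2) : restr K (x + y) = restr K x + restr K y := by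
  funext u; simp only [restr, Pi.add_apply]; split_ifs <;> simp

lemma restr_restr (K K' : Finset U) (x : U → ZMod 2) : restr K (restr K' x) = restr (K ∩ K') x := by
  funext u; simp only [restr, Finset.mem_inter]; split_ifs <;> simp_all

variable [Fintype U]

lemma suppF_restr (K : Finset U) (x : U → ZMod 2) : suppF (restr K x) = K ∩ suppF x := by
  ext u; simp [restr]

lemma restr_suppF (x : U → ZMod 2) : restr (suppF x) x = x := by
  funext u
  by_cases h : x u = 0 <;> simp [restr, h]

lemma suppF_add_subset (x y : U → ZMod 2) : suppF (x + y) ⊆ suppF x ∪ suppF y := by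
  intro u hu
  simp only [mem_suppF, Pi.add_apply, Finset.mem_union] at hu ⊢
  by_contra! h
  exact hu (by rw [h.1, h.2, add_zero])

lemma suppF_add_of_disjoint {x y : U → ZMod 2} (h : ∀ u, x u = 0 ∨ y u = 0) :
    (suppF (x + y)).card = (suppF x).card + (suppF y).card := by
  rw [← Finset.card_union_of_disjoint]
  · congr 1
    ext u
    simp only [mem_suppF, Pi.add_apply, Finset.mem_union]
    rcases h u with h | h <;> simp [h]
  · rw [Finset.disjoint_left]
    intro u hu hv
    rw [mem_suppF] at hu hv
    rcases h u with h | h <;> contradiction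

/-- A vector is the sum of its restrictions to the clusters of its support. -/
lemma closed_decomposition (G : SimpleGraph U) (P : (U → ZMod 2) → Prop) (x : U → ZMod 2)
    (h0 : P 0) (hadd : ∀ a b : U → ZMod 2, (∀ u, a u = 0 ∨ b u = 0) → P a → P b → P (a + b))
    (hc : ∀ u W, Rooted G {u} W → W ⊆ suppF x → ClosedIn G (suppF x) W → P (restr W x)) :
    P x := by
  suffices h : ∀ A : Finset U, A ⊆ suppF x → ClosedIn G (suppF x) A → P (restr A x) by
    have := h _ (Finset.Subset.refl _) (fun _ _ _ hv _ => hv)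
    rwa [restr_suppF] at this
  intro A
  induction A using Finset.strongInduction with
  | H A ih =>
    intro hA hAc
    rcases A.eq_empty_or_nonempty with rfl | ⟨u, hu⟩
    · convert h0 using 1; funext u; simp [restr]
    · obtain ⟨W, hWA, hW, hWc⟩ := exists_rooted_closedIn G (Finset.singleton_subset_iff.mpr hu)
      have huW : u ∈ W := hW.1 (by simp)
      have hWs : ClosedIn G (suppF x) W := fun a ha v hv hav =>
        hWc a ha v (hAc a (hWA ha) v hv hav) hav
      have h1 := hc u W hW (hWA.trans hA) hWs
      have h2 := ih (A \ W) (Finset.sdiff_ssubset hWA ⟨u, huW⟩) (Finset.sdiff_subset.trans hA) (by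
        intro a ha v hv hav
        rw [Finset.mem_sdiff] at ha ⊢
        exact ⟨hAc a ha.1 v hv hav, fun hvW => ha.2 (hWc v hvW a ha.1 hav.symm)⟩)
      have h3 : restr A x = restr W x + restr (A \ W) x := by
        funext v
        simp only [restr, Pi.add_apply, Finset.mem_sdiff]
        by_cases hvW : v ∈ W
        · simp [hvW, hWA hvW]
        · simp [hvW]
      rw [h3]
      refine hadd _ _ (fun v => ?_) h1 h2
      simp only [restr, Finset.mem_sdiff]
      by_cases hvW : v ∈ W <;> simp [hvW]

/-- Two coordinates are adjacent if they take part in a common parity check. -/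
def checkGraph {C : Type} (M : Matrix C U (ZMod 2)) : SimpleGraph U where
  Adj u v := u ≠ v ∧ ∃ c, M c u ≠ 0 ∧ M c v ≠ 0
  symm := ⟨fun _ _ h => ⟨h.1.symm, h.2.imp fun _ hc => ⟨hc.2, hc.1⟩⟩⟩
  loopless := ⟨fun _ h => h.1 rfl⟩

/-- Support points in a common check are adjacent. A check that meets the closed set `K` therefore
sees no support of `x` outside `K`, and a check that misses `K` sees nothing. -/
lemma mulVec_restr_eq_zero {C : Type} (M : Matrix C U (ZMod 2)) {x : U → ZMod 2} {c : C}
    (hx : (M *ᵥ x) c = 0) {K : Finset U} (hK : ClosedIn (checkGraph M) (suppF x) K) :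
    (M *ᵥ restr K x) c = 0 := by
  by_cases h : ∃ u ∈ K, M c u ≠ 0
  · obtain ⟨u, hu, hc⟩ := h
    rw [← hx]
    refine Finset.sum_congr rfl fun v _ => ?_
    by_cases hvK : v ∈ K
    · simp [restr, hvK]
    · by_cases hcv : M c v = 0
      · simp [hcv]
      · by_cases hxv : x v = 0
        · simp [restr, hxv]
        · exact absurd (hK u hu v (by simpa using hxv)
            ⟨fun h => hvK (h ▸ hu), c, hc, hcv⟩) hvK
  · push Not at h
    refine Finset.sum_eq_zero fun v _ => ?_
    by_cases hvK : v ∈ K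
    · simp [h v hvK]
    · simp [restr, hvK]

open Classical in
lemma checkGraph_degree_le {C : Type} [Fintype C] (M : Matrix C U (ZMod 2)) {a b : ℕ}
    (hrow : ∀ c, hammingNorm (M c) ≤ a) (hcol : ∀ u, hammingNorm (Mᵀ u) ≤ b)
    (u : U) :
    (Finset.univ.filter fun v => (checkGraph M).Adj u v).card ≤ b * a := by
  classical
  refine (Finset.card_le_card (t := (Finset.univ.filter fun c => M c u ≠ 0).biUnion
    fun c => Finset.univ.filter fun v => M c v ≠ 0) ?_).trans ?_
  · intro v hv
    obtain ⟨-, -, c, hu, hv⟩ := Finset.mem_filter.mp hv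
    simp only [Finset.mem_biUnion, Finset.mem_filter, Finset.mem_univ, true_and]
    exact ⟨c, hu, hv⟩
  · refine (Finset.card_biUnion_le_card_mul _ _ a fun c _ => hrow c).trans ?_
    exact Nat.mul_le_mul_right _ (hcol u)

/-- If every cluster that is large contains few errors, then the residual error `x` left by
minimum-weight decoding is trivial, and every part of it on the unmeasured qubits is contained in
a union of clusters, each of which has a large fraction of errors. -/
theorem residual_of_small_clusters (G : SimpleGraph U) (β : Finset U)
    (Z Zf Zfull : Submodule (ZMod 2) (U → ZMod 2)) (M : ℝ)
    (hZloc : ∀ z ∈ Z, ∀ K, ClosedIn G (suppF z) K → restr K z ∈ Z)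
    (hZfloc : ∀ z ∈ Zf, ∀ K, ClosedIn G (suppF z) K → restr K z ∈ Zf)
    (hres : ∀ x ∈ Zf, restr β x ∈ Z)
    (hpush : ∀ z ∈ Z, ((suppF z).card : ℝ) < M →
      ∃ y ∈ Zf, restr β y = z ∧ (suppF y).card ≤ 2 * (suppF z).card)
    (hlog : ∀ x ∈ Zf, ((suppF x).card : ℝ) < M → x ∈ Zfull)
    (b x : U → ZMod 2) (hx : x ∈ Zf)
    (hmin : ∀ z ∈ Z, (suppF (restr β x + b)).card ≤ (suppF (restr β x + b + z)).card)
    (hmin' : ∀ x' ∈ Zf, restr β x' = restr β x → (suppF x).card ≤ (suppF x').card)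
    (hsucc : ∀ u W, Rooted G {u} W → M ≤ (W.card : ℝ) → 4 * (W ∩ suppF b).card < W.card) :
    x ∈ Zfull ∧ ∀ S ⊆ suppF x \ β, ∃ W, Rooted G S W ∧ W.card ≤ 4 * (W ∩ suppF b).card ∧
      S.card ≤ 2 * (W ∩ suppF b).card := by
  -- Adding `x` on `B` to the bulk correction replaces it there by the actual errors. By minimality
  -- the correction is no larger on `B` than the actual errors, and together the two cover `B`.
  have hA : ∀ B ⊆ β ∩ suppF x, restr B x ∈ Z → B.card ≤ 2 * (B ∩ suppF b).card := by
    intro B hB hBZ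
    have h1 := hmin _ hBZ
    set a := restr β x + b with ha
    have hxB : ∀ u ∈ B, restr β x u = x u := fun u hu => by
      simp [restr, (Finset.mem_inter.mp (hB hu)).1]
    have h2 : suppF (a + restr B x) = (suppF a \ B) ∪ (B ∩ suppF b) := by
      ext u
      simp only [mem_suppF, Pi.add_apply, Finset.mem_union, Finset.mem_sdiff, Finset.mem_inter]
      by_cases hu : u ∈ B
      · have : a u + restr B x u = b u := by
          have h3 : restr B x u = x u := by simp [restr, hu]
          rw [ha, Pi.add_apply, hxB u hu, h3, add_right_comm, ZModModule.add_self, zero_add]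
        rw [this]; simp [hu]
      · simp [restr, hu]
    have h3 : B ⊆ (suppF a ∩ B) ∪ (B ∩ suppF b) := by
      intro u hu
      simp only [mem_suppF, Finset.mem_union, Finset.mem_inter, hu, and_true, true_and]
      by_contra! h
      have : a u = x u := by rw [ha, Pi.add_apply, hxB u hu, h.2, add_zero]
      rw [h.1] at this
      exact (mem_suppF.mp (Finset.mem_inter.mp (hB hu)).2) this.symm
    have h4 := Finset.card_le_card h3
    have h5 := Finset.card_union_le (suppF a ∩ B) (B ∩ suppF b)
    have h6 := Finset.card_union_le (suppF a \ B) (B ∩ suppF b)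
    have h7 := Finset.card_sdiff_add_card_inter (suppF a) B
    rw [h2] at h1
    omega
  have hcloseβ : ∀ K, ClosedIn G (suppF x) K → ClosedIn G (suppF (restr β x)) (β ∩ K) := by
    intro K hK u hu v hv huv
    rw [suppF_restr, Finset.mem_inter] at hv
    exact Finset.mem_inter.mpr ⟨hv.1, hK u (Finset.mem_inter.mp hu).2 v hv.2 huv⟩
  have hxβ := hres x hx
  -- The bulk part of `K` is completed cluster by cluster. By `hA` at least half of each cluster
  -- consists of actual errors, so `hsucc` bounds its size by `M` and `hpush` applies.
  have hC : ∀ K ⊆ suppF x, ClosedIn G (suppF x) K → ∃ y ∈ Zf, restr β y = restr (β ∩ K) x ∧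
      (suppF y).card ≤ 2 * (suppF (restr (β ∩ K) x)).card := by
    intro K hKx hK
    have hz : restr (β ∩ K) (restr β x) = restr (β ∩ K) x := by
      rw [restr_restr]; congr 1; ext u; simp; tauto
    have hzZ : restr (β ∩ K) x ∈ Z := hz ▸ hZloc _ hxβ _ (hcloseβ K hK)
    have hzs : suppF (restr (β ∩ K) x) = β ∩ K := by
      rw [suppF_restr, Finset.inter_eq_left]
      exact Finset.inter_subset_right.trans hKx
    refine closed_decomposition G (fun z => ∃ y ∈ Zf, restr β y = z ∧
      (suppF y).card ≤ 2 * (suppF z).card) _ ?_ ?_ ?_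
    · refine ⟨0, Zf.zero_mem, ?_, ?_⟩
      · funext u; simp [restr]
      · simp [suppF]
    · rintro p q hpq ⟨y, hy, hyp, hyc⟩ ⟨y', hy', hyq, hyc'⟩
      refine ⟨y + y', Zf.add_mem hy hy', by rw [restr_add, hyp, hyq], ?_⟩
      rw [suppF_add_of_disjoint hpq]
      have := (Finset.card_le_card (suppF_add_subset y y')).trans (Finset.card_union_le _ _)
      omega
    · intro u W hW hWs hWc
      have hWZ := hZloc _ hzZ W hWc
      refine hpush _ hWZ ?_
      rw [hzs] at hWs
      have hWr : restr W (restr (β ∩ K) x) = restr W x := by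
        rw [restr_restr, Finset.inter_eq_left.mpr hWs]
      rw [hWr, suppF_restr, Finset.inter_eq_left.mpr
        ((hWs.trans Finset.inter_subset_right).trans hKx)]
      rw [hWr] at hWZ
      have h1 := hA W (fun u hu => by
        have := hWs hu
        rw [Finset.mem_inter] at this ⊢
        exact ⟨this.1, hKx this.2⟩) hWZ
      by_contra! h2
      have := hsucc u W hW h2
      omega
  -- Replacing `x` on `K` by the completion `y` keeps the bulk part. Minimality gives `|K| ≤ |y| ≤
  -- 2|β ∩ K|`, so the part of `K` outside `β` is no larger than the part inside, which `hA` bounds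
  -- by twice the number of actual errors.
  have hD : ∀ K ⊆ suppF x, ClosedIn G (suppF x) K →
      K.card ≤ 4 * (K ∩ suppF b).card ∧ (K \ β).card ≤ 2 * (K ∩ suppF b).card := by
    intro K hKx hK
    obtain ⟨y, hy, hyβ, hyc⟩ := hC K hKx hK
    have hzs : suppF (restr (β ∩ K) x) = β ∩ K := by
      rw [suppF_restr, Finset.inter_eq_left]
      exact Finset.inter_subset_right.trans hKx
    have hz : restr (β ∩ K) (restr β x) = restr (β ∩ K) x := by
      rw [restr_restr]; congr 1; ext u; simp; tauto
    have h1 := hmin' (x + restr K x + y) (Zf.add_mem (Zf.add_mem hx (hZfloc _ hx K hK)) hy) (by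
      rw [restr_add, restr_add, hyβ, restr_restr, add_assoc, ZModModule.add_self, add_zero])
    have h2 : suppF (x + restr K x + y) ⊆ (suppF x \ K) ∪ suppF y := by
      refine (suppF_add_subset _ _).trans (Finset.union_subset_union_left ?_)
      intro u hu
      simp only [mem_suppF, Pi.add_apply, Finset.mem_sdiff, restr] at hu ⊢
      by_cases huK : u ∈ K
      · simp [huK, ZModModule.add_self] at hu
      · simpa [huK] using hu
    have h3 := (Finset.card_le_card h2).trans (Finset.card_union_le _ _)
    have h4 := Finset.card_sdiff_add_card_inter (suppF x) K
    rw [Finset.inter_eq_right.mpr hKx] at h4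
    rw [hzs] at hyc
    have h5 := hA (β ∩ K) (Finset.inter_subset_inter_left hKx)
      (hz ▸ hZloc _ hxβ _ (hcloseβ K hK))
    have h6 : ((β ∩ K) ∩ suppF b).card ≤ (K ∩ suppF b).card :=
      Finset.card_le_card (Finset.inter_subset_inter_right Finset.inter_subset_right)
    have h7 := Finset.card_sdiff_add_card_inter K β
    rw [Finset.inter_comm K β] at h7
    omega
  refine ⟨?_, ?_⟩
  · refine closed_decomposition G (· ∈ Zfull) x Zfull.zero_mem
      (fun a b _ ha hb => Zfull.add_mem ha hb) ?_
    intro u W hW hWs hWc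
    refine hlog _ (hZfloc _ hx W hWc) ?_
    rw [suppF_restr, Finset.inter_eq_left.mpr hWs]
    by_contra! h
    have h1 := hsucc u W hW h
    have h2 := (hD W hWs hWc).1
    omega
  · intro S hS
    -- `W` collects the clusters of `x` that meet `S`.
    obtain ⟨W, hWs, hW, hWc⟩ := exists_rooted_closedIn G (hS.trans Finset.sdiff_subset)
    obtain ⟨h1, h2⟩ := hD W hWs hWc
    refine ⟨W, hW, h1, le_trans (Finset.card_le_card fun u hu => ?_) h2⟩
    exact Finset.mem_sdiff.mpr ⟨hW.1 hu, (Finset.mem_sdiff.mp (hS hu)).2⟩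

end Cluster

/-! ### Probabilities -/

section Prob

variable {α : Type} (D : PMF α)

lemma toOuterMeasure_le_one (A : Set α) : D.toOuterMeasure A ≤ 1 :=
  (D.toOuterMeasure.mono (Set.subset_univ A)).trans_eq (by
    change D.toOuterMeasure Set.univ = 1
    rw [PMF.toOuterMeasure_apply]; simp [D.tsum_coe])

lemma toOuterMeasure_ne_top (A : Set α) : D.toOuterMeasure A ≠ ⊤ :=
  ((toOuterMeasure_le_one D A).trans_lt ENNReal.one_lt_top).ne

lemma prob_le_one (A : Set α) : prob D A ≤ 1 :=
  ENNReal.toReal_le_of_le_ofReal zero_le_one (by simpa using toOuterMeasure_le_one D A)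

lemma prob_mono {A B : Set α} (h : A ⊆ B) : prob D A ≤ prob D B :=
  ENNReal.toReal_mono (toOuterMeasure_ne_top D B) (D.toOuterMeasure.mono h)

lemma prob_univ : prob D Set.univ = 1 := by
  rw [prob, PMF.toOuterMeasure_apply]; simp [D.tsum_coe]

lemma prob_union_le (A B : Set α) : prob D (A ∪ B) ≤ prob D A + prob D B := by
  rw [prob, prob, prob, ← ENNReal.toReal_add (toOuterMeasure_ne_top D A)
    (toOuterMeasure_ne_top D B)]
  exact ENNReal.toReal_mono (ENNReal.add_ne_top.mpr
    ⟨toOuterMeasure_ne_top D A, toOuterMeasure_ne_top D B⟩) (MeasureTheory.measure_union_le A B)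

lemma prob_biUnion_le {ι : Type} (s : Finset ι) (A : ι → Set α) :
    prob D (⋃ i ∈ s, A i) ≤ ∑ i ∈ s, prob D (A i) := by
  classical
  induction s using Finset.induction_on with
  | empty => simp [prob]
  | insert i s hi ih =>
    rw [Finset.set_biUnion_insert, Finset.sum_insert hi]
    exact (prob_union_le D _ _).trans (by linarith)

lemma one_sub_prob_compl_le (A : Set α) : 1 - prob D Aᶜ ≤ prob D A := by
  have := prob_union_le D A Aᶜ
  rw [Set.union_compl_self, prob_univ] at this
  linarith

end Prob

/-! ### Union bounds over clusters under local stochastic noise. -/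

section ClusterProb

variable {B U : Type} [Fintype B] [Fintype U] [DecidableEq U]

open Classical in
/-- The vertices at which the `Z` part of a Pauli operator is supported. -/
def errs (j : B → U) (P : PauliOp B) : Finset U :=
  (Finset.univ.filter fun v => P.2 v ≠ 0).image j

lemma sum_geometric_le {θ : ℝ} (h0 : 0 ≤ θ) (h1 : θ ≤ 1 / 2) (a b : ℕ) (ha : 1 ≤ a) :
    ∑ w ∈ Finset.Ico a b, θ ^ w ≤ 2 * θ := by
  have h2 : ∑ w ∈ Finset.Ico a b, θ ^ w ≤ θ ^ a / (1 - θ) :=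
    geom_sum_Ico_le_of_lt_one h0 (by linarith)
  have h3 : θ ^ a ≤ θ := pow_le_of_le_one h0 (by linarith) (by omega)
  refine h2.trans ?_
  rw [div_le_iff₀ (by linarith)]
  nlinarith

open Classical in
/-- The probability that some rooted cluster has a large fraction of errors. -/
lemma prob_cluster_le {j : B → U} (hj : Function.Injective j) {D : PMF (PauliOp B)} {p : ℝ}
    (hD : IsLocalStochastic D p) (G : SimpleGraph U) {Δ : ℕ}
    (hΔ : ∀ u, (Finset.univ.filter fun v => G.Adj u v).card ≤ Δ) (S : Finset U) {α τ : ℝ}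
    (hα : 0 < α) (hα1 : α ≤ 1) (w₀ : ℕ) (φ : ℕ → Prop)
    (hφ : ∀ a, φ a → (p / α ^ 4) ^ a ≤ τ) (hτ : 0 ≤ τ) :
    prob D {P | ∃ W, Rooted G S W ∧ w₀ ≤ W.card ∧ W.card ≤ 4 * (W ∩ errs j P).card ∧
      φ (W ∩ errs j P).card} ≤
      τ * ∑ w ∈ Finset.Ico w₀ (Fintype.card U + 1), (2 ^ (Δ + 1) * α) ^ w := by
  let Ws := Finset.univ.filter fun W : Finset U => Rooted G S W ∧ w₀ ≤ W.card
  let As : Finset U → Finset (Finset B) := fun W =>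
    (Finset.univ.filter fun v => j v ∈ W).powerset.filter fun A =>
      W.card ≤ 4 * A.card ∧ φ A.card
  have hsub : {P | ∃ W, Rooted G S W ∧ w₀ ≤ W.card ∧ W.card ≤ 4 * (W ∩ errs j P).card ∧
      φ (W ∩ errs j P).card} ⊆ ⋃ W ∈ Ws, ⋃ A ∈ As W, {P | (A : Set B) ⊆ supp P} := by
    rintro P ⟨W, hW, hw, hc, hf⟩
    let A := Finset.univ.filter fun v => j v ∈ W ∧ P.2 v ≠ 0
    have hA : A.card = (W ∩ errs j P).card := by
      rw [← Finset.card_image_of_injective A hj]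
      congr 1
      ext u
      simp only [A, errs, Finset.mem_image, Finset.mem_filter, Finset.mem_univ, true_and,
        Finset.mem_inter]
      constructor
      · rintro ⟨v, ⟨h1, h2⟩, rfl⟩; exact ⟨h1, v, h2, rfl⟩
      · rintro ⟨h1, v, h2, rfl⟩; exact ⟨v, ⟨h1, h2⟩, rfl⟩
    simp only [Set.mem_iUnion]
    refine ⟨W, by simp [Ws, hW, hw], A, ?_, ?_⟩
    · simp only [As, Finset.mem_filter, Finset.mem_powerset]
      refine ⟨fun v hv => ?_, hA ▸ hc, hA ▸ hf⟩
      simp only [A, Finset.mem_filter, Finset.mem_univ, true_and] at hv ⊢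
      exact hv.1
    · intro v hv
      exact Or.inr (Finset.mem_filter.mp (Finset.mem_coe.mp hv)).2.2
  have hinner : ∀ W, prob D (⋃ A ∈ As W, {P | (A : Set B) ⊆ supp P}) ≤
      τ * (2 * α) ^ W.card := by
    intro W
    refine (prob_biUnion_le D _ _).trans ?_
    have h1 : ∀ A ∈ As W, prob D {P | (A : Set B) ⊆ supp P} ≤ τ * α ^ W.card := by
      intro A hA
      simp only [As, Finset.mem_filter] at hA
      refine (hD A).trans ?_
      -- The factor `α ^ (4|A|) ≤ α ^ |W|` pays for the number of pairs `(W, A)`. The other factor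
      -- supplies the decay `τ`.
      have h2 : p ^ A.card = (p / α ^ 4) ^ A.card * α ^ (4 * A.card) := by
        rw [pow_mul, ← mul_pow, div_mul_cancel₀ _ (by positivity)]
      rw [h2]
      exact mul_le_mul (hφ _ hA.2.2) (pow_le_pow_of_le_one hα.le hα1 hA.2.1) (by positivity) hτ
    refine (Finset.sum_le_card_nsmul _ _ _ h1).trans ?_
    have h3 : (As W).card ≤ 2 ^ W.card := by
      refine (Finset.card_filter_le _ _).trans ?_
      rw [Finset.card_powerset]
      refine Nat.pow_le_pow_right (by norm_num) ?_
      exact Finset.card_le_card_of_injOn j (fun v hv => by simpa using hv) hj.injOn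
    have h4 : ((As W).card : ℝ) ≤ 2 ^ W.card := by exact_mod_cast h3
    rw [nsmul_eq_mul, mul_pow]
    calc ((As W).card : ℝ) * (τ * α ^ W.card) ≤ 2 ^ W.card * (τ * α ^ W.card) :=
          mul_le_mul_of_nonneg_right h4 (by positivity)
      _ = _ := by ring
  refine (prob_mono D hsub).trans ((prob_biUnion_le D _ _).trans ?_)
  refine (Finset.sum_le_sum fun W _ => hinner W).trans ?_
  rw [← Finset.mul_sum]
  refine mul_le_mul_of_nonneg_left ?_ hτ
  rw [← Finset.sum_fiberwise_of_maps_to (s := Ws) (t := Finset.Ico w₀ (Fintype.card U + 1))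
    (g := Finset.card) (fun W hW => by
      simp only [Finset.mem_Ico]
      exact ⟨(Finset.mem_filter.mp hW).2.2, Nat.lt_succ_of_le (Finset.card_le_univ W)⟩)]
  refine Finset.sum_le_sum fun w _ => ?_
  have h5 : ∀ W ∈ Ws.filter (fun W => W.card = w), (2 * α) ^ W.card ≤ (2 * α) ^ w := fun W hW => by
    rw [(Finset.mem_filter.mp hW).2]
  refine (Finset.sum_le_card_nsmul _ _ _ h5).trans ?_
  have h6 : (Ws.filter (fun W => W.card = w)).card ≤ 2 ^ (Δ * w) := by
    refine (Finset.card_le_card fun W hW => ?_).trans (card_rooted_le G hΔ S w)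
    simp only [Ws, Finset.mem_filter, Finset.mem_univ, true_and] at hW ⊢
    exact ⟨hW.1.1, hW.2⟩
  have h7 : ((Ws.filter (fun W => W.card = w)).card : ℝ) ≤ 2 ^ (Δ * w) := by exact_mod_cast h6
  rw [nsmul_eq_mul]
  refine (mul_le_mul_of_nonneg_right h7 (by positivity)).trans_eq ?_
  rw [pow_mul, ← mul_pow]
  congr 1
  ring

/-- The errors for which no cluster of size at least `M` has a fraction `1/4` of errors. -/
def sparseErrors (j : B → U) (G : SimpleGraph U) (M : ℝ) : Set (PauliOp B) :=
  {P | ∀ u W, Rooted G {u} W → M ≤ (W.card : ℝ) → 4 * (W ∩ errs j P).card < W.card}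

-- A bad cluster of size at least `M` contains at least `M/4` errors. For each root, the sum over
-- cluster sizes is a geometric series of ratio `1/16`, which contributes at most `1/8`.
open Classical in
theorem prob_sparseErrors_ge {j : B → U} (hj : Function.Injective j) {D : PMF (PauliOp B)} {p : ℝ}
    (hp0 : 0 ≤ p) (hD : IsLocalStochastic D p) (G : SimpleGraph U) {Δ : ℕ}
    (hΔ : ∀ u, (Finset.univ.filter fun v => G.Adj u v).card ≤ Δ) {α M : ℝ} (hα : 0 < α)
    (hαΔ : 2 ^ (Δ + 1) * α = 1 / 16) (hp : p < α ^ 4) (hM : 0 < M) :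
    1 - (Fintype.card U : ℝ) / 8 * (p / α ^ 4) ^ (1 / 4 * M) ≤ prob D (sparseErrors j G M) := by
  have hα1 : α ≤ 1 := by
    have h1 : (1 : ℝ) ≤ 2 ^ (Δ + 1) := one_le_pow₀ (by norm_num)
    nlinarith
  set ρ := p / α ^ 4 with hρ
  have hρ0 : 0 ≤ ρ := by positivity
  have hρ1 : ρ ≤ 1 := (div_le_one (by positivity)).mpr hp.le
  refine le_trans ?_ (one_sub_prob_compl_le D _)
  refine sub_le_sub_left ?_ 1
  have hsub : (sparseErrors j G M)ᶜ ⊆ ⋃ u ∈ (Finset.univ : Finset U),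
      {P | ∃ W, Rooted G {u} W ∧ 1 ≤ W.card ∧ W.card ≤ 4 * (W ∩ errs j P).card ∧
        (fun a : ℕ => M ≤ 4 * (a : ℝ)) (W ∩ errs j P).card} := by
    intro P hP
    simp only [sparseErrors, Set.mem_compl_iff, Set.mem_ofPred_eq, not_forall, not_lt] at hP
    obtain ⟨u, W, hW, hMW, hc⟩ := hP
    simp only [Set.mem_iUnion]
    refine ⟨u, Finset.mem_univ _, W, hW, Finset.card_pos.mpr ⟨u, hW.1 (by simp)⟩, hc, ?_⟩
    refine hMW.trans ?_
    exact_mod_cast hc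
  refine (prob_mono D hsub).trans ((prob_biUnion_le D _ _).trans ?_)
  have hτ : 0 ≤ ρ ^ (1 / 4 * M) := Real.rpow_nonneg hρ0 _
  have h1 : ∀ u ∈ (Finset.univ : Finset U), prob D
      {P | ∃ W, Rooted G {u} W ∧ 1 ≤ W.card ∧ W.card ≤ 4 * (W ∩ errs j P).card ∧
        (fun a : ℕ => M ≤ 4 * (a : ℝ)) (W ∩ errs j P).card} ≤ 1 / 8 * ρ ^ (1 / 4 * M) := by
    intro u _
    refine (prob_cluster_le hj hD G hΔ {u} hα hα1 1
      (fun a : ℕ => M ≤ 4 * (a : ℝ)) (τ := ρ ^ (1 / 4 * M)) ?_ hτ).trans ?_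
    · intro a ha
      have ha0 : 1 / 4 * M ≤ (a : ℝ) := by linarith
      rw [← Real.rpow_natCast]
      rcases hρ0.eq_or_lt with h0 | h0
      · rw [← hρ, ← h0, Real.zero_rpow (by linarith), Real.zero_rpow (by linarith)]
      · exact Real.rpow_le_rpow_of_exponent_ge h0 hρ1 ha0
    · rw [hαΔ, mul_comm]
      refine mul_le_mul_of_nonneg_right ?_ hτ
      refine (sum_geometric_le (by norm_num) (by norm_num) _ _ le_rfl).trans (by norm_num)
  refine (Finset.sum_le_card_nsmul _ _ _ h1).trans_eq ?_
  rw [nsmul_eq_mul, Finset.card_univ]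
  ring

-- At least `k/2` errors in a cluster give the decay `√ρ ^ k`. The constant `1/2` in front is kept
-- so that one may later condition on an event of probability at least `1/2`.
open Classical in
theorem prob_rooted_le {j : B → U} (hj : Function.Injective j) {D : PMF (PauliOp B)} {p : ℝ}
    (hp0 : 0 ≤ p) (hD : IsLocalStochastic D p) (G : SimpleGraph U) {Δ : ℕ}
    (hΔ : ∀ u, (Finset.univ.filter fun v => G.Adj u v).card ≤ Δ) {α : ℝ} (hα : 0 < α)
    (hαΔ : 2 ^ (Δ + 1) * α = 1 / 16) (hp : p < α ^ 4) {k : ℕ} (hk : 1 ≤ k)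
    (𝒮 : Finset (Finset U)) (h𝒮 : 𝒮.card ≤ 2 ^ k) (hcard : ∀ S ∈ 𝒮, S.card = k) :
    prob D {P | ∃ S ∈ 𝒮, ∃ W, Rooted G S W ∧ W.card ≤ 4 * (W ∩ errs j P).card ∧
      k ≤ 2 * (W ∩ errs j P).card} ≤ 1 / 2 * Real.sqrt (p / α ^ 4) ^ k := by
  have hα1 : α ≤ 1 := by
    have h1 : (1 : ℝ) ≤ 2 ^ (Δ + 1) := one_le_pow₀ (by norm_num)
    nlinarith
  set ρ := p / α ^ 4 with hρ
  have hρ0 : 0 ≤ ρ := by positivity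
  have hρ1 : ρ ≤ 1 := (div_le_one (by positivity)).mpr hp.le
  have hsub : {P | ∃ S ∈ 𝒮, ∃ W, Rooted G S W ∧ W.card ≤ 4 * (W ∩ errs j P).card ∧
      k ≤ 2 * (W ∩ errs j P).card} ⊆ ⋃ S ∈ 𝒮,
      {P | ∃ W, Rooted G S W ∧ k ≤ W.card ∧ W.card ≤ 4 * (W ∩ errs j P).card ∧
        (fun a : ℕ => k ≤ 2 * a) (W ∩ errs j P).card} := by
    rintro P ⟨S, hS, W, hW, h1, h2⟩
    simp only [Set.mem_iUnion]
    exact ⟨S, hS, W, hW, (hcard S hS) ▸ Finset.card_le_card hW.1, h1, h2⟩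
  refine (prob_mono D hsub).trans ((prob_biUnion_le D _ _).trans ?_)
  have hτ : 0 ≤ Real.sqrt ρ ^ k := by positivity
  have h1 : ∀ S ∈ 𝒮, prob D
      {P | ∃ W, Rooted G S W ∧ k ≤ W.card ∧ W.card ≤ 4 * (W ∩ errs j P).card ∧
        (fun a : ℕ => k ≤ 2 * a) (W ∩ errs j P).card} ≤
      Real.sqrt ρ ^ k * ∑ w ∈ Finset.Ico k (Fintype.card U + 1), (1 / 16 : ℝ) ^ w := by
    intro S _
    rw [← hαΔ]
    refine prob_cluster_le hj hD G hΔ S hα hα1 k (fun a : ℕ => k ≤ 2 * a) ?_ hτ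
    intro a ha
    have h2 : ρ ^ a = Real.sqrt ρ ^ (2 * a) := by rw [pow_mul, Real.sq_sqrt hρ0]
    rw [← hρ, h2]
    exact pow_le_pow_of_le_one (Real.sqrt_nonneg _) (Real.sqrt_le_one.mpr hρ1) ha
  refine (Finset.sum_le_card_nsmul _ _ _ h1).trans ?_
  have h3 : (𝒮.card : ℝ) ≤ 2 ^ k := by exact_mod_cast h𝒮
  rw [nsmul_eq_mul, mul_left_comm, mul_comm (1 / 2 : ℝ)]
  refine mul_le_mul_of_nonneg_left ?_ hτ
  refine (mul_le_mul_of_nonneg_right h3 (Finset.sum_nonneg fun _ _ => by positivity)).trans ?_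
  -- Clusters have size at least `k`, so the `2 ^ k` possible root sets are absorbed by raising the
  -- ratio from `1/16` to `1/8`.
  have h4 : (2 : ℝ) ^ k * ∑ w ∈ Finset.Ico k (Fintype.card U + 1), (1 / 16 : ℝ) ^ w ≤
      ∑ w ∈ Finset.Ico k (Fintype.card U + 1), (1 / 8 : ℝ) ^ w := by
    rw [Finset.mul_sum]
    refine Finset.sum_le_sum fun w hw => ?_
    have h5 : (2 : ℝ) ^ k ≤ 2 ^ w :=
      pow_le_pow_right₀ (by norm_num) (Finset.mem_Ico.mp hw).1
    calc (2 : ℝ) ^ k * (1 / 16) ^ w ≤ 2 ^ w * (1 / 16) ^ w :=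
          mul_le_mul_of_nonneg_right h5 (by positivity)
      _ = (1 / 8) ^ w := by rw [← mul_pow]; norm_num
  exact h4.trans ((sum_geometric_le (by norm_num) (by norm_num) _ _ hk).trans (by norm_num))

end ClusterProb

/-! ### Coordinates on the alternating Tanner graph -/

section Coordinates

variable {n mx mz T : ℕ}

/-- The code qubits of the `r`-th odd layer (the layer `2r` when counted from `0`). -/
def ev (v : ATGVertex n mx mz T → ZMod 2) (r : ℕ) : Fin n → ZMod 2 := fun i =>
  if h : r < T + 1 then v (.inl (⟨2 * r, by omega⟩, i)) else 0

/-- The code qubits of the `r`-th even layer (the layer `2r - 1` when counted from `0`). -/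
def od (v : ATGVertex n mx mz T → ZMod 2) : ℕ → Fin n → ZMod 2
  | 0 => 0
  | r + 1 => fun i => if h : r < T then v (.inl (⟨2 * r + 1, by omega⟩, i)) else 0

/-- The `Z` check qubits of the `r`-th odd layer. -/
def zc (v : ATGVertex n mx mz T → ZMod 2) (r : ℕ) : Fin mz → ZMod 2 := fun c =>
  if h : r < T + 1 then v (.inr (.inl (⟨r, h⟩, c))) else 0

/-- The `X` check qubits of the `r`-th even layer. -/
def xc (v : ATGVertex n mx mz T → ZMod 2) : ℕ → Fin mx → ZMod 2
  | 0 => 0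
  | r + 1 => fun c => if h : r < T then v (.inr (.inr (⟨r, h⟩, c))) else 0

/-- The vector with given coordinates. -/
def ofCoords (e o : ℕ → Fin n → ZMod 2) (g : ℕ → Fin mz → ZMod 2) (f : ℕ → Fin mx → ZMod 2) :
    ATGVertex n mx mz T → ZMod 2
  | .inl (t, i) => if t.val % 2 = 0 then e (t.val / 2) i else o (t.val / 2 + 1) i
  | .inr (.inl (r, c)) => g r c
  | .inr (.inr (r, c)) => f (r + 1) c

variable {e o : ℕ → Fin n → ZMod 2} {g : ℕ → Fin mz → ZMod 2} {f : ℕ → Fin mx → ZMod 2}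

lemma ev_ofCoords {r : ℕ} (hr : r ≤ T) : ev (T := T) (ofCoords e o g f) r = e r := by
  funext i; simp [ev, ofCoords, Nat.lt_succ_of_le hr]

lemma od_ofCoords {r : ℕ} (hr : r < T) :
    od (T := T) (ofCoords e o g f) (r + 1) = o (r + 1) := by
  funext i
  have h1 : (2 * r + 1) / 2 = r := by omega
  have h2 : (2 * r + 1) % 2 = 1 := by omega
  simp [od, ofCoords, hr, h1, h2]

lemma zc_ofCoords {r : ℕ} (hr : r ≤ T) : zc (T := T) (ofCoords e o g f) r = g r := by
  funext i; simp [zc, ofCoords, Nat.lt_succ_of_le hr]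

lemma xc_ofCoords {r : ℕ} (hr : r < T) :
    xc (T := T) (ofCoords e o g f) (r + 1) = f (r + 1) := by
  funext i; simp [xc, ofCoords, hr]

lemma ext_coords {v v' : ATGVertex n mx mz T → ZMod 2} (he : ∀ r ≤ T, ev v r = ev v' r)
    (ho : ∀ r < T, od v (r + 1) = od v' (r + 1)) (hg : ∀ r ≤ T, zc v r = zc v' r)
    (hf : ∀ r < T, xc v (r + 1) = xc v' (r + 1)) : v = v' := by
  funext u
  rcases u with ⟨⟨t, ht⟩, i⟩ | ⟨⟨r, hr⟩, c⟩ | ⟨⟨r, hr⟩, c⟩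
  · rcases Nat.even_or_odd' t with ⟨r, rfl | rfl⟩
    · have h := congrFun (he r (by omega)) i
      have hr : r < T + 1 := by omega
      simpa [ev, hr] using h
    · have h := congrFun (ho r (by omega)) i
      have hr : r < T := by omega
      simpa [od, hr] using h
  · have h := congrFun (hg r (by omega)) c
    simpa [zc, hr] using h
  · have h := congrFun (hf r (by omega)) c
    simpa [xc, hr] using h

lemma sum_fin_ite_eq {M : Type} [AddCommMonoid M] {N : ℕ} (k : ℕ) (φ : Fin N → M) :
    (∑ s : Fin N, if s.val = k then φ s else 0) = if h : k < N then φ ⟨k, h⟩ else 0 := by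
  split_ifs with h
  · rw [Finset.sum_eq_single ⟨k, h⟩]
    · simp
    · intro b _ hb
      rw [if_neg fun hk => hb (Fin.ext hk)]
    · simp
  · refine Finset.sum_eq_zero fun s _ => if_neg fun hk => h (by omega)

variable (H : CSSCode n mx mz)

/-- The action of the adjacency matrix of the alternating Tanner graph. -/
def adjMul (v : ATGVertex n mx mz T → ZMod 2) : ATGVertex n mx mz T → ZMod 2 :=
  adjMatrix2 (atgRel H T) *ᵥ v

lemma ite_eq_one (a : ZMod 2) : (if a = 1 then (1 : ZMod 2) else 0) = a := by
  revert a; decide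

lemma adjMul_apply (v : ATGVertex n mx mz T → ZMod 2) (u : ATGVertex n mx mz T) :
    adjMul H v u = (∑ w, relMatrix (atgRel H T) u w * v w) +
      ∑ w, relMatrix (atgRel H T) w u * v w := by
  simp only [adjMul, adjMatrix2, Matrix.mulVec, dotProduct, Matrix.add_apply,
    Matrix.transpose_apply, add_mul, Finset.sum_add_distrib]

lemma adjMul_code (v : ATGVertex n mx mz T → ZMod 2) (t : Fin (2 * T + 1)) (i : Fin n) :
    adjMul H v (.inl (t, i)) =
      (∑ s : Fin (2 * T + 1), if s.val = t.val + 1 then v (.inl (s, i)) else 0) +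
      (∑ r : Fin (T + 1), if t.val = 2 * r.val then (H.HZᵀ *ᵥ fun c => v (.inr (.inl (r, c)))) i
        else 0) +
      (∑ r : Fin T, if t.val = 2 * r.val + 1 then (H.HXᵀ *ᵥ fun c => v (.inr (.inr (r, c)))) i
        else 0) +
      ∑ s : Fin (2 * T + 1), if t.val = s.val + 1 then v (.inl (s, i)) else 0 := by
  rw [adjMul_apply]
  simp only [Fintype.sum_sum_type, Fintype.sum_prod_type, relMatrix, atgRel, ↓reduceIte, zero_mul,
    Finset.sum_const_zero, add_zero]
  rw [← add_assoc]
  congr 1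
  · congr 1
    · congr 1
      · refine Finset.sum_congr rfl fun s _ => ?_
        rw [Finset.sum_eq_single i]
        · by_cases h : s.val = t.val + 1 <;> simp [h]
        · intro b _ hb; simp [hb.symm]
        · simp
      · refine Finset.sum_congr rfl fun r _ => ?_
        by_cases h : t.val = 2 * r.val
        · simp [h, Matrix.mulVec, dotProduct, ite_eq_one]
        · simp [h]
    · refine Finset.sum_congr rfl fun r _ => ?_
      by_cases h : t.val = 2 * r.val + 1
      · simp [h, Matrix.mulVec, dotProduct, ite_eq_one]
      · simp [h]
  · refine Finset.sum_congr rfl fun s _ => ?_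
    rw [Finset.sum_eq_single i]
    · by_cases h : t.val = s.val + 1 <;> simp [h]
    · intro b _ hb; simp [hb]
    · simp

/-- In this and the next three formulas the graph splits into two sectors: `ev` and `xc` of `v`
influence only `od` and `zc` of `A v`, and conversely. The convention that `od` vanishes at `0` and
`T + 1` makes the formula uniform up to the boundary layers. -/
lemma ev_adjMul (v : ATGVertex n mx mz T → ZMod 2) {r : ℕ} (hr : r ≤ T) :
    ev (adjMul H v) r = od v r + od v (r + 1) + H.HZᵀ *ᵥ zc v r := by
  funext i
  have hr' : r < T + 1 := by omega
  simp only [ev, hr', dif_pos, adjMul_code, Pi.add_apply]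
  have h1 : ∀ s : ℕ, (2 * r = 2 * s) ↔ (s = r) := by omega
  have h2 : ∀ s : ℕ, (2 * r = 2 * s + 1) ↔ False := fun s => ⟨by omega, False.elim⟩
  simp only [h1, h2, if_false, Finset.sum_const_zero, add_zero, sum_fin_ite_eq, hr', dif_pos]
  have h3 : (∑ s : Fin (2 * T + 1), if 2 * r = s.val + 1 then v (.inl (s, i)) else 0) =
      od v r i := by
    rcases r with _ | r
    · simp [od]
    · have h4 : ∀ s : ℕ, (2 * (r + 1) = s + 1) ↔ s = 2 * r + 1 := by omega
      have h5 : r < T := by omega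
      have h6 : 2 * r + 1 < 2 * T + 1 := by omega
      simp only [h4, sum_fin_ite_eq, od, h5, h6, dif_pos]
  have h7 : (if h : 2 * r + 1 < 2 * T + 1 then v (.inl (⟨2 * r + 1, h⟩, i)) else 0) =
      od v (r + 1) i := by
    by_cases h : r < T
    · have h6 : 2 * r + 1 < 2 * T + 1 := by omega
      simp only [od, h, h6, dif_pos]
    · have h6 : ¬ 2 * r + 1 < 2 * T + 1 := by omega
      simp only [od, h, h6, dif_neg, not_false_eq_true]
  rw [h3, h7]
  have h8 : (fun c => v (.inr (.inl (⟨r, hr'⟩, c)))) = zc v r := by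
    funext c; simp only [zc, hr', dif_pos]
  rw [h8]
  ring

lemma od_adjMul (v : ATGVertex n mx mz T → ZMod 2) {r : ℕ} (hr : r < T) :
    od (adjMul H v) (r + 1) = ev v r + ev v (r + 1) + H.HXᵀ *ᵥ xc v (r + 1) := by
  funext i
  simp only [od, hr, dif_pos, adjMul_code, Pi.add_apply]
  have h1 : ∀ s : ℕ, (2 * r + 1 = 2 * s) ↔ False := fun s => ⟨by omega, False.elim⟩
  have h2 : ∀ s : ℕ, (2 * r + 1 = 2 * s + 1) ↔ s = r := by omega
  have h3 : ∀ s : ℕ, (2 * r + 1 = s + 1) ↔ s = 2 * r := by omega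
  have h4 : 2 * r < 2 * T + 1 := by omega
  have h5 : 2 * r + 1 + 1 < 2 * T + 1 := by omega
  simp only [h1, h2, h3, if_false, Finset.sum_const_zero, add_zero, sum_fin_ite_eq, hr, h4, h5,
    dif_pos]
  have h8 : (fun c => v (.inr (.inr (⟨r, hr⟩, c)))) = xc v (r + 1) := by
    funext c; simp only [xc, hr, dif_pos]
  have h9 : r < T + 1 := by omega
  have h10 : r + 1 < T + 1 := by omega
  rw [h8]
  simp only [ev, h9, h10, dif_pos, mul_add, mul_one]
  ring

lemma zc_adjMul (v : ATGVertex n mx mz T → ZMod 2) {r : ℕ} (hr : r ≤ T) :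
    zc (adjMul H v) r = H.HZ *ᵥ ev v r := by
  funext c
  have hr' : r < T + 1 := by omega
  simp only [zc, hr', dif_pos, adjMul_apply]
  simp only [Fintype.sum_sum_type, Fintype.sum_prod_type, relMatrix, atgRel, ↓reduceIte, zero_mul,
    Finset.sum_const_zero, add_zero, zero_add]
  rw [Finset.sum_comm]
  refine Finset.sum_congr rfl fun i _ => ?_
  rw [Finset.sum_eq_single ⟨2 * r, by omega⟩]
  · simp only [true_and, ite_eq_one, ev, hr', dif_pos]
  · intro t _ ht
    rw [Ne, Fin.ext_iff] at ht
    simp [ht]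
  · simp

lemma xc_adjMul (v : ATGVertex n mx mz T → ZMod 2) {r : ℕ} (hr : r < T) :
    xc (adjMul H v) (r + 1) = H.HX *ᵥ od v (r + 1) := by
  funext c
  simp only [xc, hr, dif_pos, adjMul_apply]
  simp only [Fintype.sum_sum_type, Fintype.sum_prod_type, relMatrix, atgRel, ↓reduceIte, zero_mul,
    Finset.sum_const_zero, add_zero, zero_add]
  rw [Finset.sum_comm]
  refine Finset.sum_congr rfl fun i _ => ?_
  rw [Finset.sum_eq_single ⟨2 * r + 1, by omega⟩]
  · simp only [true_and, ite_eq_one, od, hr, dif_pos]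
  · intro t _ ht
    rw [Ne, Fin.ext_iff] at ht
    simp [ht]
  · simp

end Coordinates

/-! ### Additivity of the coordinates and their vanishing at the top. -/

section Linear

variable {n mx mz T : ℕ} (v v' : ATGVertex n mx mz T → ZMod 2) (r : ℕ)

lemma ev_add : ev (v + v') r = ev v r + ev v' r := by
  funext i; simp only [ev, Pi.add_apply]; split_ifs <;> simp

lemma od_add : od (v + v') r = od v r + od v' r := by
  rcases r with _ | r
  · simp [od]
  · funext i; simp only [od, Pi.add_apply]; split_ifs <;> simp

lemma zc_add : zc (v + v') r = zc v r + zc v' r := by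
  funext i; simp only [zc, Pi.add_apply]; split_ifs <;> simp

lemma xc_add : xc (v + v') r = xc v r + xc v' r := by
  rcases r with _ | r
  · simp [xc]
  · funext i; simp only [xc, Pi.add_apply]; split_ifs <;> simp

lemma od_top : od v (T + 1) = 0 := by funext i; simp [od]

lemma xc_top : xc v (T + 1) = 0 := by funext i; simp [xc]

lemma adjMul_add (H : CSSCode n mx mz) : adjMul H (v + v') = adjMul H v + adjMul H v' :=
  Matrix.mulVec_add _ _ _

end Linear

/-! ### Local checks -/

section Checks

variable {n mx mz T m : ℕ}

/-- The positions of errors: the qubits of the alternating Tanner graph (where the error is of type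
`Z`), and the unmeasured qubits once more (where the error is of type `X`). -/
abbrev ErrorPos (n mx mz T m : ℕ) : Type := ATGVertex n mx mz T ⊕ (Fin m × Fin n)

/-- The parity checks: detectors on even layers, and syndromes of the unmeasured layers. -/
abbrev CheckIdx (mx mz T m : ℕ) : Type :=
  (Fin (T + 1) × Fin mx) ⊕ (Fin T × Fin mz) ⊕ (Fin m × Fin mz)

/-- The matrix of the parity checks. -/
def checkMatrix (H : CSSCode n mx mz) (σ : Fin m → Fin (T + 1)) :
    Matrix (CheckIdx mx mz T m) (ErrorPos n mx mz T m) (ZMod 2)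
  | .inl (r, c), .inl (.inl (t, i)) => if t.val = 2 * r.val then H.HX c i else 0
  | .inl (r, c), .inl (.inr (.inr (r', c'))) =>
      if c' = c then (if r'.val = r.val then 1 else 0) + (if r'.val + 1 = r.val then 1 else 0)
      else 0
  | .inr (.inl (r, c)), .inl (.inl (t, i)) => if t.val = 2 * r.val + 1 then H.HZ c i else 0
  | .inr (.inl (r, c)), .inl (.inr (.inl (r', c'))) =>
      if c' = c then (if r'.val = r.val then 1 else 0) + (if r'.val = r.val + 1 then 1 else 0)
      else 0
  | .inr (.inr (j, c)), .inl (.inr (.inl (r', c'))) =>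
      if c' = c then (if r'.val = (σ j).val then 1 else 0) else 0
  | .inr (.inr (j, c)), .inr (j', i) => if j' = j then H.HZ c i else 0
  | _, _ => 0

/-- The `j`-th block of a vector on `m` blocks. -/
def blk (w : Fin m × Fin n → ZMod 2) (j : Fin m) : Fin n → ZMod 2 := fun i => w (j, i)

variable (H : CSSCode n mx mz) (σ : Fin m → Fin (T + 1)) (x : ErrorPos n mx mz T m → ZMod 2)

lemma sum_ite_block {ι : Type} [Fintype ι] {M : Type} [AddCommMonoid M] {N : ℕ} {k : ℕ}
    (hk : k < N) (φ : Fin N → ι → M) :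
    (∑ s : Fin N, ∑ i, if s.val = k then φ s i else 0) = ∑ i, φ ⟨k, hk⟩ i := by
  rw [Finset.sum_eq_single ⟨k, hk⟩]
  · simp
  · intro b _ hb
    refine Finset.sum_eq_zero fun i _ => if_neg fun h => hb (Fin.ext h)
  · simp

lemma checkMatrix_mulVec_X (r : Fin (T + 1)) (c : Fin mx) :
    (checkMatrix H σ *ᵥ x) (.inl (r, c)) =
      (H.HX *ᵥ ev (x ∘ .inl) r + xc (x ∘ .inl) r + xc (x ∘ .inl) (r + 1)) c := by
  simp only [Matrix.mulVec, dotProduct, Fintype.sum_sum_type, Fintype.sum_prod_type, checkMatrix,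
    zero_mul, Finset.sum_const_zero, add_zero, zero_add, ite_mul, Pi.add_apply]
  rw [sum_ite_block (k := 2 * r.val) (by omega) (fun t i => H.HX c i * x (.inl (.inl (t, i)))),
    add_assoc]
  congr 1
  · refine Finset.sum_congr rfl fun i _ => ?_
    have hr := r.2
    simp [ev, hr]
  · rw [Finset.sum_comm]
    simp only [Finset.sum_ite_irrel, Finset.sum_const_zero, Finset.sum_ite_eq', Finset.mem_univ,
      if_true, add_mul, ite_mul, one_mul, zero_mul, Finset.sum_add_distrib, sum_fin_ite_eq]
    rw [add_comm]
    congr 1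
    rcases r with ⟨_ | r, hr⟩
    · simp [xc]
    · simp only [Nat.add_right_cancel_iff, sum_fin_ite_eq]
      rfl

lemma checkMatrix_mulVec_Z (r : Fin T) (c : Fin mz) :
    (checkMatrix H σ *ᵥ x) (.inr (.inl (r, c))) =
      (H.HZ *ᵥ od (x ∘ .inl) (r + 1) + zc (x ∘ .inl) r + zc (x ∘ .inl) (r + 1)) c := by
  simp only [Matrix.mulVec, dotProduct, Fintype.sum_sum_type, Fintype.sum_prod_type, checkMatrix,
    zero_mul, Finset.sum_const_zero, add_zero, ite_mul, Pi.add_apply]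
  rw [sum_ite_block (k := 2 * r.val + 1) (by omega)
    (fun t i => H.HZ c i * x (.inl (.inl (t, i)))), add_assoc]
  congr 1
  · refine Finset.sum_congr rfl fun i _ => ?_
    have hr := r.2
    simp [od, hr]
  · rw [Finset.sum_comm]
    simp only [Finset.sum_ite_irrel, Finset.sum_const_zero, Finset.sum_ite_eq', Finset.mem_univ,
      if_true, add_mul, ite_mul, one_mul, zero_mul, Finset.sum_add_distrib, sum_fin_ite_eq]
    rfl

lemma checkMatrix_mulVec_surface (j : Fin m) (c : Fin mz) :
    (checkMatrix H σ *ᵥ x) (.inr (.inr (j, c))) =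
      (H.HZ *ᵥ blk (x ∘ .inr) j + zc (x ∘ .inl) (σ j)) c := by
  simp only [Matrix.mulVec, dotProduct, Fintype.sum_sum_type, Fintype.sum_prod_type, checkMatrix,
    zero_mul, Finset.sum_const_zero, add_zero, zero_add, ite_mul, Pi.add_apply]
  rw [add_comm]
  congr 1
  · rw [Finset.sum_eq_single j]
    · simp [blk]
    · intro b _ hb; simp [hb]
    · simp
  · rw [Finset.sum_comm]
    simp only [Finset.sum_ite_irrel, Finset.sum_const_zero, Finset.sum_ite_eq', Finset.mem_univ,
      if_true, one_mul, sum_fin_ite_eq]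
    rfl

end Checks

/-! ### The degree of the check matrix -/

section Degree

variable {n mx mz T m : ℕ}

lemma hammingNorm_sum {A B : Type} [Fintype A] [Fintype B] (x : A ⊕ B → ZMod 2) :
    hammingNorm x = hammingNorm (fun a => x (.inl a)) + hammingNorm (fun b => x (.inr b)) := by
  simp only [hammingNorm, Finset.card_filter, Fintype.sum_sum_type]

lemma hammingNorm_le_of_slice {N : ℕ} {B : Type} [Fintype B] (x : Fin N × B → ZMod 2) (k : ℕ)
    (y : B → ZMod 2) (h : ∀ a b, x (a, b) ≠ 0 → a.val = k ∧ y b ≠ 0) :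
    hammingNorm x ≤ hammingNorm y := by
  refine Finset.card_le_card_of_injOn Prod.snd ?_ ?_
  · rintro ⟨a, b⟩ hab
    simpa using (h a b (by simpa using hab)).2
  · rintro ⟨a, b⟩ hab ⟨a', b'⟩ hab' hb
    have h1 := (h a b (by simpa using hab)).1
    have h2 := (h a' b' (by simpa using hab')).1
    exact Prod.ext (Fin.ext (h1.trans h2.symm)) hb

lemma hammingNorm_le_two {N : ℕ} {B : Type} [Fintype B] (x : Fin N × B → ZMod 2) (k k' : ℕ)
    (b₀ : B) (h : ∀ a b, x (a, b) ≠ 0 → (a.val = k ∨ a.val = k') ∧ b = b₀) :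
    hammingNorm x ≤ 2 := by
  refine (Finset.card_le_card_of_injOn (t := {k, k'}) (fun p => p.1.val) ?_ ?_).trans
    Finset.card_le_two
  · rintro ⟨a, b⟩ hab
    simpa using (h a b (by simpa using hab)).1
  · rintro ⟨a, b⟩ hab ⟨a', b'⟩ hab' haa
    have h1 := (h a b (by simpa using hab)).2
    have h2 := (h a' b' (by simpa using hab')).2
    exact Prod.ext (Fin.ext haa) (h1.trans h2.symm)

/-- A check consists of one Tanner row and at most two check qubits on neighbouring layers. The
truncated subtraction in `r - 1` at `r = 0` only makes two of the allowed positions coincide. -/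
lemma hammingNorm_row_le {ℓ : ℕ} {H : CSSCode n mx mz} (hH : H.Sparse ℓ)
    (σ : Fin m → Fin (T + 1)) (c : CheckIdx mx mz T m) :
    hammingNorm (checkMatrix H σ c) ≤ ℓ + 2 := by
  obtain ⟨hx, hz, -, -⟩ := hH
  rw [hammingNorm_sum, hammingNorm_sum, hammingNorm_sum]
  rcases c with ⟨r, c⟩ | ⟨r, c⟩ | ⟨j, c⟩
  · have h1 := hammingNorm_le_of_slice
      (fun a => checkMatrix H σ (.inl (r, c)) (.inl (.inl a))) (2 * r.val) (H.HX c)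
      (fun t i h => by simpa [checkMatrix] using h)
    have h2 := hammingNorm_le_two
      (fun a => checkMatrix H σ (.inl (r, c)) (.inl (.inr (.inr a)))) r.val (r.val - 1) c
      (fun r' c' h => by
        simp only [checkMatrix] at h
        split_ifs at h with h3 h4 h5 h5 <;> first | exact absurd rfl h | skip
        all_goals refine ⟨?_, h3⟩
        all_goals omega)
    have h3 : hammingNorm (fun a => checkMatrix H σ (.inl (r, c)) (.inl (.inr (.inl a)))) = 0 := by
      simp [checkMatrix, hammingNorm]
    have h4 : hammingNorm (fun a => checkMatrix H σ (.inl (r, c)) (.inr a)) = 0 := by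
      simp [checkMatrix, hammingNorm]
    have := hx c
    omega
  · have h1 := hammingNorm_le_of_slice
      (fun a => checkMatrix H σ (.inr (.inl (r, c))) (.inl (.inl a))) (2 * r.val + 1) (H.HZ c)
      (fun t i h => by simpa [checkMatrix] using h)
    have h2 := hammingNorm_le_two
      (fun a => checkMatrix H σ (.inr (.inl (r, c))) (.inl (.inr (.inl a)))) r.val (r.val + 1) c
      (fun r' c' h => by
        simp only [checkMatrix] at h
        split_ifs at h with h3 h4 h5 h5 <;> first | exact absurd rfl h | skip
        all_goals refine ⟨?_, h3⟩
        all_goals omega)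
    have h3 : hammingNorm (fun a =>
        checkMatrix H σ (.inr (.inl (r, c))) (.inl (.inr (.inr a)))) = 0 := by
      simp [checkMatrix, hammingNorm]
    have h4 : hammingNorm (fun a => checkMatrix H σ (.inr (.inl (r, c))) (.inr a)) = 0 := by
      simp [checkMatrix, hammingNorm]
    have := hz c
    omega
  · have h1 := hammingNorm_le_of_slice
      (fun a => checkMatrix H σ (.inr (.inr (j, c))) (.inr a)) j.val (H.HZ c)
      (fun t i h => by simpa [checkMatrix, Fin.ext_iff] using h)
    have h2 := hammingNorm_le_two
      (fun a => checkMatrix H σ (.inr (.inr (j, c))) (.inl (.inr (.inl a)))) (σ j).val (σ j).val c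
      (fun r' c' h => by
        simp only [checkMatrix] at h
        split_ifs at h with h3 h4 <;> first | exact absurd rfl h | skip
        exact ⟨Or.inl h4, h3⟩)
    have h3 : hammingNorm (fun a =>
        checkMatrix H σ (.inr (.inr (j, c))) (.inl (.inr (.inr a)))) = 0 := by
      simp [checkMatrix, hammingNorm]
    have h4 : hammingNorm (fun a =>
        checkMatrix H σ (.inr (.inr (j, c))) (.inl (.inl a))) = 0 := by
      simp [checkMatrix, hammingNorm]
    have := hz c
    omega

lemma hammingNorm_col_le {ℓ : ℕ} {H : CSSCode n mx mz} (hH : H.Sparse ℓ)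
    {σ : Fin m → Fin (T + 1)} (hσ : Function.Injective σ) (u : ErrorPos n mx mz T m) :
    hammingNorm ((checkMatrix H σ)ᵀ u) ≤ 2 * ℓ + 4 := by
  obtain ⟨-, -, hx, hz⟩ := hH
  rw [hammingNorm_sum, hammingNorm_sum]
  simp only [Matrix.transpose_apply]
  rcases u with (⟨t, i⟩ | ⟨r, c⟩ | ⟨r, c⟩) | ⟨j, i⟩
  · have h1 := hammingNorm_le_of_slice
      (fun a => checkMatrix H σ (.inl a) (.inl (.inl (t, i)))) (t.val / 2) (H.HXᵀ i)
      (fun r c h => by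
        simp only [checkMatrix, ne_eq, ite_eq_right_iff, Classical.not_imp] at h
        exact ⟨by omega, h.2⟩)
    have h2 := hammingNorm_le_of_slice
      (fun a => checkMatrix H σ (.inr (.inl a)) (.inl (.inl (t, i)))) (t.val / 2) (H.HZᵀ i)
      (fun r c h => by
        simp only [checkMatrix, ne_eq, ite_eq_right_iff, Classical.not_imp] at h
        exact ⟨by omega, h.2⟩)
    have h3 : hammingNorm (fun a => checkMatrix H σ (.inr (.inr a)) (.inl (.inl (t, i)))) = 0 := by
      simp [checkMatrix, hammingNorm]
    have := hx i
    have := hz i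
    omega
  · have h1 : hammingNorm (fun a =>
        checkMatrix H σ (.inl a) (.inl (.inr (.inl (r, c))))) = 0 := by
      simp [checkMatrix, hammingNorm]
    have h2 := hammingNorm_le_two
      (fun a => checkMatrix H σ (.inr (.inl a)) (.inl (.inr (.inl (r, c))))) r.val (r.val - 1) c
      (fun r' c' h => by
        simp only [checkMatrix] at h
        split_ifs at h with h3 h4 h5 h5 <;> first | exact absurd rfl h | skip
        all_goals refine ⟨?_, h3.symm⟩
        all_goals omega)
    have h3 : hammingNorm (fun a =>
        checkMatrix H σ (.inr (.inr a)) (.inl (.inr (.inl (r, c))))) ≤ 2 := by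
      by_cases hr : ∃ j, σ j = r
      · obtain ⟨j, rfl⟩ := hr
        refine hammingNorm_le_two _ j.val j.val c fun j' c' h => ?_
        simp only [checkMatrix] at h
        split_ifs at h with h3 h4 <;> first | exact absurd rfl h | skip
        exact ⟨Or.inl (by rw [hσ (Fin.ext h4)]), h3.symm⟩
      · refine hammingNorm_le_two _ 0 0 c fun j' c' h => ?_
        simp only [checkMatrix] at h
        split_ifs at h with h3 h4 <;> first | exact absurd rfl h | skip
        exact absurd ⟨j', Fin.ext h4.symm⟩ hr
    omega
  · have h1 := hammingNorm_le_two
      (fun a => checkMatrix H σ (.inl a) (.inl (.inr (.inr (r, c))))) r.val (r.val + 1) c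
      (fun r' c' h => by
        simp only [checkMatrix] at h
        split_ifs at h with h3 h4 h5 h5 <;> first | exact absurd rfl h | skip
        all_goals refine ⟨?_, h3.symm⟩
        all_goals omega)
    have h2 : hammingNorm (fun a =>
        checkMatrix H σ (.inr (.inl a)) (.inl (.inr (.inr (r, c))))) = 0 := by
      simp [checkMatrix, hammingNorm]
    have h3 : hammingNorm (fun a =>
        checkMatrix H σ (.inr (.inr a)) (.inl (.inr (.inr (r, c))))) = 0 := by
      simp [checkMatrix, hammingNorm]
    omega
  · have h1 : hammingNorm (fun a => checkMatrix H σ (.inl a) (.inr (j, i))) = 0 := by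
      simp [checkMatrix, hammingNorm]
    have h2 : hammingNorm (fun a => checkMatrix H σ (.inr (.inl a)) (.inr (j, i))) = 0 := by
      simp [checkMatrix, hammingNorm]
    have h3 := hammingNorm_le_of_slice
      (fun a => checkMatrix H σ (.inr (.inr a)) (.inr (j, i))) j.val (H.HZᵀ i)
      (fun j' c h => by
        simp only [checkMatrix, ne_eq, ite_eq_right_iff, Classical.not_imp] at h
        exact ⟨by rw [h.1], h.2⟩)
    have := hz i
    omega

end Degree

/-! ### Residual errors -/

section Residual

variable {n mx mz T m : ℕ} (H : CSSCode n mx mz) (σ : Fin m → Fin (T + 1))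

/-- The errors that violate no parity check. -/
def localSub : Submodule (ZMod 2) (ErrorPos n mx mz T m → ZMod 2) :=
  LinearMap.ker (checkMatrix H σ).mulVecLin

/-- The stabilizer `∏ K_v^{η_v}` of the graph state as an error: its `Z` part, and its `X` part on
the unmeasured qubits. -/
def fullError : (ATGVertex n mx mz T → ZMod 2) →ₗ[ZMod 2] (ErrorPos n mx mz T m → ZMod 2) where
  toFun η := Sum.elim (adjMul H η) (η ∘ surface n mx mz σ)
  map_add' η η' := by
    funext u
    rcases u with u | u <;> simp [adjMul_add]
  map_smul' a η := by
    funext u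
    rcases u with u | u <;> simp [adjMul, Matrix.mulVec_smul]

/-- The errors that act trivially. -/
def fullSub : Submodule (ZMod 2) (ErrorPos n mx mz T m → ZMod 2) := LinearMap.range (fullError H σ)

open Classical in
/-- The measured positions. -/
def bulkPos (n mx mz : ℕ) {T m : ℕ} (σ : Fin m → Fin (T + 1)) : Finset (ErrorPos n mx mz T m) :=
  Finset.univ.filter fun u => ∃ v, u = .inl v ∧ v ∉ Set.range (surface n mx mz σ)

/-- The checks that involve measured positions only. -/
def IsBulkCheck : CheckIdx mx mz T m → Prop
  | .inl (r, _) => r ∉ Set.range σ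
  | .inr (.inl _) => True
  | .inr (.inr _) => False

/-- The errors in the bulk that violate no bulk check. -/
def bulkSub : Submodule (ZMod 2) (ErrorPos n mx mz T m → ZMod 2) where
  carrier := {z | (∀ u ∉ bulkPos n mx mz σ, z u = 0) ∧
    ∀ c, IsBulkCheck σ c → (checkMatrix H σ *ᵥ z) c = 0}
  zero_mem' := ⟨fun _ _ => rfl, fun c _ => by simp⟩
  add_mem' := fun ha hb => ⟨fun u hu => by simp [ha.1 u hu, hb.1 u hu],
    fun c hc => by simp [Matrix.mulVec_add, ha.2 c hc, hb.2 c hc]⟩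
  smul_mem' := fun a x hx => ⟨fun u hu => by simp [hx.1 u hu],
    fun c hc => by simp [Matrix.mulVec_smul, hx.2 c hc]⟩

variable {H σ}

lemma surface_injective (hσ : Function.Injective σ) :
    Function.Injective (surface n mx mz σ) := by
  rintro ⟨j, i⟩ ⟨j', i'⟩ h
  simp only [surface, Sum.inl.injEq, Prod.mk.injEq, Fin.mk.injEq] at h
  have h1 : 2 * (σ j).val = 2 * (σ j').val := h.1
  exact Prod.ext (hσ (show σ j = σ j' from Fin.ext (by omega))) h.2

lemma inl_mem_bulkPos {v : ATGVertex n mx mz T} :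
    (Sum.inl v : ErrorPos n mx mz T m) ∈ bulkPos n mx mz σ ↔
      v ∉ Set.range (surface n mx mz σ) := by
  simp [bulkPos]

lemma inr_notMem_bulkPos {q : Fin m × Fin n} :
    (Sum.inr q : ErrorPos n mx mz T m) ∉ bulkPos n mx mz σ := by
  simp [bulkPos]

lemma mem_localSub_iff {x : ErrorPos n mx mz T m → ZMod 2} :
    x ∈ localSub H σ ↔
      (∀ r ≤ T, H.HX *ᵥ ev (x ∘ .inl) r = xc (x ∘ .inl) r + xc (x ∘ .inl) (r + 1)) ∧
      (∀ r < T, H.HZ *ᵥ od (x ∘ .inl) (r + 1) = zc (x ∘ .inl) r + zc (x ∘ .inl) (r + 1)) ∧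
      ∀ j, H.HZ *ᵥ blk (x ∘ .inr) j = zc (x ∘ .inl) (σ j) := by
  rw [localSub, LinearMap.mem_ker, Matrix.mulVecLin_apply]
  constructor
  · intro h
    refine ⟨fun r hr => ?_, fun r hr => ?_, fun j => ?_⟩
    · funext c
      have h1 := congrFun h (.inl (⟨r, by omega⟩, c))
      rw [checkMatrix_mulVec_X] at h1
      rw [← sub_eq_zero, ZModModule.sub_eq_add]
      simpa [add_assoc] using h1
    · funext c
      have h1 := congrFun h (.inr (.inl (⟨r, hr⟩, c)))
      rw [checkMatrix_mulVec_Z] at h1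
      rw [← sub_eq_zero, ZModModule.sub_eq_add]
      simpa [add_assoc] using h1
    · funext c
      have h1 := congrFun h (.inr (.inr (j, c)))
      rw [checkMatrix_mulVec_surface] at h1
      rw [← sub_eq_zero, ZModModule.sub_eq_add]
      simpa using h1
  · rintro ⟨h1, h2, h3⟩
    funext c
    rcases c with ⟨r, c⟩ | ⟨r, c⟩ | ⟨j, c⟩
    · rw [checkMatrix_mulVec_X, h1 r (by omega), add_assoc, ZModModule.add_self]; rfl
    · rw [checkMatrix_mulVec_Z, h2 r (by omega), add_assoc, ZModModule.add_self]; rfl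
    · rw [checkMatrix_mulVec_surface, h3, ZModModule.add_self]; rfl

/-- This is where `H^X (H^Z)ᵀ = 0` enters: it kills the contribution of the check qubits of `η`, and
the contribution of the adjacent layers is what the check qubits of `A η` record. -/
lemma fullSub_le_localSub : fullSub H σ ≤ localSub H σ := by
  rintro _ ⟨η, rfl⟩
  have h1 : (fullError H σ η) ∘ Sum.inl = adjMul H η := rfl
  have h2 : ∀ j, blk ((fullError H σ η) ∘ Sum.inr) j = ev η (σ j) := by
    intro j
    funext i
    have := (σ j).2
    simp [blk, fullError, ev, surface, this]
  rw [mem_localSub_iff]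
  simp only [h1, h2]
  refine ⟨fun r hr => ?_, fun r hr => ?_, fun j => ?_⟩
  · rw [ev_adjMul H η hr, Matrix.mulVec_add, Matrix.mulVec_add, H.HX_mulVec_HZ_transpose, add_zero]
    congr 1
    · rcases r with _ | r
      · simp [od, xc]
      · rw [xc_adjMul H η (by omega)]
    · rcases hr.eq_or_lt with rfl | hr
      · rw [od_top, xc_top, Matrix.mulVec_zero]
      · rw [xc_adjMul H η hr]
  · rw [od_adjMul H η hr, Matrix.mulVec_add, Matrix.mulVec_add, H.HZ_mulVec_HX_transpose, add_zero,
      zc_adjMul H η hr.le, zc_adjMul H η hr]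
  · rw [zc_adjMul H η (by omega)]

/-- Bulk checks only involve bulk positions. -/
lemma mem_bulkPos_of_check {c : CheckIdx mx mz T m} (hc : IsBulkCheck σ c)
    {u : ErrorPos n mx mz T m} (hu : checkMatrix H σ c u ≠ 0) : u ∈ bulkPos n mx mz σ := by
  rcases c with ⟨r, c⟩ | ⟨r, c⟩ | ⟨j, c⟩ <;>
    rcases u with (⟨t, i⟩ | ⟨r', c'⟩ | ⟨r', c'⟩) | ⟨j', i⟩ <;>
    simp only [checkMatrix, ne_eq, not_true_eq_false] at hu <;>
    first
      | exact absurd hc not_false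
      | (rw [inl_mem_bulkPos]; rintro ⟨⟨j, i'⟩, h⟩; simp [surface] at h)
  · have ht : t.val = 2 * r.val := by by_contra h'; simp [h'] at hu
    refine hc ⟨j, Fin.ext ?_⟩
    have := congrArg Fin.val h.1
    simp only at this
    omega
  · have ht : t.val = 2 * r.val + 1 := by by_contra h'; simp [h'] at hu
    have := congrArg Fin.val h.1
    simp only at this
    omega

lemma restr_mem_bulkSub {x : ErrorPos n mx mz T m → ZMod 2}
    (hx : x ∈ localSub H σ) : restr (bulkPos n mx mz σ) x ∈ bulkSub H σ := by
  refine ⟨fun u hu => by simp [restr, hu], fun c hc => ?_⟩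
  have h0 : (checkMatrix H σ *ᵥ x) c = 0 := congrFun (LinearMap.mem_ker.mp hx) c
  rw [← h0]
  refine Finset.sum_congr rfl fun u _ => ?_
  by_cases hu : checkMatrix H σ c u = 0
  · simp [hu]
  · simp [restr, mem_bulkPos_of_check hc hu]

lemma sum_Ico_telescope {A : Type} [AddCommGroup A] [Module (ZMod 2) A] (F : ℕ → A) {a b : ℕ}
    (hab : a ≤ b) : ∑ r ∈ Finset.Ico a b, (F r + F (r + 1)) = F a + F b := by
  induction b, hab using Nat.le_induction with
  | base => simp [ZModModule.add_self]
  | succ b hab ih =>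
    rw [Finset.sum_Ico_succ_top hab, ih, add_add_add_comm, ← add_assoc (F a + F b),
      add_assoc (F a) (F b), ZModModule.add_self, add_zero]

/-- Summing code qubits over consecutive layers cancels all intermediate check qubits. Both the
homology classes and the pushing of errors rest on this. -/
lemma mulVec_sum_telescope {k : ℕ} (A : Matrix (Fin k) (Fin n) (ZMod 2)) (y : ℕ → Fin n → ZMod 2)
    (F : ℕ → Fin k → ZMod 2) {a b : ℕ} (hab : a ≤ b)
    (h : ∀ r, a ≤ r → r < b → A *ᵥ y r = F r + F (r + 1)) :
    A *ᵥ (∑ r ∈ Finset.Ico a b, y r) = F a + F b := by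
  rw [← sum_Ico_telescope F hab, ← Matrix.mulVecLin_apply, map_sum]
  refine Finset.sum_congr rfl fun r hr => ?_
  rw [Finset.mem_Ico] at hr
  exact h r hr.1 hr.2

lemma blk_comp_surface (η : ATGVertex n mx mz T → ZMod 2) (j : Fin m) :
    blk (η ∘ surface n mx mz σ) j = ev η (σ j) := by
  funext i
  have := (σ j).2
  simp [blk, ev, surface, this]

/-- Stabilizers with a prescribed effect on even layers and on `Z` checks. -/
lemma exists_stabilizer_X (hσ : Function.Injective σ) {j₀ : Fin m}
    (o : ℕ → Fin n → ZMod 2) (g : ℕ → Fin mz → ZMod 2) (w : Fin m × Fin n → ZMod 2)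
    (ho : ∀ r < T, H.HZ *ᵥ o (r + 1) = g r + g (r + 1)) (hw : H.HZ *ᵥ blk w j₀ = g 0)
    (hrow : ∀ j, blk w j + (blk w j₀ + ∑ r ∈ Finset.Ico 0 (σ j).val, o (r + 1)) ∈ H.rowX) :
    ∃ η : ATGVertex n mx mz T → ZMod 2, (∀ r, od η r = 0) ∧ (∀ r, zc η r = 0) ∧
      (∀ r < T, od (adjMul H η) (r + 1) = o (r + 1)) ∧ (∀ r ≤ T, zc (adjMul H η) r = g r) ∧
      η ∘ surface n mx mz σ = w := by
  classical
  -- `c` transports the block `w j₀` upwards through the layers. By `hrow` the prescribed blocks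
  -- agree with it modulo `H.rowX`, and the X check qubits absorb the discrepancy.
  let c : ℕ → Fin n → ZMod 2 := fun r => blk w j₀ + ∑ s ∈ Finset.Ico 0 r, o (s + 1)
  let e : ℕ → Fin n → ZMod 2 := fun r =>
    if h : ∃ j, (σ j).val = r then blk w h.choose else c r
  have heσ : ∀ j, e (σ j) = blk w j := by
    intro j
    have h : ∃ j', (σ j').val = (σ j).val := ⟨j, rfl⟩
    simp only [e, dif_pos h]
    rw [hσ (Fin.ext h.choose_spec)]
  have hec : ∀ r, e r + c r ∈ H.rowX := by
    intro r
    by_cases h : ∃ j, (σ j).val = r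
    · obtain ⟨j, rfl⟩ := h
      rw [heσ]; exact hrow j
    · simp only [e, dif_neg h, ZModModule.add_self]
      exact Submodule.zero_mem _
  have hcs : ∀ r, c (r + 1) = c r + o (r + 1) := by
    intro r
    simp only [c]
    rw [Finset.sum_Ico_succ_top (Nat.zero_le r), add_assoc]
  have hc : ∀ r ≤ T, H.HZ *ᵥ c r = g r := by
    intro r hr
    simp only [c]
    rw [Matrix.mulVec_add, hw, mulVec_sum_telescope H.HZ (fun s => o (s + 1)) g (Nat.zero_le r)
      (fun s _ hs => ho s (by omega)), ← add_assoc, ZModModule.add_self, zero_add]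
  have he : ∀ r ≤ T, H.HZ *ᵥ e r = g r := by
    intro r hr
    obtain ⟨u, hu⟩ := (H.mem_rowX_iff _).mp (hec r)
    have h1 : e r = H.HXᵀ *ᵥ u + c r := by
      rw [hu, add_assoc, ZModModule.add_self, add_zero]
    rw [h1, Matrix.mulVec_add, H.HZ_mulVec_HX_transpose, zero_add, hc r hr]
  have hf : ∀ r, ∃ u, H.HXᵀ *ᵥ u = e r + e (r + 1) + o (r + 1) := by
    intro r
    rw [← H.mem_rowX_iff]
    have h1 := Submodule.add_mem _ (hec r) (hec (r + 1))
    rw [hcs] at h1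
    convert h1 using 1
    have h2 := ZModModule.add_self (c r)
    linear_combination (exp := 1) -h2
  choose f hf using hf
  -- The X check qubits are numbered from 1, whereas `f r` corrects the step from `r` to `r + 1`.
  refine ⟨ofCoords e 0 0 (fun r => f (r - 1)), ?_, ?_, ?_, ?_, ?_⟩
  · intro r
    rcases r with _ | r
    · rfl
    · by_cases hr : r < T
      · rw [od_ofCoords hr]; rfl
      · funext i; simp [od, hr]
  · intro r
    by_cases hr : r < T + 1
    · rw [zc_ofCoords (by omega)]; rfl
    · funext i; simp [zc, hr]
  · intro r hr
    rw [od_adjMul H _ hr, ev_ofCoords hr.le, ev_ofCoords hr, xc_ofCoords hr, Nat.add_sub_cancel,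
      hf, ← add_assoc, ZModModule.add_self, zero_add]
  · intro r hr
    rw [zc_adjMul H _ hr, ev_ofCoords hr, he r hr]
  · funext q
    have h1 := congrFun (blk_comp_surface (σ := σ) (ofCoords e 0 0 (fun r => f (r - 1)) :
      ATGVertex n mx mz T → ZMod 2) q.1) q.2
    rw [ev_ofCoords (by omega), heσ] at h1
    exact h1

/-- Stabilizers with a prescribed effect on odd layers and on `X` checks. -/
lemma exists_stabilizer_Z (e : ℕ → Fin n → ZMod 2) (F : ℕ → Fin mx → ZMod 2)
    (he : ∀ r ≤ T, H.HX *ᵥ e r = F r + F (r + 1)) (hF : F 0 = 0)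
    (hsum : ∑ r ∈ Finset.Ico 0 (T + 1), e r ∈ H.rowZ) :
    ∃ η : ATGVertex n mx mz T → ZMod 2, (∀ r, ev η r = 0) ∧ (∀ r, xc η r = 0) ∧
      (∀ r ≤ T, ev (adjMul H η) r = e r) ∧
      ∀ r < T, xc (adjMul H η) (r + 1) = F (r + 1) := by
  obtain ⟨a, ha⟩ := (H.mem_rowZ_iff _).mp hsum
  -- Partial sums solve the equations from the bottom upwards. The total left over at the top lies
  -- in `H.rowZ` and is produced by the Z check qubits of the last layer alone.
  let O : ℕ → Fin n → ZMod 2 := fun r => ∑ s ∈ Finset.Ico 0 r, e s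
  let z : ℕ → Fin mz → ZMod 2 := fun r => if r = T then a else 0
  have hO : ∀ r, O (r + 1) = O r + e r := fun r => Finset.sum_Ico_succ_top (Nat.zero_le r) _
  have hod : ∀ r ≤ T, od (ofCoords 0 O z 0 : ATGVertex n mx mz T → ZMod 2) r = O r := by
    intro r hr
    rcases r with _ | r
    · simp [od, O]
    · rw [od_ofCoords (by omega)]
  refine ⟨ofCoords 0 O z 0, ?_, ?_, ?_, ?_⟩
  · intro r
    by_cases hr : r < T + 1
    · rw [ev_ofCoords (by omega)]; rfl
    · funext i; simp [ev, hr]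
  · intro r
    rcases r with _ | r
    · rfl
    · by_cases hr : r < T
      · rw [xc_ofCoords hr]; rfl
      · funext i; simp [xc, hr]
  · intro r hr
    rw [ev_adjMul H _ hr, zc_ofCoords hr, hod r hr]
    rcases hr.eq_or_lt with rfl | hr
    · have h1 : z r = a := if_pos rfl
      have h2 : H.HZᵀ *ᵥ a = O r + e r := by rw [ha, ← hO]
      rw [od_top, h1, h2, add_zero, ← add_assoc, ZModModule.add_self, zero_add]
    · have h1 : z r = 0 := if_neg hr.ne
      rw [h1, Matrix.mulVec_zero, hod _ hr, hO, add_zero, ← add_assoc, ZModModule.add_self,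
        zero_add]
  · intro r hr
    rw [xc_adjMul H _ hr, hod _ hr]
    simp only [O]
    rw [mulVec_sum_telescope H.HX e F (Nat.zero_le _) (fun s _ hs => he s (by omega)), hF, zero_add]

/-- An error that violates no check and has trivial homology acts trivially. -/
lemma exists_adjMul_eq (hσ : Function.Injective σ) {j₀ : Fin m}
    (e o : ℕ → Fin n → ZMod 2) (F : ℕ → Fin mx → ZMod 2) (g : ℕ → Fin mz → ZMod 2)
    (w : Fin m × Fin n → ZMod 2)
    (he : ∀ r ≤ T, H.HX *ᵥ e r = F r + F (r + 1)) (hF : F 0 = 0)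
    (hsum : ∑ r ∈ Finset.Ico 0 (T + 1), e r ∈ H.rowZ)
    (ho : ∀ r < T, H.HZ *ᵥ o (r + 1) = g r + g (r + 1)) (hw : H.HZ *ᵥ blk w j₀ = g 0)
    (hrow : ∀ j, blk w j + (blk w j₀ + ∑ r ∈ Finset.Ico 0 (σ j).val, o (r + 1)) ∈ H.rowX) :
    ∃ η : ATGVertex n mx mz T → ZMod 2, η ∘ surface n mx mz σ = w ∧
      (∀ r ≤ T, ev (adjMul H η) r = e r) ∧ (∀ r < T, od (adjMul H η) (r + 1) = o (r + 1)) ∧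
      (∀ r ≤ T, zc (adjMul H η) r = g r) ∧ ∀ r < T, xc (adjMul H η) (r + 1) = F (r + 1) := by
  obtain ⟨a, a1, a2, a3, a4, a5⟩ := exists_stabilizer_X hσ o g w ho hw hrow
  obtain ⟨b, b1, b2, b3, b4⟩ := exists_stabilizer_Z e F he hF hsum
  -- `a` and `b` live in opposite sectors, so neither disturbs the coordinates prescribed for the
  -- other.
  refine ⟨a + b, ?_, ?_, ?_, ?_, ?_⟩
  · have h : b ∘ surface n mx mz σ = 0 := by
      funext q
      have := congrFun (blk_comp_surface (σ := σ) b q.1) q.2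
      rw [b1] at this
      exact this
    calc (a + b) ∘ surface n mx mz σ = a ∘ surface n mx mz σ + b ∘ surface n mx mz σ := rfl
      _ = w := by rw [a5, h, add_zero]
  · intro r hr
    rw [adjMul_add, ev_add, b3 r hr, ev_adjMul H a hr, a1, a1, a2]; simp
  · intro r hr
    rw [adjMul_add, od_add, a3 r hr, od_adjMul H b hr, b1, b1, b2]; simp
  · intro r hr
    rw [adjMul_add, zc_add, a4 r hr, zc_adjMul H b hr, b1]; simp
  · intro r hr
    rw [adjMul_add, xc_add, b4 r hr, xc_adjMul H a hr, a1]; simp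

end Residual

/-! ### Homology of undetected errors. -/

section Homology

variable {n mx mz T m : ℕ} {H : CSSCode n mx mz} {σ : Fin m → Fin (T + 1)}

lemma ev_ne_zero {v : ATGVertex n mx mz T → ZMod 2} {r : ℕ} {i : Fin n} (h : ev v r i ≠ 0) :
    ∃ hr : r < T + 1, v (.inl (⟨2 * r, by omega⟩, i)) ≠ 0 := by
  by_cases hr : r < T + 1
  · exact ⟨hr, by simpa [ev, hr] using h⟩
  · simp [ev, hr] at h

lemma od_succ_ne_zero {v : ATGVertex n mx mz T → ZMod 2} {r : ℕ} {i : Fin n}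
    (h : od v (r + 1) i ≠ 0) :
    ∃ hr : r < T, v (.inl (⟨2 * r + 1, by omega⟩, i)) ≠ 0 := by
  by_cases hr : r < T
  · exact ⟨hr, by simpa [od, hr] using h⟩
  · simp [od, hr] at h

/-- The sum over odd layers, modulo `H.rowZ`, and the transported differences of blocks, modulo
`H.rowX`, are the only obstructions to being a stabilizer. -/
lemma mem_fullSub_of_trivial_homology (hσ : Function.Injective σ) {j₀ : Fin m}
    (hj₀ : (σ j₀).val = 0) {x : ErrorPos n mx mz T m → ZMod 2} (hx : x ∈ localSub H σ)
    (hsum : ∑ r ∈ Finset.Ico 0 (T + 1), ev (x ∘ .inl) r ∈ H.rowZ)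
    (hrow : ∀ j, blk (x ∘ .inr) j + (blk (x ∘ .inr) j₀ +
      ∑ r ∈ Finset.Ico 0 (σ j).val, od (x ∘ .inl) (r + 1)) ∈ H.rowX) :
    x ∈ fullSub H σ := by
  obtain ⟨h1, h2, h3⟩ := mem_localSub_iff.mp hx
  have h4 := h3 j₀
  rw [hj₀] at h4
  obtain ⟨η, a1, a2, a3, a4, a5⟩ := exists_adjMul_eq hσ _ _ _ _ _ h1 rfl hsum h2 h4 hrow
  refine ⟨η, ?_⟩
  have h5 : adjMul H η = x ∘ Sum.inl := ext_coords a2 a3 a4 a5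
  funext u
  rcases u with u | u
  · exact congrFun h5 u
  · exact congrFun a1 u

/-- The code qubit at a position. -/
def codeIndex : ErrorPos n mx mz T m → Option (Fin n)
  | .inl (.inl (_, i)) => some i
  | .inr (_, i) => some i
  | _ => none

/-- Errors of weight less than the distance that violate no check act trivially. -/
lemma mem_fullSub_of_card_lt (hσ : Function.Injective σ) {j₀ : Fin m}
    (hj₀ : (σ j₀).val = 0) {d : ℕ}
    (hdX : ∀ y, H.HZ *ᵥ y = 0 → hammingNorm y < d → y ∈ H.rowX)
    (hdZ : ∀ y, H.HX *ᵥ y = 0 → hammingNorm y < d → y ∈ H.rowZ)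
    {x : ErrorPos n mx mz T m → ZMod 2} (hx : x ∈ localSub H σ) (hxd : (suppF x).card < d) :
    x ∈ fullSub H σ := by
  classical
  -- The homology representatives are supported on the code indices occurring in `x`, and projecting
  -- to code indices does not increase weight.
  have key : ∀ y : Fin n → ZMod 2, (∀ i, y i ≠ 0 → ∃ u ∈ suppF x, codeIndex u = some i) →
      hammingNorm y < d := by
    intro y hy
    refine lt_of_le_of_lt ?_ hxd
    rw [hammingNorm, ← Finset.card_image_of_injective _ (Option.some_injective (Fin n))]
    refine (Finset.card_le_card (t := (suppF x).image codeIndex) fun a ha => ?_).trans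
      Finset.card_image_le
    obtain ⟨i, hi, rfl⟩ := Finset.mem_image.mp ha
    obtain ⟨u, hu, hui⟩ := hy i (by simpa using hi)
    exact Finset.mem_image.mpr ⟨u, hu, hui⟩
  obtain ⟨h1, h2, h3⟩ := mem_localSub_iff.mp hx
  refine mem_fullSub_of_trivial_homology hσ hj₀ hx ?_ fun j => ?_
  · refine hdZ _ ?_ (key _ fun i hi => ?_)
    · rw [mulVec_sum_telescope H.HX _ (xc (x ∘ .inl)) (Nat.zero_le _)
        (fun r _ hr => h1 r (by omega)), xc_top]
      simp [xc]
    · rw [Finset.sum_apply] at hi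
      obtain ⟨r, -, hr⟩ := Finset.exists_ne_zero_of_sum_ne_zero hi
      obtain ⟨hrT, hr⟩ := ev_ne_zero hr
      exact ⟨_, mem_suppF.mpr hr, rfl⟩
  · refine hdX _ ?_ (key _ fun i hi => ?_)
    · rw [Matrix.mulVec_add, Matrix.mulVec_add, h3, h3, hj₀,
        mulVec_sum_telescope H.HZ _ (zc (x ∘ .inl)) (Nat.zero_le _)
        (fun r _ hr => h2 r (by have := (σ j).2; omega)), ← add_assoc (zc _ 0),
        ZModModule.add_self, zero_add, ZModModule.add_self]
    · by_contra! hne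
      have hb : ∀ j', blk (x ∘ .inr) j' i = 0 := by
        intro j'
        by_contra h
        exact hne (.inr (j', i)) (mem_suppF.mpr h) rfl
      have ho : ∀ r, od (x ∘ .inl) (r + 1) i = 0 := by
        intro r
        by_contra h
        obtain ⟨hrT, hr⟩ := od_succ_ne_zero h
        exact hne _ (mem_suppF.mpr hr) rfl
      apply hi
      simp [hb, ho, Finset.sum_apply]

lemma mem_bulkSub_coords {z : ErrorPos n mx mz T m → ZMod 2} (hz : z ∈ bulkSub H σ) :
    (∀ r ≤ T, (∀ j, (σ j).val ≠ r) →
      H.HX *ᵥ ev (z ∘ .inl) r = xc (z ∘ .inl) r + xc (z ∘ .inl) (r + 1)) ∧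
    (∀ r < T, H.HZ *ᵥ od (z ∘ .inl) (r + 1) = zc (z ∘ .inl) r + zc (z ∘ .inl) (r + 1)) := by
  refine ⟨fun r hr hj => ?_, fun r hr => ?_⟩
  · funext c
    have h1 := hz.2 (.inl (⟨r, by omega⟩, c)) (by
      rintro ⟨j, h⟩
      exact hj j (congrArg Fin.val h))
    rw [checkMatrix_mulVec_X] at h1
    rw [← sub_eq_zero, ZModModule.sub_eq_add]
    simpa [add_assoc] using h1
  · funext c
    have h1 := hz.2 (.inr (.inl (⟨r, hr⟩, c))) trivial
    rw [checkMatrix_mulVec_Z] at h1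
    rw [← sub_eq_zero, ZModModule.sub_eq_add]
    simpa [add_assoc] using h1

lemma notMem_range_surface_iff {t : Fin (2 * T + 1)} {i : Fin n} :
    (.inl (t, i) : ATGVertex n mx mz T) ∉ Set.range (surface n mx mz σ) ↔
      ∀ j, 2 * (σ j).val ≠ t.val := by
  constructor
  · intro h j hj
    exact h ⟨(j, i), by simp only [surface, Sum.inl.injEq, Prod.mk.injEq, and_true]; exact Fin.ext hj⟩
  · rintro h ⟨⟨j, i'⟩, hj⟩
    simp only [surface, Sum.inl.injEq, Prod.mk.injEq] at hj
    exact h j (congrArg Fin.val hj.1)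

lemma bulk_ext {v v' : ATGVertex n mx mz T → ZMod 2}
    (he : ∀ r ≤ T, (∀ j, (σ j).val ≠ r) → ev v r = ev v' r)
    (ho : ∀ r < T, od v (r + 1) = od v' (r + 1)) (hg : ∀ r ≤ T, zc v r = zc v' r)
    (hf : ∀ r < T, xc v (r + 1) = xc v' (r + 1)) (u : ATGVertex n mx mz T)
    (hu : u ∉ Set.range (surface n mx mz σ)) : v u = v' u := by
  rcases u with ⟨⟨t, ht⟩, i⟩ | ⟨⟨r, hr⟩, c⟩ | ⟨⟨r, hr⟩, c⟩
  · rw [notMem_range_surface_iff] at hu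
    rcases Nat.even_or_odd' t with ⟨r, rfl | rfl⟩
    · have h := congrFun (he r (by omega) (fun j hj => hu j (by simp only; omega))) i
      have hr : r < T + 1 := by omega
      simpa [ev, hr] using h
    · have h := congrFun (ho r (by omega)) i
      have hr : r < T := by omega
      simpa [od, hr] using h
  · have h := congrFun (hg r (by omega)) c
    simpa [zc, hr] using h
  · have h := congrFun (hf r (by omega)) c
    simpa [xc, hr] using h

/-- A bulk error that violates no bulk check is the bulk part of a stabilizer. -/
lemma exists_fullError_of_mem_bulkSub (hσ : Function.Injective σ) {j₀ : Fin m}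
    (hj₀ : (σ j₀).val = 0) {z : ErrorPos n mx mz T m → ZMod 2} (hz : z ∈ bulkSub H σ) :
    ∃ η, restr (bulkPos n mx mz σ) (fullError H σ η) = z := by
  classical
  obtain ⟨h1, h2⟩ := mem_bulkSub_coords hz
  set F := xc (z ∘ .inl) with hF
  set g := zc (z ∘ .inl) with hg
  choose y hy using fun r => H.HX_surjective (F r + F (r + 1))
  obtain ⟨w₀, hw₀⟩ := H.HZ_surjective (g 0)
  let e' : ℕ → Fin n → ZMod 2 := fun r => if ∃ j, (σ j).val = r then y r else ev (z ∘ .inl) r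
  -- The unmeasured layers may be filled freely. Layer 0 is one of them and receives the sum of all
  -- other layers: this makes the total vanish, and by telescoping it still satisfies the check of
  -- layer 0.
  let e : ℕ → Fin n → ZMod 2 := fun r => if r = 0 then ∑ s ∈ Finset.Ico 0 T, e' (s + 1) else e' r
  have he' : ∀ r ≤ T, H.HX *ᵥ e' r = F r + F (r + 1) := by
    intro r hr
    by_cases hj : ∃ j, (σ j).val = r
    · simp only [e', if_pos hj, hy]
    · simp only [e', if_neg hj]
      exact h1 r hr fun j h => hj ⟨j, h⟩
  have hF0 : F 0 = 0 := rfl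
  have hFT : F (T + 1) = 0 := xc_top _
  have he : ∀ r ≤ T, H.HX *ᵥ e r = F r + F (r + 1) := by
    intro r hr
    rcases r with _ | r
    · simp only [e, if_pos]
      rw [mulVec_sum_telescope H.HX (fun s => e' (s + 1)) (fun s => F (s + 1)) (Nat.zero_le T)
        (fun s _ hs => he' (s + 1) (by omega)), hFT, hF0, add_zero]
      exact (zero_add _).symm
    · exact he' _ hr
  have hsum : ∑ r ∈ Finset.Ico 0 (T + 1), e r ∈ H.rowZ := by
    have : ∑ r ∈ Finset.Ico 0 (T + 1), e r = 0 := by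
      rw [← Finset.range_eq_Ico, Finset.sum_range_succ']
      have h3 : ∑ s ∈ Finset.range T, e (s + 1) = e 0 := by
        simp only [e, if_pos, Finset.range_eq_Ico]
        rfl
      rw [h3, ZModModule.add_self]
    rw [this]; exact Submodule.zero_mem _
  let w : Fin m × Fin n → ZMod 2 := fun q =>
    (w₀ + ∑ r ∈ Finset.Ico 0 (σ q.1).val, od (z ∘ .inl) (r + 1)) q.2
  have hw : ∀ j, blk w j = w₀ + ∑ r ∈ Finset.Ico 0 (σ j).val, od (z ∘ .inl) (r + 1) :=
    fun j => rfl
  have hwj : blk w j₀ = w₀ := by rw [hw, hj₀]; simp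
  obtain ⟨η, -, a2, a3, a4, a5⟩ := exists_adjMul_eq (j₀ := j₀) hσ e (od (z ∘ .inl)) F g w he hF0
    hsum h2 (by rw [hwj, hw₀]) (fun j => by
      rw [hw, hwj, ZModModule.add_self]; exact Submodule.zero_mem _)
  refine ⟨η, funext fun u => ?_⟩
  by_cases hu : u ∈ bulkPos n mx mz σ
  · rcases u with u | u
    · rw [restr, if_pos hu]
      rw [inl_mem_bulkPos] at hu
      refine bulk_ext (v := adjMul H η) (v' := z ∘ Sum.inl) (fun r hr hj => ?_) a3 a4 a5 u hu
      have hr0 : r ≠ 0 := fun h => hj j₀ (by rw [hj₀, h])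
      have hj' : ¬ ∃ j, (σ j).val = r := fun ⟨j, h⟩ => hj j h
      rw [a2 r hr]
      simp only [e, if_neg hr0, e', if_neg hj']
    · exact absurd hu inr_notMem_bulkPos
  · rw [restr, if_neg hu, hz.1 u hu]

/-! ### Pushing small bulk errors to the unmeasured layers -/

open Classical in
/-- A bulk error together with errors on the unmeasured layers. -/
def withSurface (σ : Fin m → Fin (T + 1)) (z : ErrorPos n mx mz T m → ZMod 2)
    (a w : Fin m × Fin n → ZMod 2) : ErrorPos n mx mz T m → ZMod 2
  | .inl v => if h : ∃ q, surface n mx mz σ q = v then a h.choose else z (.inl v)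
  | .inr q => w q

lemma withSurface_surface (hσ : Function.Injective σ) (z : ErrorPos n mx mz T m → ZMod 2)
    (a w : Fin m × Fin n → ZMod 2) (q : Fin m × Fin n) :
    withSurface σ z a w (.inl (surface n mx mz σ q)) = a q := by
  have h : ∃ q', surface n mx mz σ q' = surface n mx mz σ q := ⟨q, rfl⟩
  simp only [withSurface, dif_pos h]
  rw [surface_injective hσ h.choose_spec]

lemma withSurface_bulk (z : ErrorPos n mx mz T m → ZMod 2) (a w : Fin m × Fin n → ZMod 2)
    {v : ATGVertex n mx mz T} (hv : v ∉ Set.range (surface n mx mz σ)) :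
    withSurface σ z a w (.inl v) = z (.inl v) := by
  have h : ¬ ∃ q', surface n mx mz σ q' = v := hv
  simp only [withSurface, dif_neg h]

/-- Disjoint ranges of layers in which the `Z`-type errors are pushed to the unmeasured layers. -/
lemma exists_intervals_Z {k : ℕ} (hσ : StrictMono σ) (F : ℕ → Fin k → ZMod 2) (hF0 : F 0 = 0)
    (hFT : F (T + 1) = 0)
    (hcut : ∀ j j' : Fin m, j'.val = j.val + 1 →
      ∃ R, (σ j).val < R ∧ R ≤ (σ j').val ∧ F R = 0) :
    ∃ lo hi : Fin m → ℕ, (∀ j, lo j ≤ (σ j).val ∧ (σ j).val < hi j ∧ hi j ≤ T + 1) ∧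
      (∀ j, F (lo j) = 0 ∧ F (hi j) = 0) ∧ ∀ j j', j < j' → hi j ≤ lo j' := by
  have hR : ∀ j : ℕ, ∃ R, ∀ h : j + 1 < m, (σ ⟨j, by omega⟩).val < R ∧
      R ≤ (σ ⟨j + 1, h⟩).val ∧ F R = 0 := by
    intro j
    by_cases h : j + 1 < m
    · obtain ⟨R, hR⟩ := hcut ⟨j, by omega⟩ ⟨j + 1, h⟩ rfl
      exact ⟨R, fun _ => hR⟩
    · exact ⟨0, fun h' => absurd h' h⟩
  choose R hR using hR
  -- The outermost intervals run to the ends `0` and `T + 1`, where `F` vanishes by assumption, so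
  -- no cut is needed there.
  refine ⟨fun j => if j.val = 0 then 0 else R (j.val - 1),
    fun j => if j.val + 1 < m then R j.val else T + 1, fun j => ⟨?_, ?_, ?_⟩, fun j => ⟨?_, ?_⟩,
    fun j j' h => ?_⟩
  · dsimp only
    split_ifs with h
    · exact Nat.zero_le _
    · have := (hR (j.val - 1) (by omega)).2.1
      have h2 : (⟨j.val - 1 + 1, by omega⟩ : Fin m) = j := Fin.ext (by simp only; omega)
      rwa [h2] at this
  · dsimp only
    split_ifs with h
    · exact (hR j.val h).1
    · omega
  · dsimp only
    split_ifs with h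
    · have := (hR j.val h).2.1
      omega
    · exact le_rfl
  · dsimp only
    split_ifs with h
    · exact hF0
    · exact (hR (j.val - 1) (by omega)).2.2
  · dsimp only
    split_ifs with h
    · exact (hR j.val h).2.2
    · exact hFT
  · have hlt : j.val < j'.val := h
    have h1 : j.val + 1 < m := by omega
    have h2 : j'.val ≠ 0 := by omega
    simp only [if_pos h1, if_neg h2]
    rcases Nat.lt_or_ge (j.val + 1) j'.val with h3 | h3
    · have h4 := (hR j.val h1).2.1
      have h5 := (hR (j'.val - 1) (by omega)).1
      have h6 : σ ⟨j.val + 1, h1⟩ ≤ σ ⟨j'.val - 1, by omega⟩ :=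
        hσ.monotone (Fin.mk_le_mk.mpr (by omega))
      have h7 : (σ ⟨j.val + 1, h1⟩).val ≤ (σ ⟨j'.val - 1, by omega⟩).val := h6
      omega
    · have : j'.val - 1 = j.val := by omega
      rw [this]

/-- Disjoint ranges of layers in which the `X`-type errors are pushed to the unmeasured layers. -/
lemma exists_intervals_X {k : ℕ} (hσ : StrictMono σ) (g : ℕ → Fin k → ZMod 2)
    (hcut : ∀ j j' : Fin m, j'.val = j.val + 1 →
      ∃ R, (σ j).val ≤ R ∧ R ≤ (σ j').val ∧ g R = 0)
    (hcut' : m = 1 → ∀ j : Fin m, ∃ R, (σ j).val ≤ R ∧ R ≤ T ∧ g R = 0) :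
    ∃ lo hi : Fin m → ℕ, (∀ j, lo j ≤ hi j ∧ hi j ≤ T) ∧
      (∀ j, g (lo j) + g (hi j) = g (σ j)) ∧ ∀ j j', j < j' → hi j ≤ lo j' := by
  have hR : ∀ j : ℕ, ∃ R, (∀ h : j + 1 < m, (σ ⟨j, by omega⟩).val ≤ R ∧
      R ≤ (σ ⟨j + 1, h⟩).val ∧ g R = 0) ∧
      (m = 1 → ∀ h : j < m, (σ ⟨j, h⟩).val ≤ R ∧ R ≤ T ∧ g R = 0) := by
    intro j
    by_cases h : j + 1 < m
    · obtain ⟨R, hR⟩ := hcut ⟨j, by omega⟩ ⟨j + 1, h⟩ rfl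
      exact ⟨R, fun _ => hR, fun hm => by omega⟩
    · by_cases hj : m = 1 ∧ j < m
      · obtain ⟨R, hR⟩ := hcut' hj.1 ⟨j, hj.2⟩
        exact ⟨R, fun h' => absurd h' h, fun _ _ => hR⟩
      · exact ⟨0, fun h' => absurd h' h, fun h1 h2 => absurd ⟨h1, h2⟩ hj⟩
  choose R hR hR1 using hR
  have hprev : ∀ j : Fin m, ∀ h : j.val ≠ 0, (σ ⟨j.val - 1, by omega⟩).val ≤ R (j.val - 1) ∧
      R (j.val - 1) ≤ (σ j).val ∧ g (R (j.val - 1)) = 0 := by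
    intro j h
    have := hR (j.val - 1) (by omega)
    have h2 : (⟨j.val - 1 + 1, by omega⟩ : Fin m) = j := Fin.ext (by simp only; omega)
    rwa [h2] at this
  have hnext : ∀ j : Fin m, j.val + 1 < m ∨ m = 1 → (σ j).val ≤ R j.val ∧ R j.val ≤ T ∧
      g (R j.val) = 0 := by
    rintro j (h | h)
    · have := hR j.val h
      refine ⟨this.1, ?_, this.2.2⟩
      have := this.2.1
      omega
    · exact hR1 j.val h j.2
  -- Errors are collected from the layers between an unmeasured layer and the next cut above it,
  -- except that the last of several unmeasured layers uses the cut below it. A single unmeasured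
  -- layer also looks upwards.
  refine ⟨fun j => if j.val + 1 < m ∨ m = 1 then (σ j).val else R (j.val - 1),
    fun j => if j.val + 1 < m ∨ m = 1 then R j.val else (σ j).val, fun j => ⟨?_, ?_⟩, fun j => ?_,
    fun j j' h => ?_⟩
  · dsimp only
    split_ifs with h
    · exact (hnext j h).1
    · exact (hprev j (by omega)).2.1
  · dsimp only
    split_ifs with h
    · exact (hnext j h).2.1
    · omega
  · dsimp only
    split_ifs with h
    · rw [(hnext j h).2.2, add_zero]
    · rw [(hprev j (by omega)).2.2, zero_add]
  · have hlt : j.val < j'.val := h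
    have h1 : j.val + 1 < m := by omega
    have h2 := (hR j.val h1).2.1
    simp only [if_pos (Or.inl h1 : j.val + 1 < m ∨ m = 1)]
    split_ifs with h3
    · have h4 : σ ⟨j.val + 1, h1⟩ ≤ σ j' := hσ.monotone (Fin.mk_le_mk.mpr (by omega))
      have h5 : (σ ⟨j.val + 1, h1⟩).val ≤ (σ j').val := h4
      omega
    · rcases Nat.lt_or_ge (j.val + 1) j'.val with h4 | h4
      · have h5 := (hprev j' (by omega)).1
        have h6 : σ ⟨j.val + 1, h1⟩ ≤ σ ⟨j'.val - 1, by omega⟩ :=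
          hσ.monotone (Fin.mk_le_mk.mpr (by omega))
        have h7 : (σ ⟨j.val + 1, h1⟩).val ≤ (σ ⟨j'.val - 1, by omega⟩).val := h6
        omega
      · have : j'.val - 1 = j.val := by omega
        rw [this]

lemma exists_cell {m : ℕ} (j₀ : Fin m) {lo hi : Fin m → ℕ} (h : ∀ j j', j < j' → hi j ≤ lo j') :
    ∃ cell : ℕ → Fin m, ∀ j r, lo j ≤ r → r < hi j → cell r = j := by
  classical
  refine ⟨fun r => if hr : ∃ j, lo j ≤ r ∧ r < hi j then hr.choose else j₀, fun j r h1 h2 => ?_⟩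
  have hr : ∃ j, lo j ≤ r ∧ r < hi j := ⟨j, h1, h2⟩
  simp only [dif_pos hr]
  obtain ⟨h3, h4⟩ := hr.choose_spec
  rcases lt_trichotomy hr.choose j with h5 | h5 | h5
  · have := h _ _ h5; omega
  · exact h5
  · have := h _ _ h5; omega

/-- By pigeonhole, an error with fewer positions than there are layers leaves some layer untouched.
These layers are the cuts. -/
lemma exists_untouched {k : ℕ} {U : Type} [Fintype U] (z : U → ZMod 2) (lay : U → ℕ)
    (g : ℕ → Fin k → ZMod 2) (s : Finset ℕ) (hs : (suppF z).card < s.card)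
    (hlay : ∀ r c, g r c ≠ 0 → ∃ u, z u ≠ 0 ∧ lay u = r) : ∃ R ∈ s, g R = 0 := by
  classical
  by_contra! h
  have h1 : s ⊆ (suppF z).image lay := by
    intro r hr
    obtain ⟨c, hc⟩ := Function.ne_iff.mp (h r hr)
    obtain ⟨u, hu, hur⟩ := hlay r c hc
    exact Finset.mem_image.mpr ⟨u, mem_suppF.mpr hu, hur⟩
  have := (Finset.card_le_card h1).trans Finset.card_image_le
  omega

/-- A bulk error that violates no bulk check and is smaller than the gaps between the unmeasured
layers can be pushed to these layers without increasing its weight. -/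
theorem exists_push (hσ : StrictMono σ) {j₀ : Fin m} (hj₀ : (σ j₀).val = 0)
    {z : ErrorPos n mx mz T m → ZMod 2} (hz : z ∈ bulkSub H σ)
    (hgap : ∀ j j' : Fin m, j'.val = j.val + 1 → (suppF z).card + (σ j).val < (σ j').val)
    (hT : m = 1 → (suppF z).card < T + 1) :
    ∃ y ∈ localSub H σ, restr (bulkPos n mx mz σ) y = z ∧
      (suppF y).card ≤ 2 * (suppF z).card := by
  classical
  obtain ⟨h1, h2⟩ := mem_bulkSub_coords hz
  have hcutF : ∀ j j' : Fin m, j'.val = j.val + 1 →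
      ∃ R, (σ j).val < R ∧ R ≤ (σ j').val ∧ xc (z ∘ .inl) R = 0 := by
    intro j j' h
    obtain ⟨R, hR, hR0⟩ := exists_untouched z
      (fun u => match u with | .inl (.inr (.inr (r, _))) => r.val + 1 | _ => 0)
      (xc (z ∘ .inl)) (Finset.Ioc (σ j).val (σ j').val)
      (by rw [Nat.card_Ioc]; have := hgap j j' h; omega) (by
        intro r c hr
        rcases r with _ | r
        · simp [xc] at hr
        · by_cases hrT : r < T
          · exact ⟨.inl (.inr (.inr (⟨r, hrT⟩, c))), by simpa [xc, hrT] using hr, rfl⟩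
          · simp [xc, hrT] at hr)
    rw [Finset.mem_Ioc] at hR
    exact ⟨R, hR.1, hR.2, hR0⟩
  have hzlay : ∀ r c, zc (z ∘ .inl) r c ≠ 0 → ∃ u, z u ≠ 0 ∧
      (fun u : ErrorPos n mx mz T m =>
        match u with | .inl (.inr (.inl (r, _))) => r.val | _ => 0) u = r := by
    intro r c hr
    by_cases hrT : r < T + 1
    · exact ⟨.inl (.inr (.inl (⟨r, hrT⟩, c))), by simpa [zc, hrT] using hr, rfl⟩
    · simp [zc, hrT] at hr
  have hcutg : ∀ j j' : Fin m, j'.val = j.val + 1 →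
      ∃ R, (σ j).val ≤ R ∧ R ≤ (σ j').val ∧ zc (z ∘ .inl) R = 0 := by
    intro j j' h
    obtain ⟨R, hR, hR0⟩ := exists_untouched z _ (zc (z ∘ .inl))
      (Finset.Icc (σ j).val (σ j').val)
      (by rw [Nat.card_Icc]; have := hgap j j' h; omega) hzlay
    rw [Finset.mem_Icc] at hR
    exact ⟨R, hR.1, hR.2, hR0⟩
  have hcutg' : m = 1 → ∀ j : Fin m, ∃ R, (σ j).val ≤ R ∧ R ≤ T ∧ zc (z ∘ .inl) R = 0 := by
    intro hm j
    have hj : j = j₀ := Fin.ext (by omega)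
    obtain ⟨R, hR, hR0⟩ := exists_untouched z _ (zc (z ∘ .inl)) (Finset.Icc 0 T)
      (by rw [Nat.card_Icc]; have := hT hm; omega) hzlay
    rw [Finset.mem_Icc] at hR
    exact ⟨R, by rw [hj, hj₀]; exact hR.1, hR.2, hR0⟩
  obtain ⟨lo, hi, hint, hend, hdis⟩ := exists_intervals_Z hσ (xc (z ∘ .inl)) rfl (xc_top _) hcutF
  obtain ⟨lo', hi', hint', hend', hdis'⟩ := exists_intervals_X hσ (zc (z ∘ .inl)) hcutg hcutg'
  obtain ⟨cell, hcell⟩ := exists_cell j₀ hdis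
  obtain ⟨cell', hcell'⟩ := exists_cell j₀ hdis'
  -- Each unmeasured layer receives the sum of all layers in its interval, as Z errors in `a` and as
  -- X errors in `w`.
  let a : Fin m × Fin n → ZMod 2 := fun q =>
    (∑ r ∈ Finset.Ico (lo q.1) (hi q.1), ev (z ∘ .inl) r) q.2
  let w : Fin m × Fin n → ZMod 2 := fun q =>
    (∑ r ∈ Finset.Ico (lo' q.1) (hi' q.1), od (z ∘ .inl) (r + 1)) q.2
  have hze : ∀ j, ev (z ∘ .inl) (σ j) = 0 := by
    intro j
    funext i
    have hlt := (σ j).2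
    simp only [ev, hlt, dif_pos]
    refine hz.1 _ fun h => inl_mem_bulkPos.mp h ⟨(j, i), rfl⟩
  set y := withSurface σ z a w with hy
  have hyz : ∀ v : ATGVertex n mx mz T, v ∉ Set.range (surface n mx mz σ) →
      (y ∘ .inl) v = (z ∘ .inl) v := fun v hv => withSurface_bulk z a w hv
  have hyxc : ∀ r, xc (y ∘ .inl) r = xc (z ∘ .inl) r := by
    intro r
    rcases r with _ | r
    · rfl
    · funext c
      simp only [xc]
      split_ifs with h
      · exact hyz _ (by rintro ⟨q, hq⟩; simp [surface] at hq)
      · rfl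
  have hyzc : ∀ r, zc (y ∘ .inl) r = zc (z ∘ .inl) r := by
    intro r
    funext c
    simp only [zc]
    split_ifs with h
    · exact hyz _ (by rintro ⟨q, hq⟩; simp [surface] at hq)
    · rfl
  have hyod : ∀ r, od (y ∘ .inl) (r + 1) = od (z ∘ .inl) (r + 1) := by
    intro r
    funext c
    simp only [od]
    split_ifs with h
    · exact hyz _ (by rw [notMem_range_surface_iff]; intro j; simp only; omega)
    · rfl
  have hyev : ∀ r, (∀ j, (σ j).val ≠ r) → ev (y ∘ .inl) r = ev (z ∘ .inl) r := by
    intro r hr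
    funext c
    simp only [ev]
    split_ifs with h
    · exact hyz _ (by rw [notMem_range_surface_iff]; intro j; have := hr j; simp only; omega)
    · rfl
  have hyσ : ∀ j, ev (y ∘ .inl) (σ j) =
      ∑ r ∈ Finset.Ico (lo j) (hi j), ev (z ∘ .inl) r := by
    intro j
    rw [← blk_comp_surface]
    funext i
    exact withSurface_surface hσ.injective z a w (j, i)
  refine ⟨y, ?_, ?_, ?_⟩
  · rw [mem_localSub_iff]
    refine ⟨fun r hr => ?_, fun r hr => ?_, fun j => ?_⟩
    · rw [hyxc, hyxc]
      by_cases hj : ∃ j, (σ j).val = r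
      · obtain ⟨j, rfl⟩ := hj
        obtain ⟨hl, hh, hhT⟩ := hint j
        have hne : ∀ r, lo j ≤ r → r < hi j → r ≠ σ j → ∀ j', (σ j').val ≠ r := by
          intro r hr1 hr2 hr3 j' hj'
          have h3 := hcell j r hr1 hr2
          have h4 := hcell j' r (by rw [← hj']; exact (hint j').1)
            (by rw [← hj']; exact (hint j').2.1)
          rw [h3] at h4
          exact hr3 (by rw [h4, hj'])
        -- `z` vanishes on the unmeasured layer itself. The sums below and above it telescope, the
        -- terms at the cuts vanish, and exactly the check of the layer `σ j` remains.
        rw [hyσ, ← Finset.sum_Ico_consecutive _ hl hh.le, Finset.sum_eq_sum_Ico_succ_bot hh, hze,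
          zero_add, Matrix.mulVec_add,
          mulVec_sum_telescope H.HX _ (xc (z ∘ .inl)) hl
            (fun r hr1 hr2 => h1 r (by omega) (hne r hr1 (by omega) (by omega))),
          mulVec_sum_telescope H.HX _ (xc (z ∘ .inl)) hh
            (fun r hr1 hr2 => h1 r (by omega) (hne r (by omega) (by omega) (by omega))),
          (hend j).1, (hend j).2, zero_add, add_zero]
      · rw [hyev r fun j h => hj ⟨j, h⟩]
        exact h1 r hr fun j h => hj ⟨j, h⟩
    · rw [hyod, hyzc, hyzc]; exact h2 r hr
    · rw [hyzc]
      have h3 : blk (y ∘ .inr) j = ∑ r ∈ Finset.Ico (lo' j) (hi' j), od (z ∘ .inl) (r + 1) := rfl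
      rw [h3, mulVec_sum_telescope H.HZ _ (zc (z ∘ .inl)) (hint' j).1
        (fun r _ hr => h2 r (by have := (hint' j).2; omega)), hend']
  · funext u
    by_cases hu : u ∈ bulkPos n mx mz σ
    · rcases u with u | u
      · rw [restr, if_pos hu]
        exact hyz u (inl_mem_bulkPos.mp hu)
      · exact absurd hu inr_notMem_bulkPos
    · rw [restr, if_neg hu, hz.1 u hu]
  -- The intervals are disjoint, so every code qubit of `z` has one destination. The new errors lie
  -- in the image of `suppF z`, whence the factor 2.
  · let φ : ErrorPos n mx mz T m → ErrorPos n mx mz T m := fun u =>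
      match u with
      | .inl (.inl (t, i)) => if t.val % 2 = 0 then .inl (surface n mx mz σ (cell (t.val / 2), i))
          else .inr (cell' (t.val / 2), i)
      | u => u
    have hsub : suppF y ⊆ suppF z ∪ (suppF z).image φ := by
      intro u hu
      rw [mem_suppF] at hu
      rw [Finset.mem_union, mem_suppF, Finset.mem_image]
      rcases u with u | ⟨j, i⟩
      · by_cases hur : u ∈ Set.range (surface n mx mz σ)
        · obtain ⟨⟨j, i⟩, rfl⟩ := hur
          right
          have hu' : a (j, i) ≠ 0 := by rwa [hy, withSurface_surface hσ.injective] at hu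
          simp only [a, Finset.sum_apply] at hu'
          obtain ⟨r, hr, hri⟩ := Finset.exists_ne_zero_of_sum_ne_zero hu'
          obtain ⟨hrT, hri⟩ := ev_ne_zero hri
          rw [Finset.mem_Ico] at hr
          refine ⟨_, mem_suppF.mpr hri, ?_⟩
          have hr2 : 2 * r / 2 = r := by omega
          simp only [φ, Nat.mul_mod_right, if_true, hr2, hcell j r hr.1 hr.2]
        · left
          rwa [hy, withSurface_bulk z a w hur] at hu
      · right
        have hu' : w (j, i) ≠ 0 := hu
        simp only [w, Finset.sum_apply] at hu'
        obtain ⟨r, hr, hri⟩ := Finset.exists_ne_zero_of_sum_ne_zero hu'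
        obtain ⟨hrT, hri⟩ := od_succ_ne_zero hri
        rw [Finset.mem_Ico] at hr
        refine ⟨_, mem_suppF.mpr hri, ?_⟩
        have hr2 : (2 * r + 1) / 2 = r := by omega
        have hr3 : ¬ (2 * r + 1) % 2 = 0 := by omega
        simp only [φ, if_neg hr3, hr2, hcell' j r hr.1 hr.2]
    have h3 := (Finset.card_le_card hsub).trans (Finset.card_union_le _ _)
    have h4 : ((suppF z).image φ).card ≤ (suppF z).card := Finset.card_image_le
    omega

end Homology

/-! ### The state of the unmeasured qubits -/

section State

variable {n mx mz T m k : ℕ} {H : CSSCode n mx mz} {σ : Fin m → Fin (T + 1)}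

open Classical in
/-- A vector on the bulk as a vector on all error positions. -/
def bulkExt (σ : Fin m → Fin (T + 1)) (s : Bulk (surface n mx mz σ) → ZMod 2) :
    ErrorPos n mx mz T m → ZMod 2
  | .inl v => if h : v ∉ Set.range (surface n mx mz σ) then s ⟨v, h⟩ else 0
  | .inr _ => 0

lemma bulkExt_bulk (s : Bulk (surface n mx mz σ) → ZMod 2) (v : Bulk (surface n mx mz σ)) :
    bulkExt σ s (.inl v.1) = s v := by
  have h := v.2
  simp only [bulkExt, dif_pos h]

lemma bulkExt_of_notMem (s : Bulk (surface n mx mz σ) → ZMod 2) {u : ErrorPos n mx mz T m}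
    (hu : u ∉ bulkPos n mx mz σ) : bulkExt σ s u = 0 := by
  rcases u with u | u
  · rw [inl_mem_bulkPos] at hu
    simp only [bulkExt, dif_neg hu]
  · rfl

lemma bulkExt_add (s t : Bulk (surface n mx mz σ) → ZMod 2) :
    bulkExt σ (s + t) = bulkExt σ s + bulkExt σ t := by
  funext u
  rcases u with u | u
  · simp only [bulkExt, Pi.add_apply]; split_ifs <;> simp
  · simp [bulkExt]

lemma bulkExt_toBulk (η : ATGVertex n mx mz T → ZMod 2) :
    bulkExt σ (toBulk (surface n mx mz σ) (adjMul H η)) =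
      restr (bulkPos n mx mz σ) (fullError H σ η) := by
  funext u
  by_cases hu : u ∈ bulkPos n mx mz σ
  · rcases u with u | u
    · have hu' := inl_mem_bulkPos.mp hu
      simp only [bulkExt, dif_pos hu', restr, if_pos hu]
      rfl
    · exact absurd hu inr_notMem_bulkPos
  · rw [bulkExt_of_notMem _ hu, restr, if_neg hu]

/-- The outcomes that occur without errors. -/
def outcomeSub (H : CSSCode n mx mz) (σ : Fin m → Fin (T + 1)) :
    Submodule (ZMod 2) (Bulk (surface n mx mz σ) → ZMod 2) where
  carrier := {s | ∃ η, toBulk (surface n mx mz σ) (adjMul H η) = s}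
  zero_mem' := ⟨0, by funext v; simp [toBulk, adjMul]⟩
  add_mem' := by
    rintro _ _ ⟨η, rfl⟩ ⟨η', rfl⟩
    exact ⟨η + η', by rw [adjMul_add]; rfl⟩
  smul_mem' := by
    rintro a _ ⟨η, rfl⟩
    exact ⟨a • η, by rw [adjMul, Matrix.mulVec_smul]; rfl⟩

/-- Possible outcomes are thus characterized by local checks, because every bulk vector passing them
extends to a stabilizer. -/
lemma mem_outcomeSub_iff (hσ : Function.Injective σ) {j₀ : Fin m} (hj₀ : (σ j₀).val = 0)
    (s : Bulk (surface n mx mz σ) → ZMod 2) :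
    s ∈ outcomeSub H σ ↔ bulkExt σ s ∈ bulkSub H σ := by
  constructor
  · rintro ⟨η, rfl⟩
    rw [bulkExt_toBulk]
    exact restr_mem_bulkSub (fullSub_le_localSub ⟨η, rfl⟩)
  · intro h
    obtain ⟨η, hη⟩ := exists_fullError_of_mem_bulkSub hσ hj₀ h
    refine ⟨η, funext fun v => ?_⟩
    rw [← bulkExt_toBulk] at hη
    rw [← bulkExt_bulk s v, ← hη, bulkExt_bulk]

/-- The graph is bipartite: `od` and `zc` form one independent class, `ev` and `xc` the other. -/
lemma not_rel_of_ev_eq_zero {δ : ATGVertex n mx mz T → ZMod 2} (h1 : ∀ r, ev δ r = 0)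
    (h2 : ∀ r, xc δ r = 0) (u v : ATGVertex n mx mz T) (hu : δ u ≠ 0) (hv : δ v ≠ 0) :
    ¬ atgRel H T u v := by
  have hodd : ∀ t i, δ (.inl (t, i)) ≠ 0 → t.val % 2 = 1 := by
    rintro ⟨t, ht⟩ i h
    rcases Nat.even_or_odd' t with ⟨r, rfl | rfl⟩
    · have h3 := congrFun (h1 r) i
      have hr : r < T + 1 := by omega
      simp only [ev, hr, dif_pos] at h3
      exact absurd h3 h
    · simp only; omega
  rcases u with ⟨t, i⟩ | ⟨r, c⟩ | ⟨r, c⟩ <;> rcases v with ⟨t', i'⟩ | ⟨r', c'⟩ | ⟨r', c'⟩ <;>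
    simp only [atgRel, not_false_eq_true]
  · have := hodd _ _ hu
    have := hodd _ _ hv
    omega
  · have := hodd _ _ hu
    omega
  · have h3 := congrFun (h2 (r'.val + 1)) c'
    have hr := r'.2
    simp only [xc, hr, dif_pos] at h3
    exact absurd h3 hv

lemma not_rel_of_od_eq_zero {δ : ATGVertex n mx mz T → ZMod 2} (h1 : ∀ r, od δ r = 0)
    (h2 : ∀ r, zc δ r = 0) (u v : ATGVertex n mx mz T) (hu : δ u ≠ 0) (hv : δ v ≠ 0) :
    ¬ atgRel H T u v := by
  have heven : ∀ t i, δ (.inl (t, i)) ≠ 0 → t.val % 2 = 0 := by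
    rintro ⟨t, ht⟩ i h
    rcases Nat.even_or_odd' t with ⟨r, rfl | rfl⟩
    · simp only; omega
    · have h3 := congrFun (h1 (r + 1)) i
      have hr : r < T := by omega
      simp only [od, hr, dif_pos] at h3
      exact absurd h3 h
  rcases u with ⟨t, i⟩ | ⟨r, c⟩ | ⟨r, c⟩ <;> rcases v with ⟨t', i'⟩ | ⟨r', c'⟩ | ⟨r', c'⟩ <;>
    simp only [atgRel, not_false_eq_true]
  · have := heven _ _ hu
    have := heven _ _ hv
    omega
  · have h3 := congrFun (h2 r'.val) c'
    have hr := r'.2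
    simp only [zc, hr, dif_pos] at h3
    exact absurd h3 hv
  · have := heven _ _ hu
    omega

/-- Rows of bulk checks are stabilizers of type `X` on the bulk. -/
lemma not_rel_of_check {c : CheckIdx mx mz T m} (hc : IsBulkCheck σ c)
    (u v : ATGVertex n mx mz T) (hu : checkMatrix H σ c (.inl u) ≠ 0)
    (hv : checkMatrix H σ c (.inl v) ≠ 0) : ¬ atgRel H T u v := by
  rcases c with ⟨r, c⟩ | ⟨r, c⟩ | ⟨j, c⟩
  · refine not_rel_of_od_eq_zero (δ := fun u => checkMatrix H σ (.inl (r, c)) (.inl u))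
      (fun r' => ?_) (fun r' => ?_) u v hu hv
    · rcases r' with _ | r'
      · rfl
      · funext i
        have : ¬ 2 * r' + 1 = 2 * r.val := by omega
        simp [od, checkMatrix, this]
    · funext i; simp [zc, checkMatrix]
  · refine not_rel_of_ev_eq_zero (δ := fun u => checkMatrix H σ (.inr (.inl (r, c))) (.inl u))
      (fun r' => ?_) (fun r' => ?_) u v hu hv
    · funext i
      have : ¬ 2 * r' = 2 * r.val + 1 := by omega
      simp [ev, checkMatrix, this]
    · rcases r' with _ | r'
      · rfl
      · funext i; simp [xc, checkMatrix]
  · exact absurd hc not_false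

/-- An impossible outcome violates some bulk check. The row of that check, as an X operator on the
bulk, stabilizes the graph state but takes the value -1 on the outcome, so the resulting vector
equals its negative. -/
lemma postMeasure_eq_zero (hσ : Function.Injective σ) {j₀ : Fin m} (hj₀ : (σ j₀).val = 0)
    {s : Bulk (surface n mx mz σ) → ZMod 2} (hs : s ∉ outcomeSub H σ) :
    postMeasure (surface n mx mz σ) s (atgState H T) = 0 := by
  have hι := surface_injective (n := n) (mx := mx) (mz := mz) hσ
  rw [mem_outcomeSub_iff hσ hj₀] at hs
  obtain ⟨c, hc, hcs⟩ : ∃ c, IsBulkCheck σ c ∧ (checkMatrix H σ *ᵥ bulkExt σ s) c ≠ 0 := by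
    by_contra! h
    exact hs ⟨fun u hu => bulkExt_of_notMem s hu, h⟩
  set δ : ATGVertex n mx mz T → ZMod 2 := fun v => checkMatrix H σ c (.inl v) with hδ
  have hinr : ∀ q, checkMatrix H σ c (.inr q) = 0 := by
    intro q
    by_contra h
    exact inr_notMem_bulkPos (mem_bulkPos_of_check hc h)
  have hsurf : δ ∘ surface n mx mz σ = 0 := by
    funext q
    by_contra h
    exact inl_mem_bulkPos.mp (mem_bulkPos_of_check hc h) ⟨q, rfl⟩
  have hsymm : (adjMatrix2 (atgRel H T))ᵀ = adjMatrix2 (atgRel H T) := by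
    rw [adjMatrix2, Matrix.transpose_add, Matrix.transpose_transpose, add_comm]
  -- All vectors `A η` pass the check, so its row is orthogonal to the image of the symmetric matrix
  -- `A`.
  have hadj : adjMatrix2 (atgRel H T) *ᵥ δ = 0 := by
    refine dotProduct_eq_zero _ fun η => ?_
    have h1 : (checkMatrix H σ *ᵥ fullError H σ η) c = 0 :=
      congrFun (LinearMap.mem_ker.mp (fullSub_le_localSub (σ := σ) ⟨η, rfl⟩)) c
    have h2 : δ ⬝ᵥ adjMatrix2 (atgRel H T) *ᵥ η = 0 := by
      have h3 : ∑ u, checkMatrix H σ c u * fullError H σ η u = ∑ v, δ v * adjMul H η v := by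
        rw [Fintype.sum_sum_type, Finset.sum_eq_zero (s := Finset.univ (α := Fin m × Fin n)),
          add_zero]
        · rfl
        · intro q _
          rw [hinr, zero_mul]
      exact h3.symm.trans h1
    rw [← hsymm, Matrix.mulVec_transpose, ← Matrix.dotProduct_mulVec, h2]
  have h3 := postMeasure_stabilizer hι (atgRel_asymm H T)
    (dotProduct_relMatrix_eq_zero (not_rel_of_check hc)) (δ := δ)
    (fun v => by rw [hadj]; rfl) s
  have h4 : ∑ v : Bulk (surface n mx mz σ), s v * δ v = 1 := by
    have h5 : (checkMatrix H σ *ᵥ bulkExt σ s) c = ∑ v : Bulk (surface n mx mz σ), s v * δ v := by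
      have h6 : ∀ q, bulkExt σ s (.inl (surface n mx mz σ q)) = 0 := fun q =>
        bulkExt_of_notMem s fun h => inl_mem_bulkPos.mp h ⟨q, rfl⟩
      have h7 : ∑ u, checkMatrix H σ c u * bulkExt σ s u = ∑ v, δ v * bulkExt σ s (.inl v) := by
        rw [Fintype.sum_sum_type, Finset.sum_eq_zero (s := Finset.univ (α := Fin m × Fin n)),
          add_zero]
        intro q _
        rw [hinr, zero_mul]
      refine Eq.trans h7 ?_
      rw [sum_eq_sum_bulk_add hι]
      simp only [bulkExt_bulk, h6, mul_zero, Finset.sum_const_zero, add_zero]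
      exact Finset.sum_congr rfl fun v _ => mul_comm _ _
    rw [← h5]
    exact (zmod2_eq _).resolve_left hcs
  rw [h4, hsurf, hadj, bsign_one] at h3
  have h7 : applyPauli ((0 : Fin m × Fin n → ZMod 2), (0 : ATGVertex n mx mz T → ZMod 2) ∘
      surface n mx mz σ) (postMeasure (surface n mx mz σ) s (atgState H T)) =
      postMeasure (surface n mx mz σ) s (atgState H T) := applyPauli_zero _
  change postMeasure (surface n mx mz σ) s (atgState H T) = _ at h3
  change postMeasure (surface n mx mz σ) s (atgState H T) = (-1 : ℂ) • applyPauli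
    ((0 : Fin m × Fin n → ZMod 2), (0 : ATGVertex n mx mz T → ZMod 2) ∘
      surface n mx mz σ) (postMeasure (surface n mx mz σ) s (atgState H T)) at h3
  rw [h7, neg_one_smul] at h3
  exact self_eq_neg.mp h3

/-- The strings in the support of the encoded state. -/
def ghzSupport (H : CSSCode n mx mz) (j₀ : Fin m) : Set (Fin m × Fin n → ZMod 2) :=
  {y | ∀ j, H.HZ *ᵥ blk y j = 0 ∧ blk y j + blk y j₀ ∈ H.rowX}

/-- The `Z`-type stabilizers of the state of the unmeasured qubits. -/
lemma postMeasure_zero_stabilizer_Z (hσ : Function.Injective σ)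
    {b : Fin m × Fin n → ZMod 2} (hb : ∀ j, H.HX *ᵥ blk b j = 0)
    (hsum : ∑ j, blk b j ∈ H.rowZ) (y : Fin m × Fin n → ZMod 2)
    (hy : postMeasure (surface n mx mz σ) 0 (atgState H T) y ≠ 0) : b ⬝ᵥ y = 0 := by
  classical
  have hι := surface_injective (n := n) (mx := mx) (mz := mz) hσ
  let e : ℕ → Fin n → ZMod 2 := fun r => ∑ j, if (σ j).val = r then blk b j else 0
  have heσ : ∀ j, e (σ j) = blk b j := by
    intro j
    simp only [e]
    rw [Finset.sum_eq_single j]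
    · simp
    · intro j' _ hj'
      rw [if_neg fun h => hj' (hσ (Fin.ext h))]
    · simp
  have he0 : ∀ r, (∀ j, (σ j).val ≠ r) → e r = 0 := fun r hr =>
    Finset.sum_eq_zero fun j _ => if_neg (hr j)
  obtain ⟨δ, d1, d2, d3, d4⟩ := exists_stabilizer_Z (H := H) (T := T) e 0 (fun r _ => by
      by_cases h : ∃ j, (σ j).val = r
      · obtain ⟨j, rfl⟩ := h
        rw [heσ, hb]; simp
      · rw [he0 r fun j hj => h ⟨j, hj⟩]; simp) rfl (by
      have h1 : ∑ r ∈ Finset.Ico 0 (T + 1), e r = ∑ j, blk b j := by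
        simp only [e]
        rw [Finset.sum_comm]
        refine Finset.sum_congr rfl fun j _ => ?_
        rw [Finset.sum_ite_eq, if_pos (Finset.mem_Ico.mpr ⟨Nat.zero_le _, (σ j).2⟩)]
      rw [h1]; exact hsum)
  have hbulk : ∀ v : Bulk (surface n mx mz σ), (adjMatrix2 (atgRel H T) *ᵥ δ) v = 0 := by
    intro v
    refine bulk_ext (v := adjMul H δ) (v' := 0) (fun r hr hj => ?_) (fun r hr => ?_)
      (fun r hr => ?_) (fun r hr => ?_) v.1 v.2
    · rw [d3 r hr, he0 r hj]; funext i; simp [ev]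
    · rw [od_adjMul H δ hr, d1, d1, d2]; funext i; simp [od]
    · rw [zc_adjMul H δ hr, d1]; funext i; simp [zc]
    · rw [d4 r hr]; funext i; simp [xc]
  have hδι : δ ∘ surface n mx mz σ = 0 := by
    funext q
    have := congrFun (blk_comp_surface (σ := σ) δ q.1) q.2
    rw [d1] at this
    exact this
  have hadjι : (adjMatrix2 (atgRel H T) *ᵥ δ) ∘ surface n mx mz σ = b := by
    funext q
    have h1 := congrFun (blk_comp_surface (σ := σ) (adjMul H δ) q.1) q.2
    rw [d3 _ (by omega), heσ] at h1
    exact h1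
  have h3 := congrFun (postMeasure_stabilizer hι (atgRel_asymm H T)
    (dotProduct_relMatrix_eq_zero (not_rel_of_ev_eq_zero d1 d2)) hbulk 0) y
  rw [hδι, hadjι] at h3
  simp only [Pi.zero_apply, zero_mul, Finset.sum_const_zero, bsign_zero, one_smul, applyPauli,
    add_zero] at h3
  rcases zmod2_eq (b ⬝ᵥ y) with h | h
  · exact h
  · have h4 : ∑ q, b q * y q = 1 := h
    rw [h4, bsign_one, neg_one_mul] at h3
    exact absurd (self_eq_neg.mp h3) hy

/-- The `X`-type stabilizers of the state of the unmeasured qubits. -/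
lemma postMeasure_zero_stabilizer_X (hσ : Function.Injective σ) {j₀ : Fin m}
    {w : Fin m × Fin n → ZMod 2} (hw : w ∈ ghzSupport H j₀) (y : Fin m × Fin n → ZMod 2) :
    postMeasure (surface n mx mz σ) 0 (atgState H T) y =
      postMeasure (surface n mx mz σ) 0 (atgState H T) (y + w) := by
  have hι := surface_injective (n := n) (mx := mx) (mz := mz) hσ
  obtain ⟨δ, d1, d2, d3, d4, d5⟩ := exists_stabilizer_X (H := H) (j₀ := j₀) hσ 0 0 w
    (fun r _ => by simp) (by rw [(hw j₀).1]; rfl) (fun j => by simpa using (hw j).2)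
  have hev : ∀ r ≤ T, ev (adjMul H δ) r = 0 := by
    intro r hr
    rw [ev_adjMul H δ hr, d1, d1, d2]; simp
  have hbulk : ∀ v : Bulk (surface n mx mz σ), (adjMatrix2 (atgRel H T) *ᵥ δ) v = 0 := by
    intro v
    refine bulk_ext (v := adjMul H δ) (v' := 0) (fun r hr hj => ?_) (fun r hr => ?_)
      (fun r hr => ?_) (fun r hr => ?_) v.1 v.2
    · rw [hev r hr]; funext i; simp [ev]
    · rw [d3 r hr]; funext i; simp [od]
    · rw [d4 r hr]; funext i; simp [zc]
    · rw [xc_adjMul H δ hr, d1]; funext i; simp [xc]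
  have hadjι : (adjMatrix2 (atgRel H T) *ᵥ δ) ∘ surface n mx mz σ = 0 := by
    funext q
    have h1 := congrFun (blk_comp_surface (σ := σ) (adjMul H δ) q.1) q.2
    rw [hev _ (by omega)] at h1
    exact h1
  have h3 := congrFun (postMeasure_stabilizer hι (atgRel_asymm H T)
    (dotProduct_relMatrix_eq_zero (not_rel_of_od_eq_zero d1 d2)) hbulk 0) y
  rw [d5, hadjι] at h3
  simp only [applyPauli, Pi.zero_apply, zero_mul, Finset.sum_const_zero, bsign_zero, one_mul,
    one_smul] at h3
  exact h3

-- The Z stabilizers confine the support to `ghzSupport`, and the X stabilizers make the amplitude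
-- constant on it.
open Classical in
lemma postMeasure_zero_apply (hσ : Function.Injective σ) (j₀ : Fin m)
    (y : Fin m × Fin n → ZMod 2) :
    postMeasure (surface n mx mz σ) 0 (atgState H T) y =
      if y ∈ ghzSupport H j₀ then postMeasure (surface n mx mz σ) 0 (atgState H T) 0 else 0 := by
  split_ifs with h
  · rw [postMeasure_zero_stabilizer_X hσ h y, ZModModule.add_self]
  · by_contra hy
    refine h fun j => ⟨?_, ?_⟩
    · funext c
      -- A row of `H.HZ` placed in one block is a stabilizer of type Z.
      let b : Fin m × Fin n → ZMod 2 := fun q => if q.1 = j then H.HZ c q.2 else 0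
      have hb : ∀ j', blk b j' = if j' = j then H.HZ c else 0 := by
        intro j'
        funext i
        by_cases hj : j' = j <;> simp [blk, b, hj]
      have hHZ : H.HZ c ∈ H.rowZ := Submodule.subset_span ⟨c, rfl⟩
      have h0 : H.HX *ᵥ H.HZ c = 0 := by
        obtain ⟨u, hu⟩ := (H.mem_rowZ_iff _).mp hHZ
        rw [← hu, H.HX_mulVec_HZ_transpose]
      have h1 := postMeasure_zero_stabilizer_Z (H := H) hσ (b := b)
        (fun j' => by rw [hb]; split_ifs <;> simp [h0]) (by simpa [hb] using hHZ) y hy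
      rw [dotProduct, Fintype.sum_prod_type, Finset.sum_eq_single j] at h1
      · simp only [b, if_true] at h1
        exact h1
      · intro j' _ hj'; simp [b, hj']
      · simp
    · refine H.mem_rowX_of_forall fun v hv => ?_
      by_cases hj : j = j₀
      · rw [hj, ZModModule.add_self, dotProduct_zero]
      -- The same vector `v` of the kernel of `H.HX` in two blocks sums to zero, so it is a
      -- stabilizer of type Z. It compares the logical values of the two blocks.
      let b : Fin m × Fin n → ZMod 2 := fun q =>
        (if q.1 = j then v q.2 else 0) + (if q.1 = j₀ then v q.2 else 0)
      have hb : ∀ j', blk b j' = (if j' = j then v else 0) + if j' = j₀ then v else 0 := by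
        intro j'
        funext i
        simp only [blk, b, Pi.add_apply]
        split_ifs <;> rfl
      have h1 := postMeasure_zero_stabilizer_Z (H := H) hσ (b := b)
        (fun j' => by
          rw [hb, Matrix.mulVec_add]
          split_ifs <;> simp [hv])
        (by simp [hb, Finset.sum_add_distrib, ZModModule.add_self]) y hy
      simp only [dotProduct, Fintype.sum_prod_type, b, add_mul, ite_mul, zero_mul,
        Finset.sum_add_distrib, Finset.sum_ite_irrel, Finset.sum_const_zero, Finset.sum_ite_eq',
        Finset.mem_univ, if_true] at h1
      rw [dotProduct_add]
      exact h1

/-! ### The encoded state -/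

lemma ghz_const (hm : 1 ≤ m) (b : ZMod 2) : ghz m (fun _ => b) = 1 / (Real.sqrt 2 : ℂ) := by
  have hne : ∀ a b : ZMod 2, a ≠ b → (fun _ : Fin m => a) ≠ fun _ => b := fun a b hab h =>
    hab (congrFun h ⟨0, hm⟩)
  rcases zmod2_eq b with rfl | rfl
  · have h1 : (fun _ : Fin m => (0 : ZMod 2)) = 0 := rfl
    have h2 : (0 : Fin m → ZMod 2) ≠ 1 := hne 0 1 (by decide)
    simp [ghz, h1, h2]
  · have h1 : (fun _ : Fin m => (1 : ZMod 2)) = 1 := rfl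
    have h2 : (1 : Fin m → ZMod 2) ≠ 0 := hne 1 0 (by decide)
    simp [ghz, h1, h2]

lemma eq_of_ghz_ne_zero {y : Fin m → ZMod 2} (h : ghz m y ≠ 0) (j j' : Fin m) : y j = y j' := by
  by_cases h0 : y = 0
  · simp [h0]
  · by_cases h1 : y = 1
    · simp [h1]
    · simp [ghz, h0, h1] at h

-- The GHZ factors force one logical string on all blocks, and independence of `L` modulo `Q.rowX`
-- leaves at most one such string. Hence at most one term of the sum survives.
open Classical in
lemma encode_ghzPow_apply {Q : CSSCode n mx mz} (hm : 1 ≤ m) (j₀ : Fin m)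
    {L : Fin k → Fin n → ZMod 2} (hL : Q.IsLogicalBasis L) (y : Fin m × Fin n → ZMod 2) :
    Q.encode L (ghzPow m k) y = if y ∈ ghzSupport Q j₀ then
      (1 / (Real.sqrt 2 : ℂ)) ^ k * ((1 / (Real.sqrt 2 : ℂ)) ^ mx) ^ m else 0 := by
  obtain ⟨hL1, hL2, hL3⟩ := hL
  have hterm : ∀ u : Fin m × Fin k → ZMod 2,
      ghzPow m k u * ∏ j, Q.encodedBasis L (fun a => u (j, a)) (fun i => y (j, i)) ≠ 0 →
      (∀ j a, u (j, a) = u (j₀, a)) ∧ ∀ j, blk y j - ∑ a, u (j₀, a) • L a ∈ Q.rowX := by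
    intro u hu
    have h1 : ∀ j a, u (j, a) = u (j₀, a) := by
      intro j a
      have h2 := Finset.prod_ne_zero_iff.mp (left_ne_zero_of_mul hu) a (Finset.mem_univ a)
      exact eq_of_ghz_ne_zero h2 j j₀
    refine ⟨h1, fun j => ?_⟩
    have h2 := Finset.prod_ne_zero_iff.mp (right_ne_zero_of_mul hu) j (Finset.mem_univ j)
    by_contra h3
    refine h2 (if_neg fun h4 => h3 ?_)
    simp only [h1 j] at h4
    exact h4
  split_ifs with hy
  · obtain ⟨u₀, hu₀⟩ := hL3 (blk y j₀) (hy j₀).1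
    have hall : ∀ j, blk y j - ∑ a, u₀ a • L a ∈ Q.rowX := by
      intro j
      have h1 := Submodule.add_mem _ (hy j).2 hu₀
      convert h1 using 1
      have h2 := ZModModule.add_self (blk y j₀)
      linear_combination (exp := 1) -h2
    rw [CSSCode.encode, Finset.sum_eq_single (fun q => u₀ q.2)]
    · have h1 : ghzPow m k (fun q => u₀ q.2) = (1 / (Real.sqrt 2 : ℂ)) ^ k := by
        simp only [ghzPow, ghz_const hm, Finset.prod_const, Finset.card_univ, Fintype.card_fin]
      have h2 : ∀ j, Q.encodedBasis L u₀ (fun i => y (j, i)) = (1 / (Real.sqrt 2 : ℂ)) ^ mx :=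
        fun j => if_pos (hall j)
      rw [h1]
      simp only [h2, Finset.prod_const, Finset.card_univ, Fintype.card_fin]
    · intro u _ hu
      by_contra h
      obtain ⟨h1, h2⟩ := hterm u h
      apply hu
      have h3 : ∑ a, (u (j₀, a) - u₀ a) • Q.rowX.mkQ (L a) = 0 := by
        have h4 := Submodule.sub_mem _ hu₀ (h2 j₀)
        have h5 : ∑ a, (u (j₀, a) - u₀ a) • L a ∈ Q.rowX := by
          convert h4 using 1
          simp only [sub_smul, Finset.sum_sub_distrib]
          abel
        rw [← (Submodule.Quotient.mk_eq_zero Q.rowX).mpr h5]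
        simp [← Submodule.mkQ_apply, map_sum]
      have h6 := Fintype.linearIndependent_iff.mp hL2 _ h3
      funext q
      rw [← Prod.mk.eta (p := q), h1]
      exact sub_eq_zero.mp (h6 q.2)
    · simp
  · rw [CSSCode.encode]
    refine Finset.sum_eq_zero fun u _ => ?_
    by_contra h
    obtain ⟨-, h2⟩ := hterm u h
    refine hy fun j => ⟨?_, ?_⟩
    · obtain ⟨v, hv⟩ := (Q.mem_rowX_iff _).mp (h2 j)
      have h3 : blk y j = Q.HXᵀ *ᵥ v + ∑ a, u (j₀, a) • L a := by rw [hv, sub_add_cancel]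
      rw [h3, Matrix.mulVec_add, Q.HZ_mulVec_HX_transpose, zero_add, ← Matrix.mulVecLin_apply,
        map_sum]
      refine Finset.sum_eq_zero fun a _ => ?_
      rw [map_smul, Matrix.mulVecLin_apply, hL1, smul_zero]
    · have h3 := Submodule.sub_mem _ (h2 j) (h2 j₀)
      rw [sub_sub_sub_cancel_right, ZModModule.sub_eq_add] at h3
      exact h3

lemma ghzSupport_eq {Q : CSSCode n mx mz} (hQ : H.SameCode Q) (j₀ : Fin m) :
    ghzSupport H j₀ = ghzSupport Q j₀ := by
  ext y
  simp only [ghzSupport, Set.mem_ofPred_eq, hQ.1, H.HZ_mulVec_eq_zero_iff,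
    Q.HZ_mulVec_eq_zero_iff, hQ.2]

/-- Without errors, and for the outcome `0`, the unmeasured qubits are in the encoded state. -/
theorem postMeasure_zero_eq {Q : CSSCode n mx mz} (hQ : H.SameCode Q) (hσ : Function.Injective σ)
    (hm : 1 ≤ m) {L : Fin k → Fin n → ZMod 2} (hL : Q.IsLogicalBasis L) :
    ∃ γ : ℂ, postMeasure (surface n mx mz σ) 0 (atgState H T) =
      γ • Q.encode L (ghzPow m k) := by
  set A : ℂ := (1 / (Real.sqrt 2 : ℂ)) ^ k * ((1 / (Real.sqrt 2 : ℂ)) ^ mx) ^ m with hA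
  have hA0 : A ≠ 0 := by
    have h : (1 / (Real.sqrt 2 : ℂ)) ≠ 0 := by
      simp
    exact mul_ne_zero (pow_ne_zero _ h) (pow_ne_zero _ (pow_ne_zero _ h))
  refine ⟨postMeasure (surface n mx mz σ) 0 (atgState H T) 0 / A, funext fun y => ?_⟩
  rw [postMeasure_zero_apply hσ ⟨0, hm⟩, Pi.smul_apply, encode_ghzPow_apply hm ⟨0, hm⟩ hL,
    ghzSupport_eq hQ, smul_eq_mul]
  split_ifs
  · rw [div_mul_cancel₀ _ hA0]
  · rw [mul_zero]

/-- The state of the unmeasured qubits for the outcome `(Adj η)_bulk`. -/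
theorem postMeasure_outcome {Q : CSSCode n mx mz} (hQ : H.SameCode Q) (hσ : Function.Injective σ)
    (hm : 1 ≤ m) {L : Fin k → Fin n → ZMod 2} (hL : Q.IsLogicalBasis L)
    (η : ATGVertex n mx mz T → ZMod 2) :
    ∃ γ : ℂ, postMeasure (surface n mx mz σ) (toBulk _ (adjMul H η)) (atgState H T) =
      γ • applyPauli (η ∘ surface n mx mz σ, adjMul H η ∘ surface n mx mz σ)
        (Q.encode L (ghzPow m k)) := by
  obtain ⟨γ, hγ⟩ := postMeasure_adj (surface_injective (n := n) (mx := mx) (mz := mz) hσ)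
    (atgRel_asymm H T) η
  obtain ⟨γ', hγ'⟩ := postMeasure_zero_eq (T := T) (σ := σ) hQ hσ hm hL
  refine ⟨γ * γ', ?_⟩
  change postMeasure _ _ (atgState H T) = γ • applyPauli _ (postMeasure _ 0 (atgState H T)) at hγ
  rw [hγ'] at hγ
  rw [mul_smul, ← applyPauli_smul]
  exact hγ

end State

/-! ### The residual error -/

section Residual

variable {n mx mz T m k : ℕ} {H : CSSCode n mx mz} {σ : Fin m → Fin (T + 1)}

/-- The Pauli error on the unmeasured qubits contained in a vector on all error positions. -/
def surfacePart (σ : Fin m → Fin (T + 1)) (y : ErrorPos n mx mz T m → ZMod 2) :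
    PauliOp (Fin m × Fin n) :=
  (fun q => y (.inr q), fun q => y (.inl (surface n mx mz σ q)))

lemma surfacePart_add (y y' : ErrorPos n mx mz T m → ZMod 2) :
    surfacePart σ (y + y') = surfacePart σ y + surfacePart σ y' := rfl

lemma syndrome_add (H : CSSCode n mx mz) (E F : PauliOp (Fin m × Fin n)) :
    H.syndrome (E + F) = H.syndrome E + H.syndrome F := by
  funext j
  exact Prod.ext (Matrix.mulVec_add H.HX (blk E.2 j) (blk F.2 j))
    (Matrix.mulVec_add H.HZ (blk E.1 j) (blk F.1 j))

/-- With nothing in the bulk, the checks touching the unmeasured layers become the code syndromes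
and all others are vacuous. -/
lemma mem_localSub_iff_syndrome_eq_zero {y : ErrorPos n mx mz T m → ZMod 2}
    (hy : restr (bulkPos n mx mz σ) y = 0) :
    y ∈ localSub H σ ↔ H.syndrome (surfacePart σ y) = 0 := by
  have h0 : ∀ v, v ∉ Set.range (surface n mx mz σ) → y (.inl v) = 0 := by
    intro v hv
    have h1 := congrFun hy (.inl v)
    rwa [restr, if_pos (inl_mem_bulkPos.mpr hv)] at h1
  have hev : ∀ j, ev (y ∘ .inl) (σ j) = blk (surfacePart σ y).2 j := fun j =>
    (blk_comp_surface (σ := σ) (y ∘ .inl) j).symm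
  have hev0 : ∀ r, (∀ j, (σ j).val ≠ r) → ev (y ∘ .inl) r = 0 := by
    intro r hr
    funext i
    simp only [ev, Function.comp]
    split_ifs with h
    · exact h0 _ (notMem_range_surface_iff.mpr fun j hj => hr j (by
        change 2 * (σ j).val = 2 * r at hj; omega))
    · rfl
  have hod : ∀ r, od (y ∘ .inl) r = 0 := by
    rintro (_ | r)
    · rfl
    · funext i
      simp only [od, Function.comp]
      split_ifs with h
      · exact h0 _ (notMem_range_surface_iff.mpr fun j hj => by
          change 2 * (σ j).val = 2 * r + 1 at hj; omega)
      · rfl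
  have hzc : ∀ r, zc (y ∘ .inl) r = 0 := by
    intro r
    funext c
    simp only [zc, Function.comp]
    split_ifs with h
    · exact h0 _ (by rintro ⟨q, hq⟩; simp [surface] at hq)
    · rfl
  have hxc : ∀ r, xc (y ∘ .inl) r = 0 := by
    rintro (_ | r)
    · rfl
    · funext c
      simp only [xc, Function.comp]
      split_ifs with h
      · exact h0 _ (by rintro ⟨q, hq⟩; simp [surface] at hq)
      · rfl
  rw [mem_localSub_iff]
  simp only [hod, hzc, hxc, Matrix.mulVec_zero, add_zero, implies_true, true_and]
  constructor
  · rintro ⟨h1, h2⟩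
    funext j
    refine Prod.ext ?_ (h2 j)
    have h3 := h1 (σ j) (by omega)
    rw [hev] at h3
    exact h3
  · intro h
    refine ⟨fun r _ => ?_, fun j => congrArg Prod.snd (congrFun h j)⟩
    by_cases hr : ∃ j, (σ j).val = r
    · obtain ⟨j, rfl⟩ := hr
      rw [hev]
      exact congrArg Prod.fst (congrFun h j)
    · rw [hev0 r fun j hj => hr ⟨j, hj⟩, Matrix.mulVec_zero]

lemma card_suppF_eq (hσ : Function.Injective σ) (y : ErrorPos n mx mz T m → ZMod 2) :
    (suppF y).card = (suppF (restr (bulkPos n mx mz σ) y)).card +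
      (hammingNorm (surfacePart σ y).1 + hammingNorm (surfacePart σ y).2) := by
  have h1 : ∀ z : ErrorPos n mx mz T m → ZMod 2, (suppF z).card = hammingNorm z := fun _ => rfl
  have h2 : ∀ z : ErrorPos n mx mz T m → ZMod 2, hammingNorm (fun v => z (.inl v)) =
      (∑ v : Bulk (surface n mx mz σ), if z (.inl v.1) ≠ 0 then 1 else 0) +
        hammingNorm (surfacePart σ z).2 := by
    intro z
    simp only [hammingNorm, Finset.card_filter]
    exact sum_eq_sum_bulk_add (surface_injective hσ) fun v => if z (.inl v) ≠ 0 then 1 else 0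
  have h3 : surfacePart σ (restr (bulkPos n mx mz σ) y) = 0 := by
    refine Prod.ext (funext fun q => if_neg inr_notMem_bulkPos) (funext fun q => if_neg fun h => ?_)
    exact inl_mem_bulkPos.mp h ⟨q, rfl⟩
  have h4 : hammingNorm (fun q => restr (bulkPos n mx mz σ) y (.inr q)) = 0 :=
    hammingNorm_eq_zero.mpr (congrArg Prod.fst h3)
  have h5 : ∀ v : Bulk (surface n mx mz σ),
      restr (bulkPos n mx mz σ) y (.inl v.1) = y (.inl v.1) := fun v =>
    if_pos (inl_mem_bulkPos.mpr v.2)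
  rw [h1, h1, hammingNorm_sum (A := ATGVertex n mx mz T),
    hammingNorm_sum (A := ATGVertex n mx mz T) (restr _ y), h2, h2, h3, h4]
  simp only [h5]
  have h6 : hammingNorm (0 : PauliOp (Fin m × Fin n)).2 = 0 := hammingNorm_zero
  rw [h6]
  change _ + _ + hammingNorm (surfacePart σ y).1 = _
  omega

/-- The vector with bulk part `t` and surface part `E`. -/
def joinError (σ : Fin m → Fin (T + 1)) (t : Bulk (surface n mx mz σ) → ZMod 2)
    (E : PauliOp (Fin m × Fin n)) : ErrorPos n mx mz T m → ZMod 2 :=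
  Sum.elim (Function.extend (surface n mx mz σ) E.2 fun v => bulkExt σ t (.inl v)) E.1

lemma surfacePart_joinError (hσ : Function.Injective σ)
    (t : Bulk (surface n mx mz σ) → ZMod 2) (E : PauliOp (Fin m × Fin n)) :
    surfacePart σ (joinError σ t E) = E :=
  Prod.ext rfl (funext fun q =>
    (surface_injective (n := n) (mx := mx) (mz := mz) hσ).extend_apply E.2
      (fun v => bulkExt σ t (.inl v)) q)

lemma restr_joinError (t : Bulk (surface n mx mz σ) → ZMod 2) (E : PauliOp (Fin m × Fin n)) :
    restr (bulkPos n mx mz σ) (joinError σ t E) = bulkExt σ t := by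
  funext u
  by_cases hu : u ∈ bulkPos n mx mz σ
  · rw [restr, if_pos hu]
    rcases u with u | u
    · exact Function.extend_apply' E.2 (fun v => bulkExt σ t (.inl v)) u fun h =>
        inl_mem_bulkPos.mp hu h
    · exact absurd hu inr_notMem_bulkPos
  · rw [restr, if_neg hu, bulkExt_of_notMem _ hu]

/-- The errors on the unmeasured qubits that are equivalent to the measured bulk error `t`. -/
def IsResidual (H : CSSCode n mx mz) (σ : Fin m → Fin (T + 1))
    (t : Bulk (surface n mx mz σ) → ZMod 2) (R : PauliOp (Fin m × Fin n)) : Prop :=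
  ∃ η : ATGVertex n mx mz T → ZMod 2, toBulk (surface n mx mz σ) (adjMul H η) = t ∧
    R = (η ∘ surface n mx mz σ, adjMul H η ∘ surface n mx mz σ)

/-- Minimizing over a coset gives a correction that depends on the coset only. The outcome and the
error that caused it therefore yield the same correction. -/
lemma exists_minimal_representatives {B : Type} (N : Submodule (ZMod 2) (B → ZMod 2))
    (wt : (B → ZMod 2) → ℕ) :
    ∃ a : (B → ZMod 2) → B → ZMod 2, (∀ s, s + a s ∈ N) ∧ (∀ s s', s + s' ∈ N → a s = a s') ∧
      ∀ s, ∀ z ∈ N, wt (a s) ≤ wt (a s + z) := by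
  have h1 : ∀ q : (B → ZMod 2) ⧸ N, ∃ t, N.mkQ t = q ∧ ∀ t', N.mkQ t' = q → wt t ≤ wt t' := by
    intro q
    obtain ⟨t, ht, hmin⟩ := (measure wt).wf.has_min {t | N.mkQ t = q} (N.mkQ_surjective q)
    exact ⟨t, ht, fun t' ht' => not_lt.mp (hmin t' ht')⟩
  choose f hf hmin using h1
  have h2 : ∀ s s' : B → ZMod 2, N.mkQ s = N.mkQ s' ↔ s + s' ∈ N := by
    intro s s'
    rw [Submodule.mkQ_apply, Submodule.mkQ_apply, Submodule.Quotient.eq, ZModModule.sub_eq_add]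
  refine ⟨fun s => f (N.mkQ s), fun s => (h2 _ _).mp (hf _).symm, fun s s' h => ?_,
    fun s z hz => hmin _ _ ?_⟩
  · change f _ = f _
    rw [(h2 _ _).mpr h]
  · have h3 : N.mkQ z = 0 := (Submodule.Quotient.mk_eq_zero N).mpr hz
    rw [map_add, h3, add_zero, hf]

/-- The conditions under which decoding succeeds: small errors in the bulk can be pushed to the
unmeasured qubits, and small errors are not logical. -/
structure GoodScale (H : CSSCode n mx mz) (σ : Fin m → Fin (T + 1)) (M : ℝ) : Prop where
  push : ∀ z ∈ bulkSub H σ, ((suppF z).card : ℝ) < M → ∃ y ∈ localSub H σ,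
    restr (bulkPos n mx mz σ) y = z ∧ (suppF y).card ≤ 2 * (suppF z).card
  log : ∀ x ∈ localSub H σ, ((suppF x).card : ℝ) < M → x ∈ fullSub H σ

/-- The separation `T/m` refers to layers, while `σ` counts every second one. This explains the
division by 2. -/
lemma goodScale (hσ : WellSeparated σ) (hm : 1 ≤ m) {Q : CSSCode n mx mz}
    (hQ : H.SameCode Q) {d : ℕ} (hd : Q.HasParams k d) :
    GoodScale H σ (min ((T : ℝ) / m) d / 2) := by
  have hj₀ : (σ ⟨0, hm⟩).val = 0 := hσ.first _ rfl
  constructor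
  · intro z hz hcard
    have h1 : ((suppF z).card : ℝ) * 2 < T / m := by
      have := min_le_left ((T : ℝ) / m) d; linarith
    refine exists_push hσ.mono hj₀ hz (fun j j' h => ?_) fun h => ?_
    · have h2 := hσ.gap j j' h
      have h3 : ((suppF z).card : ℝ) + (σ j).val < (σ j').val := by
        push_cast at h2; linarith
      exact_mod_cast h3
    · subst h
      have h3 : ((suppF z).card : ℝ) * 2 < T := by simpa using h1
      have h4 : (suppF z).card * 2 < T := by exact_mod_cast h3
      omega
  · intro x hx hcard
    obtain ⟨-, -, hmin⟩ := hd
    have h1 : ((suppF x).card : ℝ) * 2 < d := by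
      have := min_le_right ((T : ℝ) / m) d; linarith
    have h2 : (suppF x).card * 2 < d := by exact_mod_cast h1
    refine mem_fullSub_of_card_lt hσ.mono.injective hj₀ (d := d) (fun y hy hyd => ?_)
      (fun y hy hyd => ?_) hx (by omega)
    · by_contra h
      rw [hQ.1] at h
      rw [H.HZ_mulVec_eq_zero_iff, hQ.2, ← Q.HZ_mulVec_eq_zero_iff] at hy
      exact absurd (hmin ⟨y, Or.inl ⟨hy, h⟩, rfl⟩) (not_le.mpr hyd)
    · by_contra h
      rw [hQ.2] at h
      rw [H.HX_mulVec_eq_zero_iff, hQ.1, ← Q.HX_mulVec_eq_zero_iff] at hy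
      exact absurd (hmin ⟨y, Or.inr ⟨hy, h⟩, rfl⟩) (not_le.mpr hyd)

lemma suppF_bulkExt (s : Bulk (surface n mx mz σ) → ZMod 2)
    (a : Bulk (surface n mx mz σ) → ZMod 2) :
    suppF (bulkExt σ s) =
      errs (fun v : Bulk (surface n mx mz σ) => (Sum.inl v.1 : ErrorPos n mx mz T m)) (a, s) := by
  ext u
  simp only [mem_suppF, errs, Finset.mem_image, Finset.mem_filter, Finset.mem_univ, true_and]
  constructor
  · intro h
    have hu : u ∈ bulkPos n mx mz σ := by
      by_contra hu
      exact h (bulkExt_of_notMem s hu)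
    rcases u with u | u
    · exact ⟨⟨u, inl_mem_bulkPos.mp hu⟩, by rwa [← bulkExt_bulk s ⟨u, inl_mem_bulkPos.mp hu⟩], rfl⟩
    · exact absurd hu inr_notMem_bulkPos
  · rintro ⟨v, hv, rfl⟩
    rwa [bulkExt_bulk]

/-- Joining the bulk vector `t` with the surface error `E` gives an undetected error. Minimality of
the bulk correction `t + P.2` and of `E` are the two minimality hypotheses of
`residual_of_small_clusters`. -/
theorem isResidual_of_sparseErrors (hσ : Function.Injective σ) {j₀ : Fin m}
    (hj₀ : (σ j₀).val = 0) {M : ℝ} (hM : GoodScale H σ M)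
    {P : PauliOp (Bulk (surface n mx mz σ))} {t : Bulk (surface n mx mz σ) → ZMod 2}
    (hmin : ∀ z ∈ outcomeSub H σ,
      (suppF (bulkExt σ (t + P.2))).card ≤ (suppF (bulkExt σ (t + P.2 + z))).card)
    {R E : PauliOp (Fin m × Fin n)} (hR : IsResidual H σ t R)
    (hE : H.syndrome E = H.syndrome R)
    (hE' : ∀ E', H.syndrome E' = H.syndrome R →
      hammingNorm E.1 ≤ hammingNorm E'.1 ∧ hammingNorm E.2 ≤ hammingNorm E'.2)
    (hP : P ∈ sparseErrors (fun v : Bulk (surface n mx mz σ) =>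
      (Sum.inl v.1 : ErrorPos n mx mz T m)) (checkGraph (checkMatrix H σ)) M) :
    IsResidual H σ t E ∧
      ∀ S ⊆ suppF (joinError σ t E) \ bulkPos n mx mz σ,
        ∃ W, Rooted (checkGraph (checkMatrix H σ)) S W ∧
          W.card ≤ 4 * (W ∩ errs (fun v : Bulk (surface n mx mz σ) =>
            (Sum.inl v.1 : ErrorPos n mx mz T m)) P).card ∧
          S.card ≤ 2 * (W ∩ errs (fun v : Bulk (surface n mx mz σ) =>
            (Sum.inl v.1 : ErrorPos n mx mz T m)) P).card := by
  obtain ⟨η, hη, rfl⟩ := hR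
  -- Any two undetected completions of one bulk vector differ by an undetected error on the surface,
  -- so they have the same surface syndrome.
  have hsyn : ∀ y ∈ localSub H σ, restr (bulkPos n mx mz σ) y = bulkExt σ t →
      H.syndrome (surfacePart σ y) =
        H.syndrome (η ∘ surface n mx mz σ, adjMul H η ∘ surface n mx mz σ) := by
    intro y hy hyt
    have h1 := Submodule.add_mem _ hy (fullSub_le_localSub (H := H) (σ := σ) ⟨η, rfl⟩)
    rw [mem_localSub_iff_syndrome_eq_zero, surfacePart_add, syndrome_add] at h1
    · rw [← ZModModule.sub_eq_add, sub_eq_zero] at h1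
      exact h1
    · rw [restr_add, hyt, ← bulkExt_toBulk, hη, ZModModule.add_self]
  have hx : joinError σ t E ∈ localSub H σ := by
    have h1 : joinError σ t E + fullError H σ η ∈ localSub H σ := by
      rw [mem_localSub_iff_syndrome_eq_zero, surfacePart_add, syndrome_add,
        surfacePart_joinError hσ, hE]
      · exact ZModModule.add_self _
      · rw [restr_add, restr_joinError, ← bulkExt_toBulk, hη, ZModModule.add_self]
    have h2 := Submodule.add_mem _ h1 (fullSub_le_localSub (H := H) (σ := σ) ⟨η, rfl⟩)
    rwa [add_assoc, ZModModule.add_self, add_zero] at h2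
  have hclosed : ∀ z (c : CheckIdx mx mz T m) K, (checkMatrix H σ *ᵥ z) c = 0 →
      ClosedIn (checkGraph (checkMatrix H σ)) (suppF z) K →
      (checkMatrix H σ *ᵥ restr K z) c = 0 := fun z c K hz hK => mulVec_restr_eq_zero _ hz hK
  obtain ⟨h1, h2⟩ := residual_of_small_clusters (checkGraph (checkMatrix H σ))
    (bulkPos n mx mz σ) (bulkSub H σ) (localSub H σ) (fullSub H σ) M
    (fun z hz K hK => ⟨fun u hu => by
      rw [restr, hz.1 u hu, ite_self], fun c hc => hclosed z c K (hz.2 c hc) hK⟩)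
    (fun z hz K hK => LinearMap.mem_ker.mpr (funext fun c =>
      hclosed z c K (congrFun (LinearMap.mem_ker.mp hz) c) hK))
    (fun x hx => restr_mem_bulkSub hx) hM.push hM.log (bulkExt σ P.2) (joinError σ t E) hx
    (fun z hz => by
      have hzext : z = bulkExt σ (fun v : Bulk (surface n mx mz σ) => z (.inl v.1)) := by
        funext u
        by_cases hu : u ∈ bulkPos n mx mz σ
        · rcases u with u | u
          · exact (bulkExt_bulk (σ := σ) (fun v => z (.inl v.1)) ⟨u, inl_mem_bulkPos.mp hu⟩).symm
          · exact absurd hu inr_notMem_bulkPos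
        · rw [hz.1 u hu, bulkExt_of_notMem _ hu]
      rw [hzext] at hz ⊢
      rw [restr_joinError, ← bulkExt_add, ← bulkExt_add]
      exact hmin _ ((mem_outcomeSub_iff hσ hj₀ _).mpr hz))
    (fun x' hx' hres => by
      rw [restr_joinError] at hres
      have h3 := hE' _ (hsyn x' hx' hres)
      rw [card_suppF_eq hσ, card_suppF_eq hσ x', restr_joinError, hres, surfacePart_joinError hσ]
      omega)
    (by rw [suppF_bulkExt _ P.1]; exact hP)
  rw [suppF_bulkExt _ P.1] at h2
  refine ⟨?_, h2⟩
  obtain ⟨η', hη'⟩ := h1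
  refine ⟨η', ?_, ?_⟩
  · have h3 := restr_joinError t E
    rw [← hη', ← bulkExt_toBulk] at h3
    funext v
    rw [← bulkExt_bulk t v, ← h3, bulkExt_bulk]
  · rw [← surfacePart_joinError hσ t E, ← hη']
    rfl

end Residual

/-! ### Recovery and residual errors -/

section Recovery

variable {n mx mz T m k : ℕ} {H : CSSCode n mx mz} {σ : Fin m → Fin (T + 1)}

lemma IsResidual.add {t t' : Bulk (surface n mx mz σ) → ZMod 2} {R R' : PauliOp (Fin m × Fin n)}
    (h : IsResidual H σ t R) (h' : IsResidual H σ t' R') : IsResidual H σ (t + t') (R + R') := by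
  obtain ⟨η, rfl, rfl⟩ := h
  obtain ⟨η', rfl, rfl⟩ := h'
  exact ⟨η + η', by rw [adjMul_add]; rfl, by rw [adjMul_add]; rfl⟩

lemma exists_isResidual {t : Bulk (surface n mx mz σ) → ZMod 2} (ht : t ∈ outcomeSub H σ) :
    ∃ R, IsResidual H σ t R := by
  obtain ⟨η, hη⟩ := ht
  exact ⟨_, η, hη, rfl⟩

lemma IsResidual.postMeasure_eq {Q : CSSCode n mx mz} (hQ : H.SameCode Q)
    (hσ : Function.Injective σ) (hm : 1 ≤ m) {L : Fin k → Fin n → ZMod 2}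
    (hL : Q.IsLogicalBasis L) {t : Bulk (surface n mx mz σ) → ZMod 2}
    {R : PauliOp (Fin m × Fin n)} (h : IsResidual H σ t R) :
    ∃ γ : ℂ, postMeasure (surface n mx mz σ) t (atgState H T) =
      γ • applyPauli R (Q.encode L (ghzPow m k)) := by
  obtain ⟨η, rfl, rfl⟩ := h
  exact postMeasure_outcome hQ hσ hm hL η

/-- Places a set of unmeasured qubits among the error positions: those in `A` as positions of `Z`
errors, the others as positions of `X` errors. -/
def rootSet (σ : Fin m → Fin (T + 1)) (S A : Finset (Fin m × Fin n)) :
    Finset (ErrorPos n mx mz T m) :=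
  A.image (fun q => .inl (surface n mx mz σ q)) ∪ (S \ A).image .inr

lemma card_rootSet (hσ : Function.Injective σ) {S A : Finset (Fin m × Fin n)} (hA : A ⊆ S) :
    (rootSet (mx := mx) (mz := mz) σ S A).card = S.card := by
  rw [rootSet, Finset.card_union_of_disjoint, Finset.card_image_of_injective,
    Finset.card_image_of_injective _ Sum.inr_injective, add_comm,
    Finset.card_sdiff_add_card_eq_card hA]
  · exact Sum.inl_injective.comp (surface_injective hσ)
  · rw [Finset.disjoint_left]
    intro u hu hu'
    obtain ⟨q, -, rfl⟩ := Finset.mem_image.mp hu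
    obtain ⟨q', -, h⟩ := Finset.mem_image.mp hu'
    exact Sum.inr_ne_inl h

/-- The recovery, and the residual error of every bulk error. -/
theorem exists_recovery {Q : CSSCode n mx mz} (hQ : H.SameCode Q)
    (hσ : Function.Injective σ) {j₀ : Fin m} (hj₀ : (σ j₀).val = 0)
    {L : Fin k → Fin n → ZMod 2} (hL : Q.IsLogicalBasis L) {M : ℝ} (hM : GoodScale H σ M)
    {dec : (Fin m → (Fin mx → ZMod 2) × (Fin mz → ZMod 2)) → PauliOp (Fin m × Fin n)}
    (hdec : H.IsMinWeightDecoder dec) :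
    ∃ (Rec : (Bulk (surface n mx mz σ) → ZMod 2) → PauliOp (Fin m × Fin n))
      (Rep : PauliOp (Bulk (surface n mx mz σ)) → PauliOp (Fin m × Fin n)),
      Prepares (surface n mx mz σ) (atgState H T) (Q.encode L (ghzPow m k)) Rec Rep ∧
      ∀ P ∈ sparseErrors (fun v : Bulk (surface n mx mz σ) =>
          (Sum.inl v.1 : ErrorPos n mx mz T m)) (checkGraph (checkMatrix H σ)) M,
        Rep P = dec (H.syndrome (Rep P)) ∧
        ∀ S : Finset (Fin m × Fin n), (S : Set (Fin m × Fin n)) ⊆ supp (Rep P) →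
          ∃ A ⊆ S, ∃ W, Rooted (checkGraph (checkMatrix H σ)) (rootSet σ S A) W ∧
            W.card ≤ 4 * (W ∩ errs (fun v : Bulk (surface n mx mz σ) =>
              (Sum.inl v.1 : ErrorPos n mx mz T m)) P).card ∧
            S.card ≤ 2 * (W ∩ errs (fun v : Bulk (surface n mx mz σ) =>
              (Sum.inl v.1 : ErrorPos n mx mz T m)) P).card := by
  obtain ⟨a, ha, hconst, hmin⟩ := exists_minimal_representatives (outcomeSub H σ)
    fun s => (suppF (bulkExt σ s)).card
  choose Rec hRec using fun s => exists_isResidual (ha s)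
  -- The residual error is determined only up to stabilizers of the target. If this class contains
  -- an output of the decoder, that output is chosen.
  have hRep : ∀ P : PauliOp (Bulk (surface n mx mz σ)), ∃ R, IsResidual H σ (P.2 + a P.2) R ∧
      ∀ E, IsResidual H σ (P.2 + a P.2) E → E = dec (H.syndrome E) → R = dec (H.syndrome R) := by
    intro P
    by_cases h : ∃ E, IsResidual H σ (P.2 + a P.2) E ∧ E = dec (H.syndrome E)
    · obtain ⟨E, hE, hE'⟩ := h
      exact ⟨E, hE, fun _ _ _ => hE'⟩
    · exact ⟨Rec P.2, hRec P.2, fun E hE hE' => absurd ⟨E, hE, hE'⟩ h⟩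
  choose Rep hRep hRep' using hRep
  refine ⟨Rec, Rep, fun P s => ?_, fun P hP => ?_⟩
  · obtain ⟨γ, hγ⟩ := postMeasure_extendBulk (surface_injective (n := n) (mx := mx) (mz := mz) hσ)
      s P (atgState H T)
    rw [hγ]
    by_cases hs : s + P.2 ∈ outcomeSub H σ
    -- `s` and `P.2` lie in one coset of possible outcomes, so their corrections cancel and `Rec s +
    -- Rep P` is the surface error of the outcome `s + P.2`. Applying `Rec s` leaves `Rep P`.
    · have h1 := (hRec s).add (hRep P)
      have h2 : s + a s + (P.2 + a P.2) = s + P.2 := by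
        rw [hconst s P.2 hs, add_add_add_comm, ZModModule.add_self, add_zero]
      rw [h2] at h1
      obtain ⟨γ', hγ'⟩ := h1.postMeasure_eq hQ hσ j₀.pos hL
      rw [hγ', applyPauli_smul, applyPauli_smul, applyPauli_applyPauli, ← add_assoc,
        ZModModule.add_self, zero_add, smul_smul, smul_smul]
      exact ⟨_, rfl⟩
    · rw [postMeasure_eq_zero hσ hj₀ hs, smul_zero]
      refine ⟨0, ?_⟩
      have h1 := applyPauli_smul (Rec s) 0 (0 : QState (Fin m × Fin n))
      rw [zero_smul, zero_smul] at h1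
      rw [zero_smul, h1]
  · have hmin' : ∀ z ∈ outcomeSub H σ, (suppF (bulkExt σ (P.2 + a P.2 + P.2))).card ≤
        (suppF (bulkExt σ (P.2 + a P.2 + P.2 + z))).card := by
      have h1 : P.2 + a P.2 + P.2 = a P.2 := by
        rw [add_right_comm, ZModModule.add_self, zero_add]
      rw [h1]
      exact hmin P.2
    -- The first application shows that the decoder's output is itself a residual error, so `Rep P`
    -- is such an output. The second then applies to `Rep P`, now known to have minimum weight.
    obtain ⟨h1, -⟩ := isResidual_of_sparseErrors hσ hj₀ hM hmin' (hRep P) (hdec (Rep P)).1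
      (fun E' hE' => hE' ▸ (hdec E').2) hP
    have h2 := hRep' P _ h1 (by rw [(hdec (Rep P)).1])
    refine ⟨h2, fun S hS => ?_⟩
    obtain ⟨-, h3⟩ := isResidual_of_sparseErrors hσ hj₀ hM hmin' (hRep P) rfl
      (fun E' hE' => by
        rw [h2, ← hE']
        exact (hdec E').2) hP
    -- Qubits carrying a Z error are represented by their Z position, the remaining ones by their X
    -- position.
    refine ⟨S.filter fun q => (Rep P).2 q ≠ 0, Finset.filter_subset _ _, ?_⟩
    have h4 := h3 (rootSet σ S (S.filter fun q => (Rep P).2 q ≠ 0)) fun u hu => by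
      rw [Finset.mem_sdiff, mem_suppF]
      rcases Finset.mem_union.mp hu with hu | hu
      · obtain ⟨q, hq, rfl⟩ := Finset.mem_image.mp hu
        refine ⟨?_, fun h => inl_mem_bulkPos.mp h ⟨q, rfl⟩⟩
        have h5 := congrFun (congrArg Prod.snd
          (surfacePart_joinError hσ (P.2 + a P.2) (Rep P))) q
        exact fun h => (Finset.mem_filter.mp hq).2 (h5.symm.trans h)
      · obtain ⟨q, hq, rfl⟩ := Finset.mem_image.mp hu
        rw [Finset.mem_sdiff, Finset.mem_filter, not_and] at hq
        exact ⟨(hS hq.1).resolve_right (hq.2 hq.1), inr_notMem_bulkPos⟩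
    rwa [card_rootSet hσ (Finset.filter_subset _ _)] at h4

/-- The probability that the residual error covers a given set of qubits. -/
theorem prob_supp_residual_le {ℓ : ℕ} (hσ : Function.Injective σ) (hH : H.Sparse ℓ)
    {D : PMF (PauliOp (Bulk (surface n mx mz σ)))} {p α : ℝ} (hp0 : 0 ≤ p)
    (hD : IsLocalStochastic D p) (hα : 0 < α)
    (hαΔ : 2 ^ ((2 * ℓ + 4) * (ℓ + 2) + 1) * α = 1 / 16) (hp : p < α ^ 4)
    (Rep : PauliOp (Bulk (surface n mx mz σ)) → PauliOp (Fin m × Fin n))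
    (Success : Set (PauliOp (Bulk (surface n mx mz σ))))
    (hRep : ∀ P ∈ Success, ∀ S : Finset (Fin m × Fin n),
      (S : Set (Fin m × Fin n)) ⊆ supp (Rep P) →
        ∃ A ⊆ S, ∃ W, Rooted (checkGraph (checkMatrix H σ)) (rootSet σ S A) W ∧
          W.card ≤ 4 * (W ∩ errs (fun v : Bulk (surface n mx mz σ) =>
            (Sum.inl v.1 : ErrorPos n mx mz T m)) P).card ∧
          S.card ≤ 2 * (W ∩ errs (fun v : Bulk (surface n mx mz σ) =>
            (Sum.inl v.1 : ErrorPos n mx mz T m)) P).card)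
    {S : Finset (Fin m × Fin n)} (hS : S.Nonempty) :
    prob D ({P | (S : Set (Fin m × Fin n)) ⊆ supp (Rep P)} ∩ Success) ≤
      1 / 2 * Real.sqrt (p / α ^ 4) ^ S.card := by
  refine le_trans (prob_mono D ?_) (prob_rooted_le (fun v v' h => Subtype.ext (Sum.inl_injective h))
    hp0 hD (checkGraph (checkMatrix H σ))
    (checkGraph_degree_le _ (hammingNorm_row_le hH σ) (hammingNorm_col_le hH hσ))
    hα hαΔ hp (Finset.card_pos.mpr hS) (S.powerset.image (rootSet σ S))
    (Finset.card_image_le.trans_eq (Finset.card_powerset S)) ?_)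
  · rintro P ⟨hPS, hP⟩
    obtain ⟨A, hA, W, hW, h1, h2⟩ := hRep P hP S hPS
    exact ⟨_, Finset.mem_image_of_mem _ (Finset.mem_powerset.mpr hA), W, hW, h1, h2⟩
  · intro S' hS'
    obtain ⟨A, hA, rfl⟩ := Finset.mem_image.mp hS'
    exact card_rootSet hσ (Finset.mem_powerset.mp hA)

lemma card_errorPos_le (H : CSSCode n mx mz) (hT : 1 ≤ T) (hmT : m ≤ T + 1) :
    Fintype.card (ErrorPos n mx mz T m) ≤ 8 * (n * T) := by
  rw [Fintype.card_sum, Fintype.card_prod, Fintype.card_fin, Fintype.card_fin]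
  have h1 := H.card_atgVertex_le hT
  have h2 : m * n ≤ 2 * T * n := Nat.mul_le_mul_right n (by omega)
  calc _ ≤ 6 * n * T + 2 * T * n := Nat.add_le_add h1 h2
    _ = 8 * (n * T) := by ring

lemma CSSCode.HasParams.pos {Q : CSSCode n mx mz} {d : ℕ} (h : Q.HasParams k d) : 0 < d := by
  obtain ⟨-, ⟨y, hy, hyd⟩, -⟩ := h
  rw [← hyd, hammingNorm_pos_iff]
  rintro rfl
  rcases hy with hy | hy <;> exact hy.2 (Submodule.zero_mem _)

end Recovery

end
end SingleShot

/-! ### Choice of constants and conclusion. -/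

theorem mainTheorem2 :
    ∃ c K : ℝ, 0 < c ∧ 0 < K ∧
    ∀ ℓ : ℕ, 1 ≤ ℓ →
    ∃ pstar C : ℝ, 0 < pstar ∧ pstar < 1 ∧ 0 < C ∧ C * Real.sqrt pstar ≤ 1 ∧
    ∀ (T m n mx mz k d : ℕ) (Q : CSSCode n mx mz), 1 ≤ T → 1 ≤ m → m ≤ T + 1 →
      Q.HasParams k d → Q.IsLDPC ℓ →
      -- sparse parity check matrices of the code and well-separated layers exist
      (∃ H : CSSCode n mx mz, H.SameCode Q ∧ H.Sparse ℓ) ∧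
      (∃ σ : Fin m → Fin (T + 1), WellSeparated σ) ∧
      ∀ H : CSSCode n mx mz, H.SameCode Q → H.Sparse ℓ →
        -- the circuit preparing the ATG state, its size and its depth
        (Fintype.card (ATGVertex n mx mz T) : ℝ) ≤ K * ℓ * n * T ∧
        ∃ W : Circuit (ATGVertex n mx mz T), (W.depth : ℝ) ≤ K * (ℓ : ℝ) ^ 2 ∧
          W.run (zeroState (ATGVertex n mx mz T)) = atgState H T ∧
          ∀ L : Fin k → Fin n → ZMod 2, Q.IsLogicalBasis L →
          ∀ σ : Fin m → Fin (T + 1), WellSeparated σ →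
          ∃ (Rec : (Bulk (surface n mx mz σ) → ZMod 2) → PauliOp (Fin m × Fin n))
            (Rep : PauliOp (Bulk (surface n mx mz σ)) → PauliOp (Fin m × Fin n))
            (dec : (Fin m → (Fin mx → ZMod 2) × (Fin mz → ZMod 2)) → PauliOp (Fin m × Fin n))
            (Success : Set (PauliOp (Bulk (surface n mx mz σ)))),
            -- the procedure outputs the encoded state up to the residual error
            Prepares (surface n mx mz σ) (W.run (zeroState (ATGVertex n mx mz T)))
              (Q.encode L (ghzPow m k)) Rec Rep ∧
            -- on success the residual error is free of logical errors
            H.IsMinWeightDecoder dec ∧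
            (∀ P ∈ Success, Rep P = dec (H.syndrome (Rep P))) ∧
            ∀ (p : ℝ) (D : PMF (PauliOp (Bulk (surface n mx mz σ)))), 0 ≤ p → p < pstar →
              IsLocalStochastic D p →
              -- the success probability
              1 - (n : ℝ) * T * (p / pstar) ^ (c * min ((T : ℝ) / m) (d : ℝ)) ≤ prob D Success ∧
              -- the residual noise on the success event
              (∀ S : Finset (Fin m × Fin n),
                prob D ({P | (S : Set (Fin m × Fin n)) ⊆ supp (Rep P)} ∩ Success) ≤
                  (C * Real.sqrt p) ^ S.card) ∧
              (1 / 2 ≤ prob D Success → ∀ S : Finset (Fin m × Fin n),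
                condProb D {P | (S : Set (Fin m × Fin n)) ⊆ supp (Rep P)} Success ≤
                  (C * Real.sqrt p) ^ S.card) := by
  -- Clusters are called large from size `min (T/m) d / 2` on, and a quarter of them must be errors,
  -- hence `1/8`. The constant 6 covers the `6nT` qubits and the depth `3 + 2ℓ² ≤ 6ℓ²`.
  refine ⟨1 / 8, 6, by norm_num, by norm_num, fun ℓ hℓ => ?_⟩
  set α : ℝ := 1 / 16 / 2 ^ ((2 * ℓ + 4) * (ℓ + 2) + 1) with hαdef
  have hα : 0 < α := by positivity
  have hαΔ : 2 ^ ((2 * ℓ + 4) * (ℓ + 2) + 1) * α = 1 / 16 := by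
    rw [hαdef]; field_simp
  have hα1 : α < 1 := by
    have h1 : (1 : ℝ) ≤ 2 ^ ((2 * ℓ + 4) * (ℓ + 2) + 1) := one_le_pow₀ (by norm_num)
    nlinarith
  have hsqrt : Real.sqrt (α ^ 4) = α ^ 2 := by
    rw [show α ^ 4 = (α ^ 2) ^ 2 by ring, Real.sqrt_sq (by positivity)]
  -- Since one error has to pay for four cluster positions, the threshold is `α ^ 4`. The constant
  -- `1 / α ^ 2` makes `C √p = √(p / α ^ 4)`.
  refine ⟨α ^ 4, 1 / α ^ 2, by positivity, pow_lt_one₀ hα.le hα1 (by norm_num), by positivity,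
    by rw [hsqrt, one_div_mul_cancel (by positivity)], ?_⟩
  intro T m n mx mz k d Q hT hm hmT hd hQ
  refine ⟨Q.exists_sparse hQ, exists_wellSeparated hm hmT, fun H hHQ hH => ⟨?_, ?_⟩⟩
  · have h1 : (Fintype.card (ATGVertex n mx mz T) : ℝ) ≤ 6 * n * T := by
      exact_mod_cast H.card_atgVertex_le hT
    have h2 : (1 : ℝ) ≤ ℓ := by exact_mod_cast hℓ
    have h3 : (0 : ℝ) ≤ 6 * n * T := by positivity
    nlinarith
  obtain ⟨W, hW, hrun⟩ := exists_circuit_atgState H T hℓ hH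
  refine ⟨W, ?_, hrun, fun L hL σ hσ => ?_⟩
  · have h2 : (1 : ℝ) ≤ (ℓ : ℝ) ^ 2 := one_le_pow₀ (by exact_mod_cast hℓ)
    rw [hW]
    push_cast
    linarith
  have hσi := hσ.mono.injective
  have hM := goodScale hσ hm hHQ hd
  obtain ⟨dec, hdec⟩ := CSSCode.exists_isMinWeightDecoder H m
  obtain ⟨Rec, Rep, hprep, hRep⟩ := exists_recovery hHQ hσi (hσ.first ⟨0, hm⟩ rfl) hL hM hdec
  refine ⟨Rec, Rep, dec, sparseErrors (fun v : Bulk (surface n mx mz σ) =>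
      (Sum.inl v.1 : ErrorPos n mx mz T m)) (checkGraph (checkMatrix H σ))
      (min ((T : ℝ) / m) d / 2), hrun ▸ hprep, hdec, fun P hP => (hRep P hP).1,
    fun p D hp0 hp hD => ?_⟩
  have hres : ∀ S : Finset (Fin m × Fin n), S.Nonempty → _ := fun S hS =>
    prob_supp_residual_le hσi hH hp0 hD hα hαΔ hp Rep _ (fun P hP => (hRep P hP).2) hS
  have hrate : Real.sqrt (p / α ^ 4) = 1 / α ^ 2 * Real.sqrt p := by
    rw [Real.sqrt_div hp0, hsqrt, one_div_mul_eq_div]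
  rw [hrate] at hres
  refine ⟨?_, fun S => ?_, fun hhalf S => ?_⟩
  · have hMpos : 0 < min ((T : ℝ) / m) d / 2 := by
      have h1 : (0 : ℝ) < T := by exact_mod_cast hT
      have h2 : (0 : ℝ) < m := by exact_mod_cast hm
      have h3 : (0 : ℝ) < d := by exact_mod_cast hd.pos
      have h4 : 0 < min ((T : ℝ) / m) d := lt_min (by positivity) h3
      positivity
    refine le_trans ?_ (prob_sparseErrors_ge (fun v v' h => Subtype.ext (Sum.inl_injective h))
      hp0 hD (checkGraph (checkMatrix H σ))
      (checkGraph_degree_le _ (hammingNorm_row_le hH σ) (hammingNorm_col_le hH hσi))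
      hα hαΔ hp hMpos)
    rw [show 1 / 8 * min ((T : ℝ) / m) d = 1 / 4 * (min ((T : ℝ) / m) d / 2) by ring]
    -- The at most `8nT` roots cancel the factor `1/8` obtained for each root.
    have h5 : (Fintype.card (ErrorPos n mx mz T m) : ℝ) ≤ 8 * (n * T) := by
      exact_mod_cast card_errorPos_le H hT hmT
    refine sub_le_sub_left (mul_le_mul_of_nonneg_right (by linarith) ?_) 1
    exact Real.rpow_nonneg (by positivity) _
  · rcases S.eq_empty_or_nonempty with rfl | hS
    · simpa using prob_le_one D _
    · have h1 : 0 ≤ (1 / α ^ 2 * Real.sqrt p) ^ S.card := by positivity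
      exact (hres S hS).trans (by linarith)
  · rw [condProb, div_le_iff₀ (by linarith)]
    rcases S.eq_empty_or_nonempty with rfl | hS
    · rw [Finset.card_empty, pow_zero, one_mul]
      exact prob_mono D Set.inter_subset_right
    -- The spare factor `1/2` compensates for dividing by a success probability of at least `1/2`.
    · have h1 : 0 ≤ (1 / α ^ 2 * Real.sqrt p) ^ S.card := by positivity
      refine (hres S hS).trans ?_
      rw [mul_comm]
      exact mul_le_mul_of_nonneg_left hhalf h1
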